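/- Running times are counted on a real random-access machine: arithmetic operations ($+,-,\times,\div,\sqrt{\ }$) and comparisons of real numbers, and elementary list and array operations, cost a bounded number of unit steps each. **Input.** A non-empty finite family $T=\{P_1,\dots,P_N\}$ of polygons in the plane ("units"), each given by its list of at least three vertices (typically an approximate tiling of a simply connected region, that is, a tiling up to small gaps and overlaps), and a real parameter $\theta$. Let $E$ be the total number of edges of the polygons in $T$. **The primary algorithm** `smart_repair` is the following. 1. *Refined tiling.* Compute the fully noded union of all edges of the polygons of $T$, polygonize it into pieces $Q$ with pairwise disjoint interiors, and find for every $Q$ the set $S_Q$ of the units that contain it. Pieces with $|S_Q|=0$ are gaps (bounded case), and pieces with $|S_Q|\ge 2$ are overlaps of order $|S_Q|$. 2. *Overlaps.* Every unit first receives the pieces with $S_Q=\{i\}$. Then, for each order $2,3,\dots,N$ in increasing order, an overlap of this order is first assigned to units in $S_Q$ that are so far disconnected, if this helps to reconnect them; each remaining overlap of this order is assigned to the unit in $S_Q$ with which it shares the largest perimeter. 3. *Gaps.* The boundary of each simply connected gap is divided into sub-boundaries, one for each maximal boundary stretch along one unit. A gap with one sub-boundary is given to its unit. Otherwise each sub-boundary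 is replaced by the shortest path inside the gap between its end points, the parts cut off being given to its unit. A simplified gap with three sub-boundaries is divided by its angle bisectors through the incenter. In a simplified gap with at least four sub-boundaries, take the closest pair of non-adjacent sub-boundaries for which the shortest paths $\alpha_1,\alpha_2$, joining their end points in the two ways that follow the sides of the gap, are disjoint; divide the region between $\alpha_1$ and $\alpha_2$ between the two units along the diagonal shortest paths $\beta_1,\beta_2$, and repeat for the smaller gaps that remain. 4. *Clean-up.* For each disconnected unit, connected components that are small relative to the unit, as measured by $\theta$, are reassigned to the adjacent unit that shares the largest perimeter with them. **Optional features.** (a) The region-aware version takes a further finite family of region polygons (each with at least three vertices), includes their edges in the noded union, assigns each unit to the region that it overlaps most, and makes the repaired units nest in the regions. (b) The rook-to-queen conversion replaces each rook adjacency of length below a given real $\varepsilon$ by a point contact, by re-dividing a small disk around it into sectors. **Theorem.** There is an absolute constant $C$ such that for every such $T$: * for every $\theta$, the primary `smart_repair` algorithm on $T$ takes at most $C\,E^6$ steps; * for every choice of the parameters and of the optional features, (a), (b) or both, the `smart_repair` algorithm takes at most $C\,E^6$ steps, where in the region-aware version $E$ also counts the edges of the region polygons. -/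

import Mathlib

/-!
The `smart_repair` algorithm as a program for a real RAM, together with its step count.

Coordinates are exact real numbers. A program is a term of type `Run α`: a result together with
the number of elementary steps spent on it. An elementary step is one arithmetic operation, square
root or comparison of real numbers, one operation on indices or Booleans, one read or write of an
array cell, one pointer operation on a linked list, or one pass through the control of a loop.
All traversals of lists, all recursions and all loops are charged for each element and each pass;
the straight-line code in between has bounded length, and is charged up to a constant factor.
-/

noncomputable section

namespace SmartRepair

/-! ### Step-counting computations -/

/-- A computation: its result and the number of elementary steps it takes. -/
structure Run (α : Type) where
  val : α
  cost : ℕ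

instance : Monad Run where
  pure a := ⟨a, 0⟩
  bind m f := ⟨(f m.val).val, m.cost + (f m.val).cost⟩

/-- The value `a`, obtained with `k` elementary steps. -/
def charge {α : Type} (k : ℕ) (a : α) : Run α := ⟨a, k⟩

def foldR {α β : Type} (f : β → α → Run β) : β → List α → Run β
  | b, [] => charge 1 b
  | b, a :: l => do
    let b' ← f b a
    let _ ← charge 1 ()
    foldR f b' l

def mapR {α β : Type} (f : α → Run β) : List α → Run (List β)
  | [] => charge 1 []
  | a :: l => do
    let b ← f a
    let bs ← mapR f l
    charge 2 (b :: bs)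

/-- The elements that satisfy the test, and those that do not. -/
def partitionR {α : Type} (p : α → Run Bool) : List α → Run (List α × List α)
  | [] => charge 1 ([], [])
  | a :: l => do
    let b ← p a
    let r ← partitionR p l
    charge 2 (if b then (a :: r.1, r.2) else (r.1, a :: r.2))

def filterR {α : Type} (p : α → Run Bool) (l : List α) : Run (List α) := do
  let r ← partitionR p l
  return r.1

/-- The first element that satisfies the test. -/
def findR {α : Type} (p : α → Run Bool) : List α → Run (Option α)
  | [] => charge 1 none
  | a :: l => do
    let b ← p a
    if b then charge 1 (some a) else do
      let _ ← charge 1 ()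
      findR p l

def anyR {α : Type} (p : α → Run Bool) (l : List α) : Run Bool := do
  let r ← findR p l
  charge 1 r.isSome

/-- A loop: the body returns the new state and whether to go on; at most `fuel` passes. -/
def whileR {σ : Type} (body : σ → Run (σ × Bool)) : (fuel : ℕ) → σ → Run σ
  | 0, s => charge 1 s
  | n + 1, s => do
    let r ← body s
    let _ ← charge 1 ()
    if r.2 then whileR body n r.1 else return r.1

def lengthR {α : Type} (l : List α) : Run ℕ := charge (l.length + 1) l.length
def reverseR {α : Type} (l : List α) : Run (List α) := charge (l.length + 1) l.reverse
def appendR {α : Type} (l₁ l₂ : List α) : Run (List α) := charge (l₁.length + 1) (l₁ ++ l₂)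
def lastR {α : Type} (l : List α) : Run (Option α) := charge (l.length + 1) l.getLast?
def arrayR {α : Type} (l : List α) : Run (Array α) := charge (l.length + 1) l.toArray
def allocR {α : Type} (n : ℕ) (a : α) : Run (Array α) := charge (n + 1) (Array.replicate n a)
def rangeR (a n : ℕ) : Run (List ℕ) := charge (n + 1) (List.range' a n)
def zipR {α β : Type} (l₁ : List α) (l₂ : List β) : Run (List (α × β)) :=
  charge (l₁.length + 1) (l₁.zip l₂)
/-- Cyclic shift by one place. -/
def shiftR {α : Type} (l : List α) : Run (List α) := charge (l.length + 1) (l.rotate 1)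
def numberR {α : Type} (l : List α) : Run (List (α × ℕ)) := charge (l.length + 1) l.zipIdx

def concatR {α : Type} : List (List α) → Run (List α)
  | [] => charge 1 []
  | l :: ls => do
    let r ← concatR ls
    appendR l r

def memR (k : ℕ) (l : List ℕ) : Run Bool := anyR (fun j => charge 1 (j == k)) l

/-- Insertion into a list that is sorted by `key`. -/
def insertR {α : Type} (key : α → ℝ) (a : α) : List α → Run (List α)
  | [] => charge 1 [a]
  | b :: l =>
    if key a ≤ key b then charge 2 (a :: b :: l) else do
      let r ← insertR key a l
      charge 2 (b :: r)

def sortR {α : Type} (key : α → ℝ) (l : List α) : Run (List α) :=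
  foldR (fun acc a => insertR key a acc) [] l

/-- The element with the largest value (the first one in case of a tie), and that value. -/
def argmaxR {α : Type} (f : α → Run ℝ) (l : List α) : Run (Option (α × ℝ)) :=
  foldR (fun best a => do
    let v ← f a
    charge 2 (match best with
      | none => some (a, v)
      | some b => if b.2 < v then some (a, v) else some b)) none l

/-- The element with the smallest value. -/
def argminR {α : Type} (f : α → Run ℝ) (l : List α) : Run (Option (α × ℝ)) :=
  foldR (fun best a => do
    let v ← f a
    charge 2 (match best with
      | none => some (a, v)
      | some b => if v < b.2 then some (a, v) else some b)) none l

/-- Connected components of the graph on `l` given by the symmetric relation `rel`. -/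
def componentsR {α : Type} (rel : α → α → Run Bool) (l : List α) : Run (List (List α)) :=
  foldR (fun comps a => do
    let r ← partitionR (fun c => anyR (rel a) c) comps
    let c ← concatR r.1
    charge 2 ((a :: c) :: r.2)) [] l

/-! ### Elementary plane geometry -/

structure Pt where
  x : ℝ
  y : ℝ

instance : Inhabited Pt := ⟨⟨0, 0⟩⟩

/-- A directed segment. -/
abbrev Seg := Pt × Pt

/-- A polygon, given by the cyclic list of its vertices. -/
abbrev Poly := List Pt

def vec (a b : Pt) : Pt := ⟨b.x - a.x, b.y - a.y⟩
def cross (u v : Pt) : ℝ := u.x * v.y - u.y * v.x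
def dot (u v : Pt) : ℝ := u.x * v.x + u.y * v.y
/-- `a + t • u` -/
def along (a u : Pt) (t : ℝ) : Pt := ⟨a.x + t * u.x, a.y + t * u.y⟩
def distance (a b : Pt) : ℝ := Real.sqrt (dot (vec a b) (vec a b))

/-- Positive iff `a, b, c` make a left turn. -/
def orient (a b c : Pt) : ℝ := cross (vec a b) (vec a c)

def same (a b : Pt) : Bool := decide (a.x = b.x) && decide (a.y = b.y)
def sameSeg (s t : Seg) : Bool := same s.1 t.1 && same s.2 t.2
def flip (s : Seg) : Seg := (s.2, s.1)

/-- The directed edges of a closed polygon. -/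
def ringEdges (p : Poly) : Run (List Seg) := do
  let q ← shiftR p
  zipR p q

/-- The directed edges of an open polygonal path. -/
def pathEdges (p : List Pt) : Run (List Seg) := zipR p p.tail

/-- Signed area enclosed by directed boundary edges. -/
def areaR (es : List Seg) : Run ℝ :=
  foldR (fun s e => charge 5 (s + cross e.1 e.2 / 2)) 0 es

def onSeg (e : Seg) (p : Pt) : Bool :=
  decide (orient e.1 e.2 p = 0) && decide (dot (vec p e.1) (vec p e.2) ≤ 0)

/-- Does the rightward ray from `p` cross the edge `e` (half-open convention)? -/
def crossesRay (e : Seg) (p : Pt) : Bool :=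
  (decide (e.1.y ≤ p.y) && decide (p.y < e.2.y) && decide (0 < orient e.1 e.2 p)) ||
  (decide (e.2.y ≤ p.y) && decide (p.y < e.1.y) && decide (orient e.1 e.2 p < 0))

/-- Is `p` inside the closed polygon with boundary edges `es`, and not on its boundary? -/
def insideR (es : List Seg) (p : Pt) : Run Bool := do
  let r ← foldR (fun (s : Bool × Bool) e =>
    charge 50 (s.1 || onSeg e p, xor s.2 (crossesRay e p))) (false, false) es
  charge 2 (r.2 && !r.1)

/-- Do two sets with the given boundary edges have a common edge? -/
def touchR (es fs : List Seg) : Run Bool :=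
  anyR (fun e => anyR (fun f => charge 10 (sameSeg e (flip f))) fs) es

/-- Distance from a point to a segment. -/
def distPtSeg (p : Pt) (e : Seg) : ℝ :=
  let u := vec e.1 e.2
  let t := dot (vec e.1 p) u / dot u u
  distance p (along e.1 u (max 0 (min 1 t)))

/-- Distance between two segments that do not cross. -/
def distSegSeg (e f : Seg) : ℝ :=
  min (min (distPtSeg e.1 f) (distPtSeg e.2 f)) (min (distPtSeg f.1 e) (distPtSeg f.2 e))

/-- Intersection point of the lines `a + ℝ u` and `b + ℝ v`. -/
def meet (a u b v : Pt) : Pt := along a u (cross (vec a b) v / cross u v)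

def unitVec (a b : Pt) : Pt := ⟨(b.x - a.x) / distance a b, (b.y - a.y) / distance a b⟩

/-! ### Step 1: refined tiling -/

/-- Parameters (in `[0,1]` along `s`) of the point in which `s` meets `t`; if the two are collinear,
of the end points of `t` on `s`. -/
def hits (s t : Seg) : List ℝ :=
  let u := vec s.1 s.2
  let v := vec t.1 t.2
  let w := vec s.1 t.1
  if cross u v ≠ 0 then
    let p := cross w v / cross u v
    let q := cross w u / cross u v
    if 0 ≤ p ∧ p ≤ 1 ∧ 0 ≤ q ∧ q ≤ 1 then [p] else []
  else if cross u w ≠ 0 then []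
  else
    let p := dot w u / dot u u
    let q := dot (vec s.1 t.2) u / dot u u
    (if 0 ≤ p ∧ p ≤ 1 then [p] else []) ++ (if 0 ≤ q ∧ q ≤ 1 then [q] else [])

/-- Insertion into a strictly increasing list. -/
def insertNewR (t : ℝ) : List ℝ → Run (List ℝ)
  | [] => charge 1 [t]
  | b :: l =>
    if t = b then charge 2 (b :: l)
    else if t < b then charge 3 (t :: b :: l)
    else do
      let r ← insertNewR t l
      charge 3 (b :: r)

/-- Cut `s` at all its intersections with the segments `all`. -/
def nodeSeg (all : List Seg) (s : Seg) : Run (List Seg) := do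
  let ts ← foldR (fun ts t => do
    let hs ← charge 80 (hits s t)
    foldR (fun ts h => insertNewR h ts) ts hs) [0, 1] all
  let ps ← mapR (fun t => charge 8 (along s.1 (vec s.1 s.2) t)) ts
  pathEdges ps

/-- The fully noded union: every edge is cut at all intersections, and each resulting edge is kept
once. -/
def nodedUnion (polys : List Poly) : Run (List Seg) := do
  let rings ← mapR ringEdges polys
  let all ← concatR rings
  let all ← filterR (fun e => charge 4 (!same e.1 e.2)) all
  let cut ← mapR (nodeSeg all) all
  let cut ← concatR cut
  foldR (fun acc e => do
    let old ← anyR (fun f => charge 10 (sameSeg e f || sameSeg e (flip f))) acc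
    charge 2 (if old then acc else e :: acc)) [] cut

/-- Position of the direction `a` when one turns clockwise from the direction `d`: less than a half
turn, a half turn, more than a half turn, a full turn. -/
def turnClass (d a : Pt) : ℕ :=
  if cross d a < 0 then 0
  else if 0 < cross d a then 2
  else if dot d a < 0 then 1 else 3

/-- Turning clockwise from `d`, one meets `a` before `b`. -/
def cwBefore (d a b : Pt) : Bool :=
  decide (turnClass d a < turnClass d b) ||
    (decide (turnClass d a = turnClass d b) && decide (cross a b < 0))

/-- The half-edge that follows `h` on the boundary of the face to the left of `h`. -/
def nextEdge (hs : List (Seg × ℕ)) (h : Seg) : Run ℕ := do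
  let d := vec h.2 h.1
  let r ← foldR (fun (best : Option (Seg × ℕ)) c => charge 60 (
    if same c.1.1 h.2 then
      match best with
      | none => some c
      | some b => if cwBefore d (vec c.1.1 c.1.2) (vec b.1.1 b.1.2) then some c else some b
    else best)) none hs
  charge 2 ((r.map Prod.snd).getD 0)

/-- If `v` occurs on the stack, cut off the part above it: the closed-off cycle, and the rest. -/
def popTo (v : Pt) : List Pt → List Pt → Run (Option (List Pt × List Pt))
  | _, [] => charge 1 none
  | acc, w :: st =>
    if same v w then charge 5 (some (v :: acc, v :: st)) else do
      let _ ← charge 5 ()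
      popTo v (w :: acc) st

/-- Split a closed walk at its repeated vertices into cycles without repeated vertices; cycles with
fewer than three vertices are dropped. -/
def splitWalk (walk : List Pt) : Run (List Poly) := do
  let r ← foldR (fun (s : List Pt × List Poly) v => do
    let p ← popTo v [] s.1
    charge 4 (match p with
      | none => (v :: s.1, s.2)
      | some (cyc, st) => (st, cyc :: s.2))) ([], []) walk
  let last ← reverseR r.1
  filterR (fun c => do
    let n ← lengthR c
    charge 1 (decide (3 ≤ n))) (last :: r.2)

/-- A face of the 1-complex: outer boundary (counterclockwise), holes (clockwise), and all boundary
edges, with the face on their left. -/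
structure Face where
  outer : Poly
  holes : List Poly
  edges : List Seg

/-- Polygonization: the bounded faces of a noded 1-complex. -/
def polygonize (segs : List Seg) : Run (List Face) := do
  let back ← mapR (fun e => charge 2 (flip e)) segs
  let hs ← appendR segs back
  let n ← lengthR hs
  let hn ← numberR hs
  let nxtL ← mapR (nextEdge hn) hs
  let nxt ← arrayR nxtL
  let src ← arrayR hs
  let vis ← allocR n false
  -- trace the boundary walks of all faces
  let walks ← foldR (fun (s : Array Bool × List (List Pt)) (h : Seg × ℕ) => do
    let r ← whileR (fun (c : Array Bool × List Pt × ℕ) => charge 6 (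
        if c.1.getD c.2.2 true then (c, false)
        else ((c.1.setIfInBounds c.2.2 true, (src.getD c.2.2 h.1).1 :: c.2.1, nxt.getD c.2.2 0),
          true))) (n + 1) (s.1, [], h.2)
    let w ← reverseR r.2.1
    charge 2 (r.1, w :: s.2)) (vis, []) hn
  let rings ← mapR splitWalk walks.2
  let rings ← concatR rings
  let rings ← mapR (fun r => do
    let es ← ringEdges r
    let a ← areaR es
    charge 1 (r, es, a)) rings
  let outers ← filterR (fun r => charge 1 (decide (0 < r.2.2))) rings
  let inners ← filterR (fun r => charge 1 (decide (r.2.2 < 0))) rings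
  let outersN ← numberR outers
  -- a hole belongs to the smallest outer boundary around it
  let owned ← mapR (fun (r : Poly × List Seg × ℝ) => do
    let e := r.2.1.headD default
    let m := along e.1 (vec e.1 e.2) (1 / 2)
    let around ← filterR (fun (o : (Poly × List Seg × ℝ) × ℕ) => insideR o.1.2.1 m) outersN
    let o ← argminR (fun (o : (Poly × List Seg × ℝ) × ℕ) => charge 1 o.1.2.2) around
    charge 10 (r, o.map fun o => o.1.2)) inners
  mapR (fun (o : (Poly × List Seg × ℝ) × ℕ) => do
    let hs ← filterR (fun r => charge 1 (r.2 == some o.2)) owned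
    let hp ← mapR (fun r => charge 1 r.1.1) hs
    let he ← mapR (fun r => charge 1 r.1.2.1) hs
    let he ← concatR he
    let es ← appendR o.1.2.1 he
    charge 1 { outer := o.1.1, holes := hp, edges := es : Face }) outersN

/-- A point in the interior of a face: walk from the midpoint of an edge into the face, half the way
to the first edge of the complex that is met. -/
def innerPoint (segs : List Seg) (f : Face) : Run Pt := do
  let e := f.edges.headD default
  let m := along e.1 (vec e.1 e.2) (1 / 2)
  let n : Pt := ⟨-(vec e.1 e.2).y, (vec e.1 e.2).x⟩
  let t ← foldR (fun (best : Option ℝ) s => charge 50 (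
    let v := vec s.1 s.2
    let w := vec m s.1
    let den := cross n v
    let t := cross w v / den
    let u := cross w n / den
    if den ≠ 0 ∧ 0 ≤ u ∧ u ≤ 1 ∧ 0 < t then
      match best with
      | none => some t
      | some b => some (min b t)
    else best)) none segs
  charge 20 (along m n (t.getD 1 / 2))

/-- A piece of the refined tiling. -/
structure Piece where
  id : ℕ
  /-- outer boundary -/
  ring : Poly
  /-- whether the piece is simply connected -/
  simple : Bool
  /-- boundary edges, with the piece on the left -/
  edges : List Seg
  /-- the region that contains the piece -/
  region : Option ℕ
  /-- the units that contain the piece -/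
  owners : List ℕ
  /-- the overlap order -/
  order : ℕ
  /-- the unit to which the piece has been assigned so far -/
  unit : Option ℕ

/-- The faces of a noded 1-complex, with the regions and the units (given by their numbered boundaries)
that contain them. Without regions, everything lies in one region with number `0`. -/
def locatePieces (aware : Bool) (units regs : List (List Seg × ℕ)) (segs : List Seg) :
    Run (List Piece) := do
  let faces ← polygonize segs
  let facesN ← numberR faces
  mapR (fun (f : Face × ℕ) => do
    let p ← innerPoint segs f.1
    let own ← filterR (fun (k : List Seg × ℕ) => insideR k.1 p) units
    let own ← mapR (fun (k : List Seg × ℕ) => charge 1 k.2) own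
    let d ← lengthR own
    let r ← findR (fun (k : List Seg × ℕ) => insideR k.1 p) regs
    charge 12 ({ id := f.2, ring := f.1.outer, simple := f.1.holes.isEmpty, edges := f.1.edges,
                 region := if aware then r.map Prod.snd else some 0,
                 owners := own, order := d, unit := none } : Piece)) facesN

/-- Assign every unit to the region that it meets in the largest area. -/
def assignRegions (units regs : List (List Seg × ℕ)) (ps : List Piece) : Run (Array ℕ) := do
  let l ← mapR (fun (k : List Seg × ℕ) => do
    let best ← argmaxR (fun (r : List Seg × ℕ) => foldR (fun s (q : Piece) => do
      let mine ← memR k.2 q.owners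
      if mine && q.region == some r.2 then do
        let a ← areaR q.edges
        charge 4 (s + a)
      else charge 3 s) 0 ps) regs
    charge 3 ((best.map fun b => b.1.2).getD 0)) units
  arrayR l

/-- Drop the pieces outside all regions; count only units of its own region as containing a piece. -/
def localize (ureg : Array ℕ) (ps : List Piece) : Run (List Piece) := do
  let kept ← filterR (fun (q : Piece) => charge 1 q.region.isSome) ps
  mapR (fun (q : Piece) => do
    let own ← filterR (fun k => charge 3 (q.region == some (ureg.getD k 0))) q.owners
    let d ← lengthR own
    charge 3 { q with owners := own, order := d }) kept

/-- The edges of the complex, without those that lie between two gaps in the same region. (Such edges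
come from units that have been assigned to another region.) -/
def dropInnerEdges (segs : List Seg) (ps : List Piece) : Run (List Seg) :=
  filterR (fun (e : Seg) => do
    let isGap := fun (q : Piece) (e : Seg) =>
      if q.order == 0 then touchR [e] q.edges else charge 1 false
    let l ← findR (fun q => isGap q (flip e)) ps
    let r ← findR (fun q => isGap q e) ps
    charge 5 (match l, r with
      | some q, some q' => q.region != q'.region
      | _, _ => true)) segs

/-- Construction of the refined tiling: its pieces, and the array of the regions of the units. In the
region-aware version, the region boundaries are part of the 1-complex, and adjoining gaps in the same
region are treated as one gap. -/
def refinedTiling (T : List Poly) (regions : Option (List Poly)) :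
    Run (List Piece × Array ℕ) := do
  let regs := regions.getD []
  let polys ← appendR T regs
  let segs ← nodedUnion polys
  let unitE ← mapR ringEdges T
  let unitN ← numberR unitE
  let regE ← mapR ringEdges regs
  let regN ← numberR regE
  let raw ← locatePieces regions.isSome unitN regN segs
  let ureg ← assignRegions unitN regN raw
  let ps ← localize ureg raw
  if regions.isSome then do
    let segs' ← dropInnerEdges segs ps
    let raw' ← locatePieces true unitN regN segs'
    let ps' ← localize ureg raw'
    return (ps', ureg)
  else return (ps, ureg)

/-! ### Step 2: assignment of overlaps -/

/-- Total length of the common boundary, for two lists of boundary edges. -/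
def sharedR (es fs : List Seg) : Run ℝ :=
  foldR (fun s e => foldR (fun s f =>
    charge 20 (if sameSeg e (flip f) then s + distance e.1 e.2 else s)) s fs) 0 es

/-- Does the unit `k` have more than one component at this stage? -/
def disconnectedR (ps : List Piece) (k : ℕ) : Run Bool := do
  let mine ← filterR (fun (q : Piece) => charge 1 (q.unit == some k)) ps
  let cs ← componentsR (fun (q q' : Piece) => touchR q.edges q'.edges) mine
  let c ← lengthR cs
  charge 1 (decide (1 < c))

/-- Length of the common boundary of the edges `es` with the partially reconstructed unit `k`. -/
def perimeterR (ps : List Piece) (es : List Seg) (k : ℕ) : Run ℝ :=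
  foldR (fun s (q : Piece) =>
    if q.unit == some k then do
      let l ← sharedR es q.edges
      charge 2 (s + l)
    else charge 2 s) 0 ps

/-- Assign the overlaps of order `d`: first to units that are still disconnected, then by largest
common perimeter. -/
def assignOrder (st : List Piece × List ℕ) (d : ℕ) : Run (List Piece × List ℕ) := do
  let st ← foldR (fun (s : List Piece × List ℕ) k => do
    let ps ← mapR (fun (q : Piece) => do
      let mine ← memR k q.owners
      charge 5 (if mine && q.order == d && q.unit.isNone then { q with unit := some k } else q)) s.1
    let bad ← disconnectedR ps k
    charge 2 (ps, if bad then k :: s.2 else s.2)) (st.1, []) st.2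
  let disc ← reverseR st.2
  let rest ← filterR (fun (q : Piece) => charge 3 (q.order == d && q.unit.isNone)) st.1
  let ps ← foldR (fun (ps : List Piece) (q : Piece) => do
    let best ← argmaxR (perimeterR ps q.edges) q.owners
    mapR (fun (q' : Piece) =>
      charge 3 (if q'.id == q.id then { q' with unit := best.map Prod.fst } else q')) ps) st.1 rest
  return (ps, disc)

/-- Assign all pieces of positive overlap order, by increasing order. -/
def assignOverlaps (N : ℕ) (ps : List Piece) : Run (List Piece) := do
  let ps ← mapR (fun (q : Piece) =>
    charge 3 (if q.order == 1 then { q with unit := q.owners.head? } else q)) ps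
  let units ← rangeR 0 N
  let disc ← filterR (disconnectedR ps) units
  let orders ← rangeR 2 (N - 1)
  let r ← foldR assignOrder (ps, disc) orders
  return r.1

/-! ### Shortest paths in a simple polygon

Vertices are referred to by their index in the counterclockwise cyclic order. The polygon is
triangulated by ear clipping; a shortest path is found by the funnel method along the sleeve of
triangles that joins the two vertices. -/

/-- The part of a triangulation that hangs on a (directed) edge: either nothing (the edge is a side
of the polygon) or a triangle with third vertex `apex` and what hangs on its two other edges. -/
inductive Tree where
  | leaf : Tree
  | node (apex : ℕ) (left right : Tree) : Tree

/-- A vertex of the polygon that remains during ear clipping. -/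
structure ClipVertex where
  idx : ℕ
  pt : Pt
  ear : Bool
  /-- what has been cut off beyond the edge from this vertex to the next one -/
  tree : Tree

/-- Is `b` (between `a` and `c`) an ear of the remaining polygon `l`? -/
def earR (a b c : ClipVertex) (l : List ClipVertex) : Run Bool := do
  let blocked ← anyR (fun (v : ClipVertex) => charge 40 (
    v.idx != a.idx && v.idx != b.idx && v.idx != c.idx &&
    decide (0 ≤ orient a.pt b.pt v.pt) && decide (0 ≤ orient b.pt c.pt v.pt) &&
    decide (0 ≤ orient c.pt a.pt v.pt))) l
  charge 10 (decide (0 < orient a.pt b.pt c.pt) && !blocked)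

/-- Rotate a cyclic list so that it starts with the first ear. -/
def toEar : List ClipVertex → List ClipVertex → Run (Option (ClipVertex × List ClipVertex))
  | _, [] => charge 1 none
  | acc, v :: l =>
    if v.ear then do
      let a ← reverseR acc
      let r ← appendR l a
      charge 1 (some (v, r))
    else do
      let _ ← charge 2 ()
      toEar (v :: acc) l

/-- Recompute whether the first vertex of a cyclic list is an ear. -/
def refreshHead (l : List ClipVertex) : Run (List ClipVertex) := do
  let z ← lastR l
  match l, z with
  | b :: c :: r, some a => do
    let e ← earR a b c l
    charge 2 ({ b with ear := e } :: c :: r)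
  | _, _ => return l

/-- Cut off one ear. -/
def clipEar (l : List ClipVertex) : Run (List ClipVertex × Bool) := do
  let n ← lengthR l
  if n ≤ 3 then return (l, false) else
  match ← toEar [] l with
  | none => return (l, false)
  | some (v, r) => do
    -- make the predecessor `a` of `v` the first element
    let rev ← reverseR r
    match rev with
    | [] => return (l, false)
    | a :: rev' => do
      let r' ← reverseR rev'
      let l₁ ← refreshHead ({ a with tree := .node v.idx a.tree v.tree } :: r')
      let l₂ ← shiftR l₁
      let l₃ ← refreshHead l₂
      return (l₃, true)

/-- A triangulated polygon: the diagonal (or side) from `a` to `c`, with what lies on its two sides: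
`t₁` on the boundary arc from `a` to `c`, `t₂` on the arc from `c` to `a`. -/
structure Triang where
  n : ℕ
  pts : Array Pt
  a : ℕ
  c : ℕ
  t₁ : Tree
  t₂ : Tree

def triangulate (p : Poly) : Run Triang := do
  let n ← lengthR p
  let pts ← arrayR p
  let pn ← numberR p
  let l ← mapR (fun (v : Pt × ℕ) => charge 4 (⟨v.2, v.1, false, .leaf⟩ : ClipVertex)) pn
  let l ← foldR (fun l _ => do
    let l' ← refreshHead l
    shiftR l') l pn
  let l ← whileR clipEar n l
  charge 8 (match l with
    | a :: b :: c :: _ => ⟨n, pts, a.idx, c.idx, .node b.idx a.tree b.tree, c.tree⟩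
    | _ => ⟨n, pts, 0, 0, .leaf, .leaf⟩)

/-- Number of steps from `x` counterclockwise to `v`. -/
def off (n x v : ℕ) : ℕ := (v + n - x) % n

/-- Is `v` on the closed arc from `x` to `y`? -/
def inArc (n x y v : ℕ) : Bool := decide (off n x v ≤ off n x y)

/-- Is `v` on the open arc from `x` to `y`? -/
def inOpenArc (n x y v : ℕ) : Bool := decide (0 < off n x v) && decide (off n x v < off n x y)

/-- The diagonals to be crossed on the way from the edge `x y` to the vertex `v` beyond it, this edge
included; none if `v` is `x` or `y`. -/
def descend (n v : ℕ) : Tree → ℕ → ℕ → Run (List (ℕ × ℕ))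
  | .leaf, _, _ => charge 1 []
  | .node z l r, x, y =>
    if !inOpenArc n x y v then charge 10 []
    else do
      let rest ← if inArc n x z v then descend n v l x z else descend n v r z y
      charge 20 ((x, y) :: rest)

/-- The diagonals that separate `i` from `j`, in order, for two vertices of the arc from `x` to `y`. -/
def sleeveIn (n i j : ℕ) : Tree → ℕ → ℕ → Run (List (ℕ × ℕ))
  | .leaf, _, _ => charge 1 []
  | .node z l r, x, y =>
    if inArc n x z i && inArc n x z j then do
      let _ ← charge 10 ()
      sleeveIn n i j l x z
    else if inArc n z y i && inArc n z y j then do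
      let _ ← charge 20 ()
      sleeveIn n i j r z y
    else do
      let ui ← if inArc n x z i then descend n i l x z else descend n i r z y
      let uj ← if inArc n x z j then descend n j l x z else descend n j r z y
      let ri ← reverseR ui
      let _ ← charge 30 ()
      appendR ri uj

/-- The diagonals of the triangulation that separate `i` from `j`, in order. -/
def sleeve (t : Triang) (i j : ℕ) : Run (List (ℕ × ℕ)) :=
  if inArc t.n t.a t.c i && inArc t.n t.a t.c j then sleeveIn t.n i j t.t₁ t.a t.c
  else if inArc t.n t.c t.a i && inArc t.n t.c t.a j then sleeveIn t.n i j t.t₂ t.c t.a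
  else do
    let first := inArc t.n t.a t.c i
    let ui ← if first then descend t.n i t.t₁ t.a t.c else descend t.n i t.t₂ t.c t.a
    let uj ← if first then descend t.n j t.t₂ t.c t.a else descend t.n j t.t₁ t.a t.c
    let ri ← reverseR ui
    let _ ← charge 40 ()
    appendR ri uj.tail

/-- The funnel: a double-ended queue in the cells `lo, …, hi` of an array, with the left chain in
`lo, …, apex` and the right chain in `apex, …, hi`. `parent v` is the vertex before `v` on the
shortest path from the source to `v`. -/
structure Funnel where
  cells : Array ℕ
  lo : ℕ
  apex : ℕ
  hi : ℕ
  parent : Array ℕ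

/-- Add a vertex `w` at the right end. -/
def addRight (t : Triang) (w : ℕ) (f : Funnel) : Run Funnel := do
  let P := fun k => t.pts.getD (f.cells.getD k 0) default
  let W := t.pts.getD w default
  let k ← whileR (fun k => charge 25 (
    if f.apex < k then
      if 0 < orient (P (k - 1)) (P k) W then (k - 1, true) else (k, false)
    else if f.lo < k then
      if 0 ≤ orient (P k) (P (k - 1)) W then (k - 1, true) else (k, false)
    else (k, false))) (f.hi - f.lo + 1) f.hi
  charge 10 { cells := f.cells.setIfInBounds (k + 1) w, lo := f.lo, apex := min f.apex k,
              hi := k + 1, parent := f.parent.setIfInBounds w (f.cells.getD k 0) }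

/-- Add a vertex `w` at the left end. -/
def addLeft (t : Triang) (w : ℕ) (f : Funnel) : Run Funnel := do
  let P := fun k => t.pts.getD (f.cells.getD k 0) default
  let W := t.pts.getD w default
  let k ← whileR (fun k => charge 25 (
    if k < f.apex then
      if orient (P (k + 1)) (P k) W < 0 then (k + 1, true) else (k, false)
    else if k < f.hi then
      if orient (P k) (P (k + 1)) W ≤ 0 then (k + 1, true) else (k, false)
    else (k, false))) (f.hi - f.lo + 1) f.lo
  charge 10 { cells := f.cells.setIfInBounds (k - 1) w, lo := k - 1, apex := max f.apex k,
              hi := f.hi, parent := f.parent.setIfInBounds w (f.cells.getD k 0) }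

/-- The vertices of the shortest path in the polygon from vertex `i` to vertex `j`, including all
vertices of the polygon through which it passes. -/
def geodesic (t : Triang) (i j : ℕ) : Run (List ℕ) := do
  let gates ← sleeve t i j
  let cells ← allocR (2 * t.n + 3) i
  let parent ← allocR t.n i
  let f ← foldR (fun (f : Funnel) (g : ℕ × ℕ) => do
    let onRight ← charge 10 (inOpenArc t.n i j g.1)
    let r := if onRight then g.1 else g.2
    let l := if onRight then g.2 else g.1
    let f ← if f.cells.getD f.hi 0 == r then charge 3 f else addRight t r f
    if f.cells.getD f.lo 0 == l then charge 3 f else addLeft t l f)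
    { cells := cells, lo := t.n + 1, apex := t.n + 1, hi := t.n + 1, parent := parent } gates
  let f ← addRight t j f
  let r ← whileR (fun (s : List ℕ × ℕ) => charge 4 (
    if s.2 == i then ((i :: s.1, i), false)
    else ((s.2 :: s.1, f.parent.getD s.2 i), true))) (t.n + 1) ([], j)
  return r.1

/-- The same path as a list of points. -/
def geodesicPts (t : Triang) (i j : ℕ) : Run (List Pt) := do
  let p ← geodesic t i j
  mapR (fun k => charge 1 (t.pts.getD k default)) p

/-! ### Step 3: closing gaps -/

/-- A directed edge of a polygon into which a gap is cut up, with the polygon on its left.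
If `filled` is set, the polygon has been assigned to `unit`. Otherwise the edge is part of the
sub-boundary number `sub`, which is adjacent to `unit`, or exterior if `unit` is `none`. -/
structure GapEdge where
  a : Pt
  b : Pt
  sub : ℕ
  unit : Option ℕ
  filled : Bool

/-- A polygon of the subdivision of a gap. -/
abbrev Loop := List GapEdge

def isEdge (x y : Pt) (e : GapEdge) : Bool := same e.a x && same e.b y

/-- Split a list at the first edge that starts in `x`. -/
def splitAt (x : Pt) : List GapEdge → List GapEdge → Run (Option (List GapEdge × List GapEdge))
  | _, [] => charge 1 none
  | acc, e :: l =>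
    if same e.a x then do
      let r ← reverseR acc
      charge 5 (some (r, e :: l))
    else do
      let _ ← charge 5 ()
      splitAt x (e :: acc) l

/-- Cut a polygon by the diagonal `x y` in two. -/
def splitLoop (x y : Pt) (l : Loop) : Run (List Loop) := do
  match ← splitAt x [] l with
  | none => return [l]
  | some (p, q) => do
    let l' ← appendR q p
    match ← splitAt y [] l' with
    | none => return [l]
    | some (p', q') => do
      let u ← appendR p' [⟨y, x, 0, none, false⟩]
      let v ← appendR q' [⟨x, y, 0, none, false⟩]
      return [u, v]

/-- Add the diagonal `x y` to a subdivision, unless it is an edge of it already. -/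
def addChord (loops : List Loop) (x y : Pt) : Run (List Loop) := do
  let old ← anyR (anyR fun e => charge 10 (isEdge x y e || isEdge y x e)) loops
  if old then return loops else do
    let r ← foldR (fun (s : List Loop × Bool) (l : Loop) => do
      let hx ← anyR (fun e => charge 4 (same e.a x)) l
      let hy ← anyR (fun e => charge 4 (same e.a y)) l
      if hx && hy && !s.2 && !same x y then do
        let ls ← splitLoop x y l
        let ls ← appendR ls s.1
        charge 5 (ls, true)
      else charge 6 (l :: s.1, s.2)) ([], false) loops
    return r.1

/-- Insert the new vertex `p` into the edge `x y` (unless it is a vertex already). -/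
def addPoint (loops : List Loop) (x y p : Pt) : Run (List Loop) :=
  mapR (fun (l : Loop) => do
    let old ← anyR (fun e => charge 4 (same e.a p)) l
    if old then return l else do
      let parts ← mapR (fun (e : GapEdge) => charge 12 (
        if isEdge x y e || isEdge y x e then [{ e with b := p }, { e with a := p }] else [e])) l
      concatR parts) loops

/-- Cut the subdivision along a directed path. The path is the new sub-boundary number `sub`: what
lies on its left remains to be filled, what lies on its right is assigned to `unit`. -/
def cutPath (loops : List Loop) (path : List Pt) (sub : ℕ) (unit : Option ℕ) :
    Run (List Loop) := do
  let es ← pathEdges path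
  foldR (fun loops (s : Seg) => do
    let loops ← addChord loops s.1 s.2
    mapR (mapR fun (e : GapEdge) => charge 12 (
      if isEdge s.1 s.2 e then (if e.filled then e else { e with sub := sub, unit := unit })
      else if isEdge s.2 s.1 e then { e with unit := unit, filled := true }
      else e)) loops) loops es

/-- Maximal runs of a cyclic list with respect to `eq`. -/
def runsR {α : Type} (eq : α → α → Bool) (l : List α) : Run (List (List α)) := do
  let rev ← reverseR l
  let gs ← foldR (fun (gs : List (List α)) a => charge 5 (match gs with
    | (b :: g) :: gs' => if eq a b then (a :: b :: g) :: gs' else [a] :: gs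
    | _ => [a] :: gs)) [] rev
  match gs with
  | g :: g' :: gs' => do
    let rest ← reverseR (g' :: gs')
    match g, rest with
    | x :: _, (y :: h) :: rest' =>
      if eq x y then do
        let first ← appendR (y :: h) g
        let mid ← reverseR rest'
        charge 10 (first :: mid)
      else charge 10 gs
    | _, _ => return gs
  | _ => charge 2 gs

/-- A sub-boundary of a gap: number, adjacent unit, indices of its initial and terminal vertex in the
polygon, and its vertices. -/
structure Sub where
  id : ℕ
  unit : Option ℕ
  start : ℕ
  finish : ℕ
  pts : List Pt

/-- The sub-boundaries of a gap polygon in counterclockwise order, and the polygon with its vertices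
numbered from the start of the first one. -/
def subBoundaries (l : Loop) : Run (List Sub × Poly) := do
  let n ← lengthR l
  let runs ← runsR (fun (e f : GapEdge) => e.sub == f.sub) l
  let r ← foldR (fun (s : List Sub × ℕ) (g : List GapEdge) => do
    let m ← lengthR g
    let z ← lastR g
    let ps ← mapR (fun (e : GapEdge) => charge 1 e.a) g
    let ps ← appendR ps (match z with | some e => [e.b] | none => [])
    charge 10 (match g with
      | e :: _ => (⟨e.sub, e.unit, s.2, (s.2 + m) % n, ps⟩ :: s.1, s.2 + m)
      | [] => s)) ([], 0) runs
  let subs ← reverseR r.1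
  let es ← concatR runs
  let vs ← mapR (fun (e : GapEdge) => charge 1 e.a) es
  return (subs, vs)

/-- Convexification: cut along the shortest path between the end points of every sub-boundary that is
adjacent to a unit. -/
def convexify (l : Loop) (subs : List Sub) (t : Triang) : Run (List Loop) :=
  foldR (fun loops (s : Sub) =>
    if s.unit.isSome then do
      let p ← geodesicPts t s.start s.finish
      cutPath loops p s.id s.unit
    else charge 1 loops) [l] subs

/-- A polygon that has been assigned to a unit. -/
abbrev Part := List Seg × ℕ

def loopEdges (l : Loop) : Run (List Seg) := mapR (fun (e : GapEdge) => charge 1 (e.a, e.b)) l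

/-- Separate the polygons of a subdivision into assigned ones and remaining gaps. -/
def sortLoops (loops : List Loop) : Run (List Part × List Loop) :=
  foldR (fun (s : List Part × List Loop) (l : Loop) => do
    match ← findR (fun (e : GapEdge) => charge 1 e.filled) l with
    | none => charge 1 (s.1, l :: s.2)
    | some e => do
      let es ← loopEdges l
      charge 3 (match e.unit with
        | some u => ((es, u) :: s.1, s.2)
        | none => s)) ([], []) loops

/-- Does the list contain a repeated number? -/
def repeatsR : List ℕ → Run Bool
  | [] => charge 1 false
  | a :: l => do
    let b ← memR a l
    if b then charge 1 true else do
      let _ ← charge 1 ()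
      repeatsR l

def incenter (a b c : Pt) : Pt :=
  let p := distance b c
  let q := distance c a
  let r := distance a b
  ⟨(p * a.x + q * b.x + r * c.x) / (p + q + r), (p * a.y + q * b.y + r * c.y) / (p + q + r)⟩

/-- A corner of a gap with three sub-boundaries: vertex, direction of the angle bisector. -/
def cornerR (prev next : Sub) : Run (Pt × Pt) := do
  let rp ← reverseR prev.pts
  match rp, next.pts with
  | _ :: u :: _, v :: w :: _ =>
    let d := unitVec v u
    let e := unitVec v w
    charge 50 (v, ⟨d.x + e.x, d.y + e.y⟩)
  | _, _ => return (default, default)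

/-- `q`, if it comes before `p` on the way from `v`. -/
def nearer (v p q : Pt) : List Pt := if distance v q < distance v p then [q] else []

/-- Fill a gap whose three sub-boundaries are outward convex, by angle bisectors. -/
def fillThree (s₀ s₁ s₂ : Sub) : Run (List Part) := do
  let (v₀, d₀) ← cornerR s₂ s₀
  let (v₁, d₁) ← cornerR s₀ s₁
  let (v₂, d₂) ← cornerR s₁ s₂
  -- `m i` is the intersection of the bisectors at the end points of the sub-boundary `i`
  let m₀ := meet v₀ d₀ v₁ d₁
  let m₁ := meet v₁ d₁ v₂ d₂
  let m₂ := meet v₂ d₂ v₀ d₀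
  let _ ← charge 150 ()
  let region := fun (s : Sub) (v w m mv mw : Pt) => do
    -- from `v` along the sub-boundary to `w`, along the bisector of `w` to `m`, and back to `v`
    let p ← appendR s.pts (nearer w m mw ++ [m] ++ nearer v m mv)
    let es ← ringEdges p
    let _ ← charge 40 ()
    return (es, s.unit)
  let r₀ ← region s₀ v₀ v₁ m₀ m₂ m₁
  let r₁ ← region s₁ v₁ v₂ m₁ m₀ m₂
  let r₂ ← region s₂ v₂ v₀ m₂ m₁ m₀
  let rs := [r₀, r₁, r₂]
  -- the triangle between the bisectors
  let tri := if 0 < orient m₀ m₁ m₂ then [m₀, m₁, m₂] else [m₀, m₂, m₁]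
  let c := incenter m₀ m₁ m₂
  let sides ← ringEdges tri
  let inner ← if same m₀ m₁ && same m₁ m₂ then charge 8 [] else
    mapR (fun (e : Seg) => do
      let r ← findR (fun (r : List Seg × Option ℕ) => touchR [e] r.1) rs
      charge 70 ([(e.1, e.2), (e.2, c), (c, e.1)], r.bind Prod.snd)) sides
  let all ← appendR rs inner
  foldR (fun (ps : List Part) (r : List Seg × Option ℕ) => charge 2 (match r.2 with
    | some u => (r.1, u) :: ps
    | none => ps)) [] all

/-- Fill a gap with two sub-boundaries `s₁, s₂` adjacent to units, followed by an exterior one: cut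
along the shortest path from their common vertex to the closest exterior vertex. -/
def fillExteriorThree (l : Loop) (t : Triang) (s₁ s₂ x : Sub) : Run (List Loop) := do
  let xs ← numberR x.pts
  let y := t.pts.getD s₁.finish default
  let best ← argminR (fun (v : Pt × ℕ) => charge 8 (distance y v.1)) xs
  let k := (x.start + (best.map fun b => b.1.2).getD 0) % t.n
  let p ← geodesicPts t s₁.finish k
  let es ← pathEdges p
  foldR (fun loops (s : Seg) => do
    let loops ← addChord loops s.1 s.2
    mapR (mapR fun (e : GapEdge) => charge 12 (
      if isEdge s.1 s.2 e then { e with unit := s₁.unit, filled := true }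
      else if isEdge s.2 s.1 e then { e with unit := s₂.unit, filled := true }
      else e)) loops) [l] es

/-- Distance between two sub-boundaries. -/
def distSubs (s s' : Sub) : Run ℝ := do
  let es ← pathEdges s.pts
  let fs ← pathEdges s'.pts
  let r ← foldR (fun (best : Option ℝ) e => foldR (fun (best : Option ℝ) f => charge 200 (
    let d := distSegSeg e f
    match best with
    | none => some d
    | some b => some (min b d))) best fs) none es
  charge 1 (r.getD 0)

/-- A pair of sub-boundaries with its distance. -/
structure Pair where
  dist : ℝ
  fst : Sub
  snd : Sub

/-- Bring the closest pair to the front. -/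
def closestFirst (row : List Pair) : Run (List Pair) :=
  foldR (fun (acc : List Pair) (p : Pair) => charge 4 (match acc with
    | [] => [p]
    | q :: r => if p.dist < q.dist then p :: q :: r else q :: p :: r)) [] row

/-- A table of the pairs of sub-boundaries that are known not to be strongly mutually visible. A pair
that is not strongly mutually visible in a polygon is not so in a smaller one either. -/
structure Table where
  width : ℕ
  cells : Array Bool

def Table.get (m : Table) (i j : ℕ) : Bool := m.cells.getD (i * m.width + j) false
def Table.mark (m : Table) (i j : ℕ) : Table :=
  ⟨m.width, (m.cells.setIfInBounds (i * m.width + j) true).setIfInBounds (j * m.width + i) true⟩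

/-- All pairs of non-adjacent sub-boundaries that come into question, one list for each first
member, with the closest pair in front. -/
def candidateRows (subs : List Sub) (bad : Table) : Run (List (List Pair)) := do
  let s ← lengthR subs
  let sn ← numberR subs
  mapR (fun (p : Sub × ℕ) => do
    let later ← filterR (fun (q : Sub × ℕ) => charge 12 (
      decide (p.2 + 1 < q.2) && decide (q.2 + 1 < p.2 + s) &&
      (p.1.unit.isSome || q.1.unit.isSome) && !bad.get p.1.id q.1.id)) sn
    let row ← mapR (fun (q : Sub × ℕ) => do
      let d ← distSubs p.1 q.1
      charge 3 (⟨d, p.1, q.1⟩ : Pair)) later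
    closestFirst row) sn

/-- Have two paths, given by vertex indices below `n`, no vertex in common? -/
def disjointR (n : ℕ) (p q : List ℕ) : Run Bool := do
  let marks ← allocR n false
  let marks ← foldR (fun (m : Array Bool) k => charge 1 (m.setIfInBounds k true)) marks p
  let hit ← anyR (fun k => charge 1 (marks.getD k false)) q
  charge 1 (!hit)

/-- A way to treat a pair: new courses of one or two sub-boundaries. -/
inductive Cut where
  /-- join two sub-boundaries along the diagonals `β₁` (between the initial points) and `β₂` (between
  the terminal points) -/
  | join (s s' : Sub) (β₁ β₂ : List Pt) : Cut
  /-- extend a sub-boundary to an exterior vertex -/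
  | extend (s : Sub) (path : List Pt) : Cut

/-- Remove the common initial part of two paths, except for its last vertex. -/
def dropCommon : List Pt → List Pt → Run (List Pt × List Pt)
  | p :: p' :: ps, q :: q' :: qs =>
    if same p' q' then do
      let _ ← charge 5 ()
      dropCommon (p' :: ps) (q' :: qs)
    else charge 5 (p :: p' :: ps, q :: q' :: qs)
  | ps, qs => charge 1 (ps, qs)

/-- Two sub-boundaries adjacent to units: they are joined if the shortest paths `α₁` and `α₂` are
disjoint. -/
def tryJoin (t : Triang) (s s' : Sub) : Run (Option Cut) := do
  let α₁ ← geodesic t s.finish s'.start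
  let α₂ ← geodesic t s'.finish s.start
  let free ← disjointR t.n α₁ α₂
  if free then do
    let β₁ ← geodesicPts t s.start s'.start
    let β₂ ← geodesicPts t s.finish s'.finish
    charge 1 (some (.join s s' β₁ β₂))
  else return none

/-- A sub-boundary `s` adjacent to a unit and an exterior one `x`: shortest paths from the exterior
vertex closest to `s` to the end points of `s`. If these paths run together near the exterior vertex,
they are followed from where they separate; if nothing is bounded by them and `s`, the pair is
skipped. -/
def tryExtend (t : Triang) (s x : Sub) : Run (Option Cut) := do
  let es ← pathEdges s.pts
  let xs ← numberR x.pts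
  let best ← argminR (fun (v : Pt × ℕ) => do
    let d ← argminR (fun e => charge 50 (distPtSeg v.1 e)) es
    charge 2 ((d.map Prod.snd).getD 0)) xs
  let k := (x.start + (best.map fun b => b.1.2).getD 0) % t.n
  let γ₁ ← geodesicPts t k s.start
  let γ₂ ← geodesicPts t k s.finish
  let r ← dropCommon γ₁ γ₂
  let back ← reverseR r.1
  let path ← appendR back r.2.tail
  let l₁ ← lengthR path
  let l₂ ← lengthR s.pts
  let ps ← zipR path s.pts
  let differ ← anyR (fun (p : Pt × Pt) => charge 4 (!same p.1 p.2)) ps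
  charge 3 (if differ || l₁ != l₂ then some (.extend s path) else none)

/-- Go through the pairs by increasing distance until one can be treated. -/
def findCut (t : Triang) (subs : List Sub) (bad : Table) : Run (Option Cut × Table) := do
  let rows ← candidateRows subs bad
  let s ← lengthR subs
  let r ← whileR (fun (st : List (List Pair) × Option Cut × Table) => do
    let heads ← foldR (fun (hs : List Pair) (row : List Pair) => charge 2 (match row with
      | p :: _ => p :: hs
      | [] => hs)) [] st.1
    match ← argminR (fun (p : Pair) => charge 1 p.dist) heads with
    | none => charge 1 (st, false)
    | some (p, _) => do
      let c ← if p.fst.unit.isNone then tryExtend t p.snd p.fst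
        else if p.snd.unit.isNone then tryExtend t p.fst p.snd
        else tryJoin t p.fst p.snd
      match c with
      | some c => charge 5 ((st.1, some c, st.2.2), false)
      | none => do
        let rows ← mapR (fun (row : List Pair) => match row with
          | q :: rest => if q.fst.id == p.fst.id then closestFirst rest else charge 2 row
          | [] => charge 1 []) st.1
        charge 10 ((rows, none, st.2.2.mark p.fst.id p.snd.id), true))
    (s * s + 1) (rows, none, bad)
  return r.2

/-- The part of a path up to the point `p` (in reverse order, starting with `p`), and the part from
`p` on. -/
def breakAt (p : Pt) : List Pt → List Pt → Run (Option (List Pt × List Pt))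
  | _, [] => charge 1 none
  | acc, q :: l =>
    if same p q then charge 5 (some (q :: acc, q :: l)) else do
      let _ ← charge 5 ()
      breakAt p (q :: acc) l

/-- Do two segments cross in an interior point of both? -/
def properCross (e f : Seg) : Bool :=
  decide (orient e.1 e.2 f.1 * orient e.1 e.2 f.2 < 0) &&
  decide (orient f.1 f.2 e.1 * orient f.1 f.2 e.2 < 0)

/-- Insert `p` into the edge `e` of a path. -/
def insertPoint (p : Pt) (e : Seg) (path : List Pt) : Run (List Pt) := do
  let parts ← mapR (fun q => charge 5 (if same q e.1 then [q, p] else [q])) path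
  concatR parts

/-- The meeting point of the diagonals `β₁` and `β₂` of the polygon `l`: a common vertex, or else a
crossing, which becomes a new vertex of a subdivision of `l` and of both paths. -/
def meetPaths (l : Loop) (β₁ β₂ : List Pt) : Run (List Loop × Pt × List Pt × List Pt) := do
  match ← findR (fun p => anyR (fun q => charge 4 (same p q)) β₂) β₁ with
  | some p => charge 2 ([l], p, β₁, β₂)
  | none => do
    let es ← pathEdges β₁
    let fs ← pathEdges β₂
    let pairs ← mapR (fun e => do
      let f ← findR (fun f => charge 40 (properCross e f)) fs
      charge 1 (f.map fun f => (e, f))) es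
    match ← findR (fun (c : Option (Seg × Seg)) => charge 1 c.isSome) pairs with
    | some (some (e, f)) => do
      let p ← charge 30 (meet e.1 (vec e.1 e.2) f.1 (vec f.1 f.2))
      let loops ← addChord [l] e.1 e.2
      let loops ← addPoint loops e.1 e.2 p
      let γ₁ ← insertPoint p e β₁
      let γ₂ ← insertPoint p f β₂
      return (loops, p, γ₁, γ₂)
    | _ => return ([l], default, β₁, β₂)

/-- Carry out a cut; `fresh` and `fresh + 1` number the new sub-boundaries. -/
def applyCut (l : Loop) (fresh : ℕ) : Cut → Run (List Loop)
  | .extend s path => cutPath [l] path fresh s.unit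
  | .join s s' β₁ β₂ => do
    let (loops, p, γ₁, γ₂) ← meetPaths l β₁ β₂
    match ← breakAt p [] γ₁, ← breakAt p [] γ₂ with
    | some (pa, pc), some (pb, pd) => do
      -- `pa`: from `p` back to the start of `s`; `pb`: from `p` back to the end of `s`;
      -- `pc`, `pd`: from `p` on to the start and the end of `s'`
      let ap ← reverseR pa
      let apb ← appendR ap pb.tail
      let cp ← reverseR pc
      let cpd ← appendR cp pd.tail
      let loops ← cutPath loops apb fresh s.unit
      cutPath loops cpd (fresh + 1) s'.unit
    | _, _ => return [l]

/-- If all sub-boundaries that are adjacent to units are adjacent to the same unit, this unit. -/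
def onlyUnit (subs : List Sub) : Run (Option ℕ) := do
  match ← findR (fun (s : Sub) => charge 1 s.unit.isSome) subs with
  | none => return none
  | some s => do
    let other ← anyR (fun (s' : Sub) => charge 2 (s'.unit.isSome && s'.unit != s.unit)) subs
    charge 1 (if other then none else s.unit)

/-- State of the work on one gap: remaining gaps, polygons assigned so far, table of pairs known not
to be strongly mutually visible, next free number. -/
structure GapState where
  todo : List Loop
  parts : List Part
  bad : Table
  fresh : ℕ

/-- Treat one remaining (simplified) gap. -/
def gapStep (st : GapState) : Run (GapState × Bool) := do
  match st.todo with
  | [] => charge 1 (st, false)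
  | l :: todo => do
    let st := { st with todo := todo }
    let (subs, poly) ← subBoundaries l
    let ids ← mapR (fun (s : Sub) => charge 1 s.id) subs
    let rep ← repeatsR ids
    let only ← onlyUnit subs
    let found ← anyR (fun (s : Sub) => charge 1 s.unit.isSome) subs
    let t ← triangulate poly
    let proceed := fun (loops : List Loop) (st : GapState) => do
      let (ps, gaps) ← sortLoops loops
      let ps ← appendR ps st.parts
      let gaps ← appendR gaps st.todo
      return ({ st with parts := ps, todo := gaps }, true)
    if rep || !found then charge 3 (st, true) else
    match only, subs with
    | some u, _ => do
      let es ← loopEdges l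
      charge 3 ({ st with parts := (es, u) :: st.parts }, true)
    | none, [_, _] => do
      let loops ← convexify l subs t
      proceed loops st
    | none, [s₀, s₁, s₂] =>
      if s₀.unit.isNone then do
        let loops ← fillExteriorThree l t s₁ s₂ s₀
        proceed loops st
      else if s₁.unit.isNone then do
        let loops ← fillExteriorThree l t s₂ s₀ s₁
        proceed loops st
      else if s₂.unit.isNone then do
        let loops ← fillExteriorThree l t s₀ s₁ s₂
        proceed loops st
      else do
        let ps ← fillThree s₀ s₁ s₂
        let ps ← appendR ps st.parts
        charge 5 ({ st with parts := ps }, true)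
    | none, _ => do
      let (c, bad) ← findCut t subs st.bad
      let st := { st with bad := bad }
      match c with
      | none => charge 3 (st, true)
      | some c => do
        let loops ← applyCut l st.fresh c
        proceed loops { st with fresh := st.fresh + 2 }

/-- Close one simply connected gap, given by its boundary edges in counterclockwise order together
with the adjacent units (`none` for exterior edges). A gap with `n` edges is exhausted after at most
`4 n` steps, since every step either disposes of a gap or cuts off a polygon. -/
def closeGap (edges : List (Seg × Option ℕ)) : Run (List Part) := do
  let n ← lengthR edges
  let runs ← runsR (fun (e f : Seg × Option ℕ) => e.2 == f.2) edges
  let runsN ← numberR runs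
  let l ← mapR (fun (g : List (Seg × Option ℕ) × ℕ) =>
    mapR (fun (e : Seg × Option ℕ) =>
      charge 5 (⟨e.1.1, e.1.2, g.2, e.2, false⟩ : GapEdge)) g.1) runsN
  let l ← concatR l
  let (subs, poly) ← subBoundaries l
  let s ← lengthR subs
  match ← onlyUnit subs with
  | some u => do
    let es ← loopEdges l
    return [(es, u)]
  | none => do
    let t ← triangulate poly
    let loops ← convexify l subs t
    let (ps, gaps) ← sortLoops loops
    let steps := 4 * n + 4
    let width := s + 2 * steps
    let cells ← allocR (width * width) false
    let r ← whileR gapStep steps ⟨gaps, ps, ⟨width, cells⟩, s⟩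
    return r.parts

/-- Close all simply connected gaps, that is, pieces of overlap order 0. Edges of a gap on whose other
side there is no unit of the same region are exterior. -/
def closeGaps (ps : List Piece) : Run (List Part) := do
  let gaps ← filterR (fun (q : Piece) => charge 2 (q.order == 0 && q.simple)) ps
  let parts ← mapR (fun (q : Piece) => do
    let es ← mapR (fun (e : Seg) => do
      let nb ← findR (fun (q' : Piece) =>
        if q'.unit.isSome && q'.region == q.region then touchR [e] q'.edges else charge 2 false) ps
      charge 2 (e, nb.bind Piece.unit)) q.edges
    closeGap es) gaps
  concatR parts

/-! ### Step 4: cleaning up -/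

/-- Reassign small components of the unit `k`: as long as the smallest component has area less than
`θ` times the area of the largest one, it goes to the unit (of the same region) with which it shares
the largest perimeter. -/
def cleanUnit (θ : ℝ) (N : ℕ) (ureg : Array ℕ) (parts : List (Part × ℕ)) (k : ℕ) :
    Run (List (Part × ℕ)) := do
  let mine ← filterR (fun (p : Part × ℕ) => charge 1 (p.1.2 == k)) parts
  let comps ← componentsR (fun (p p' : Part × ℕ) => touchR p.1.1 p'.1.1) mine
  let sized ← mapR (fun (c : List (Part × ℕ)) => do
    let es ← mapR (fun (p : Part × ℕ) => charge 1 p.1.1) c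
    let es ← concatR es
    let a ← areaR es
    charge 2 (a, c, es)) comps
  let sorted ← sortR Prod.fst sized
  let n ← lengthR sorted
  let units ← rangeR 0 N
  let r ← whileR (fun (s : List (Part × ℕ) × List (ℝ × List (Part × ℕ) × List Seg)) => do
    let big ← lastR s.2
    match s.2, big with
    | (a, c, es) :: c' :: rest, some (b, _) =>
      if a < θ * b then do
        let zero ← allocR N (0 : ℝ)
        let shared ← foldR (fun (acc : Array ℝ) (p : Part × ℕ) => do
          let v ← sharedR es p.1.1
          charge 4 (acc.setIfInBounds p.1.2 (acc.getD p.1.2 0 + v))) zero s.1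
        let others ← filterR (fun u => charge 5 (u != k && ureg.getD u 0 == ureg.getD k 0)) units
        match ← argmaxR (fun u => charge 1 (shared.getD u 0)) others with
        | none => return (s, false)
        | some (u, v) =>
          if 0 < v then do
            let ids ← mapR (fun (p : Part × ℕ) => charge 1 p.2) c
            let ps ← mapR (fun (p : Part × ℕ) => do
              let m ← memR p.2 ids
              charge 3 (if m then ((p.1.1, u), p.2) else p)) s.1
            charge 5 ((ps, c' :: rest), true)
          else charge 1 (s, false)
      else charge 2 (s, false)
    | _, _ => charge 2 (s, false)) (n + 1) (parts, sorted)
  return r.1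

/-- All parts: the assigned pieces and the polygons from the gaps, after cleaning up. -/
def cleanUp (θ : ℝ) (N : ℕ) (ureg : Array ℕ) (ps : List Piece) (filled : List Part) :
    Run (List Part) := do
  let all ← foldR (fun (acc : List Part) (q : Piece) => charge 2 (match q.unit with
    | some u => (q.edges, u) :: acc
    | none => acc)) filled ps
  let allN ← numberR all
  let units ← rangeR 0 N
  let r ← foldR (cleanUnit θ N ureg) allN units
  mapR (fun (p : Part × ℕ) => charge 1 p.1) r

/-- A directed boundary edge of a repaired unit: the unit is on its left; on its right there is
another unit or none. -/
structure BoundaryEdge where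
  edge : Seg
  left : ℕ
  right : Option ℕ

/-- The boundaries of the unions of the parts of each unit. -/
def boundariesR (parts : List Part) : Run (List BoundaryEdge) := do
  let bs ← mapR (fun (p : Part) => mapR (fun (e : Seg) => do
    let nb ← findR (fun (p' : Part) => touchR [e] p'.1) parts
    charge 3 (⟨e, p.2, nb.map Prod.snd⟩ : BoundaryEdge)) p.1) parts
  let bs ← concatR bs
  filterR (fun (b : BoundaryEdge) => charge 1 (b.right != some b.left)) bs

/-! ### Optional conversion of small rook adjacencies to queen adjacencies -/

/-- Insert the normalized midpoints between consecutive points of the unit circle. -/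
def refineCircle (p : Poly) : Run Poly := do
  let es ← ringEdges p
  let ps ← mapR (fun (e : Seg) => do
    let m : Pt := ⟨e.1.x + e.2.x, e.1.y + e.2.y⟩
    charge 20 [e.1, unitVec ⟨0, 0⟩ m]) es
  concatR ps

/-- The regular polygon with 64 vertices that represents the unit disk. -/
def circleR : Run Poly := do
  let p ← refineCircle [⟨1, 0⟩, ⟨0, 1⟩, ⟨-1, 0⟩, ⟨0, -1⟩]
  let p ← refineCircle p
  let p ← refineCircle p
  refineCircle p

/-- The disk around an adjacency (a connected common boundary of two units, given by its directed
edges) of length `len`: its center is the midpoint between the end points of the adjacency, its radius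
is slightly larger than `len / 2`. For a closed curve, any of its vertices counts as both end
points. -/
def diskAround (circle : Poly) (adj : List BoundaryEdge) (len : ℝ) : Run Poly := do
  let first ← findR (fun (b : BoundaryEdge) => do
    let e ← anyR (fun (b' : BoundaryEdge) => charge 4 (same b'.edge.2 b.edge.1)) adj
    charge 1 (!e)) adj
  let last ← findR (fun (b : BoundaryEdge) => do
    let e ← anyR (fun (b' : BoundaryEdge) => charge 4 (same b'.edge.1 b.edge.2)) adj
    charge 1 (!e)) adj
  let v := (adj.head?.map fun b => b.edge.1).getD default
  let p := (first.map fun b => b.edge.1).getD v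
  let q := (last.map fun b => b.edge.2).getD v
  let m := along p (vec p q) (1 / 2)
  let _ ← charge 20 ()
  mapR (fun u => charge 8 (along m u (101 / 200 * len))) circle

/-- Is there an edge of the convex polygon `p` with all of `q` on its outer side? -/
def separatesR (p q : Poly) : Run Bool := do
  let es ← ringEdges p
  anyR (fun (e : Seg) => do
    let inner ← anyR (fun v => charge 8 (decide (0 < orient e.1 e.2 v))) q
    charge 1 (!inner)) es

/-- Do two convex polygons have common interior points? -/
def overlapR (p q : Poly) : Run Bool := do
  let a ← separatesR p q
  let b ← separatesR q p
  charge 3 (!a && !b)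

/-- Convex hull by gift wrapping, counterclockwise. -/
def hullR (ps : List Pt) : Run Poly := do
  let n ← lengthR ps
  match ps with
  | [] => return []
  | p :: _ => do
    let low ← foldR (fun (b : Pt) q => charge 5 (
      if q.y < b.y ∨ (q.y = b.y ∧ q.x < b.x) then q else b)) p ps
    let r ← whileR (fun (s : List Pt × Pt) => do
      let nxt ← foldR (fun (b : Pt) q => charge 40 (
        if same b s.2 then q
        else if orient s.2 b q < 0 ∨ (orient s.2 b q = 0 ∧ distance s.2 b < distance s.2 q) then q
        else b)) s.2 ps
      charge 5 ((s.2 :: s.1, nxt), !same nxt low)) n ([], low)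
    reverseR r.1

/-- Replace overlapping polygons by the convex hull of their union, until there are no overlaps. -/
def mergeDisks (disks : List Poly) : Run (List Poly) :=
  foldR (fun (acc : List Poly) (d : Poly) => do
    let n ← lengthR acc
    let r ← whileR (fun (s : List Poly × Poly) => do
      let p ← partitionR (overlapR s.2) s.1
      match p.1 with
      | [] => charge 1 (s, false)
      | _ :: _ => do
        let vs ← concatR (s.2 :: p.1)
        let h ← hullR vs
        charge 2 ((p.2, h), true)) (n + 1) (acc, d)
    charge 1 (r.2 :: r.1)) [] disks

/-- Centroid of a polygon. -/
def centroidR (p : Poly) : Run Pt := do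
  let es ← ringEdges p
  let r ← foldR (fun (s : ℝ × ℝ × ℝ) e => charge 20 (
    let c := cross e.1 e.2
    (s.1 + 3 * c, s.2.1 + c * (e.1.x + e.2.x), s.2.2 + c * (e.1.y + e.2.y)))) (0, 0, 0) es
  charge 2 ⟨r.2.1 / r.1, r.2.2 / r.1⟩

/-- The interval of parameters of the points of `e` in the convex polygon with edges `es` (empty if
the first end exceeds the second). -/
def clipR (e : Seg) (es : List Seg) : Run (ℝ × ℝ) :=
  foldR (fun (s : ℝ × ℝ) g => charge 30 (
    let f₀ := orient g.1 g.2 e.1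
    let f₁ := orient g.1 g.2 e.2
    if 0 ≤ f₀ ∧ 0 ≤ f₁ then s
    else if f₀ < 0 ∧ f₁ < 0 then (1, 0)
    else if f₀ < 0 then (max s.1 (f₀ / (f₀ - f₁)), s.2)
    else (s.1, min s.2 (f₀ / (f₀ - f₁))))) (0, 1) es

/-- Remove from a boundary edge what lies in one of the disks (given by edges and center), and join
each new end point on the boundary of a disk to the center. -/
def reroute (disks : List (List Seg × Pt)) (b : BoundaryEdge) : Run (List BoundaryEdge) := do
  let u := vec b.edge.1 b.edge.2
  let at' := fun t => along b.edge.1 u t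
  let ivs ← mapR (fun (d : List Seg × Pt) => do
    let i ← clipR b.edge d.1
    charge 1 (i, d.2)) disks
  let ivs ← filterR (fun (i : (ℝ × ℝ) × Pt) => charge 5 (
    decide (i.1.1 < i.1.2) || (decide (i.1.1 = i.1.2) && (decide (i.1.1 = 1) || decide (i.1.2 = 0)))))
    ivs
  let ivs ← sortR (fun i => i.1.1) ivs
  let r ← foldR (fun (s : List BoundaryEdge × ℝ) (i : (ℝ × ℝ) × Pt) => charge 40 (
    let s₁ := if s.2 < i.1.1 then { b with edge := (at' s.2, at' i.1.1) } :: s.1 else s.1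
    let s₂ := if 0 < i.1.1 then { b with edge := (at' i.1.1, i.2) } :: s₁ else s₁
    let s₃ := if i.1.2 < 1 then { b with edge := (i.2, at' i.1.2) } :: s₂ else s₂
    (s₃, i.1.2))) ([], 0) ivs
  charge 20 (if r.2 < 1 then { b with edge := (at' r.2, at' 1) } :: r.1 else r.1)

/-- Convert all rook adjacencies of length below `ε` to queen adjacencies. -/
def rookToQueen (ε : ℝ) (bs : List BoundaryEdge) : Run (List BoundaryEdge) := do
  let inner ← filterR (fun (b : BoundaryEdge) => charge 3 (match b.right with
    | some j => decide (b.left < j)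
    | none => false)) bs
  let adjs ← componentsR (fun (b b' : BoundaryEdge) => charge 20 (
    b.left == b'.left && b.right == b'.right &&
    (same b.edge.1 b'.edge.2 || same b.edge.2 b'.edge.1 ||
     same b.edge.1 b'.edge.1 || same b.edge.2 b'.edge.2))) inner
  let sized ← mapR (fun (c : List BoundaryEdge) => do
    let len ← foldR (fun (s : ℝ) (b : BoundaryEdge) =>
      charge 10 (s + distance b.edge.1 b.edge.2)) 0 c
    charge 1 (c, len)) adjs
  let small ← filterR (fun (c : List BoundaryEdge × ℝ) => charge 1 (decide (c.2 < ε))) sized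
  let circle ← circleR
  let disks ← mapR (fun (c : List BoundaryEdge × ℝ) => diskAround circle c.1 c.2) small
  let disks ← mergeDisks disks
  let disks ← mapR (fun (d : Poly) => do
    let es ← ringEdges d
    let c ← centroidR d
    charge 1 (es, c)) disks
  let rs ← mapR (reroute disks) bs
  concatR rs

/-! ### The algorithm -/

/-- The `smart_repair` algorithm. Input: the list `T` of the unit polygons; the parameter `θ` of the
cleaning-up step; optionally, a list of region polygons into which the units have to nest (the
region-aware version); optionally, the length below which rook adjacencies are converted to queen
adjacencies. Output: the boundaries of the repaired units. -/
def smartRepair (T : List Poly) (θ : ℝ) (regions : Option (List Poly)) (rook : Option ℝ) :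
    Run (List BoundaryEdge) := do
  let N ← lengthR T
  let (pieces, ureg) ← refinedTiling T regions
  let pieces ← assignOverlaps N pieces
  let filled ← closeGaps pieces
  let parts ← cleanUp θ N ureg pieces filled
  let bs ← boundariesR parts
  match rook with
  | none => return bs
  | some ε => rookToQueen ε bs

/-- The primary algorithm: no optional features. -/
def primarySmartRepair (T : List Poly) (θ : ℝ) : Run (List BoundaryEdge) :=
  smartRepair T θ none none

/-- Total number of edges of a list of polygons. -/
def edgeCount (T : List Poly) : ℕ := (T.map List.length).sum

end SmartRepair

end

namespace SmartRepair

/-! ### Reasoning about step-counting computations -/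

/-! The bound is obtained by composing worst-case bounds for the single steps. Each specification
bounds the cost of a program together with the size of its result, and the size feeds the next
bound. Geometry enters only where it controls sizes; that faces, shortest paths or hulls are
geometrically correct is never needed, since wherever such a fact would bound a loop, its fuel or a
conserved count does so instead.

Sizes. An edge meets every other edge in at most two parameters, so the noded union has at most `2 *
(E + 1) ^ 2` segments. Every half-edge is traced once, and every hole is given to at most one outer
ring. Hence `M = 8 * (E + 1) ^ 2` bounds both the number of pieces and the total number of their
boundary edges (`nodedUnion_spec`, `polygonize_spec`, `refinedTiling_spec`). Repeated vertices of a
boundary walk are split off by a stack, so a piece without holes is bounded by a ring with distinct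
vertices.

Costs. The refined tiling takes `O(E ^ 5)` steps, dominated by the assignment of units to regions.
Overlaps take `O(N ^ 2 * M ^ 2)`: there are at most `N` orders, and each costs `O(N * M ^ 2)`
(`assignOverlaps_spec`). Gaps take `O(M ^ 3)`, cleaning up `O(N * M ^ 2)`, extraction of boundaries
`O(M ^ 2)`, and the rook-to-queen conversion `O(M ^ 3)` (`rookToQueen_cost_le`). With `N ≤ E` and `M
= O(E ^ 2)`, everything is `O(E ^ 6)`.

The main point is that one gap with `n` edges is closed in `O(n ^ 3)` steps (`closeGap_spec`); cubes
of the sizes of the gaps sum to at most the cube of their sum. Two facts make this work. First, the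
sum of (number of edges minus two) over the polygons of a subdivision is preserved by a chord and
grows only when crossing diagonals create a new vertex. Thus all polygons stay of total size `O(n)`
during the `O(n)` passes. Triangulating a polygon takes quadratic time and a shortest path linear
time, because every vertex leaves the funnel at most once. Second, a pass may reject many pairs of
sub-boundaries, at linear cost each besides the cost of measuring distances. A rejected pair is
marked in a table that survives all passes, so at most `O(n ^ 2)` pairs are rejected in total. This
is a potential argument with the number of unmarked cells as potential (`cutPass_amortized`,
`gapStep_amortized`). Similar potentials handle the funnel, the reassignment of small components and
the merging of disks.

All of this gives a multiple of `(E + 1) ^ 6`; since the input has an edge, `E + 1 ≤ 2 * E` turns it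
into a multiple of `E ^ 6`. -/

@[simp] theorem bind_val {α β : Type} (m : Run α) (f : α → Run β) :
    (m >>= f).val = (f m.val).val := rfl
@[simp] theorem bind_cost {α β : Type} (m : Run α) (f : α → Run β) :
    (m >>= f).cost = m.cost + (f m.val).cost := rfl
@[simp] theorem pure_val {α : Type} (a : α) : (pure a : Run α).val = a := rfl
@[simp] theorem pure_cost {α : Type} (a : α) : (pure a : Run α).cost = 0 := rfl
@[simp] theorem charge_val {α : Type} (k : ℕ) (a : α) : (charge k a).val = a := rfl
@[simp] theorem charge_cost {α : Type} (k : ℕ) (a : α) : (charge k a).cost = k := rfl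

theorem charge_bind {α β : Type} (k : ℕ) (a : α) (f : α → Run β) :
    charge k a >>= f = ⟨(f a).val, k + (f a).cost⟩ := rfl

/-- The computation takes at most `k` steps, and its result satisfies `Q`. -/
def Spec {α : Type} (m : Run α) (k : ℕ) (Q : α → Prop) : Prop := m.cost ≤ k ∧ Q m.val

namespace Spec

variable {α β : Type} {m : Run α} {f : α → Run β} {k k' k₁ k₂ : ℕ} {Q Q' : α → Prop}
  {R : β → Prop}

theorem charge {a : α} (h : Q a) : Spec (charge k a) k Q := ⟨le_rfl, h⟩

theorem bind (h₁ : Spec m k₁ Q) (h₂ : ∀ a, Q a → Spec (f a) k₂ R) :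
    Spec (m >>= f) (k₁ + k₂) R :=
  ⟨Nat.add_le_add h₁.1 (h₂ _ h₁.2).1, (h₂ _ h₁.2).2⟩

theorem le (h : Spec m k Q) (hk : k ≤ k') : Spec m k' Q := ⟨h.1.trans hk, h.2⟩

theorem imp (h : Spec m k Q) (hQ : ∀ a, Q a → Q' a) : Spec m k Q' := ⟨h.1, hQ _ h.2⟩

theorem and (h : Spec m k Q) (h' : Q' m.val) : Spec m k (fun a => Q a ∧ Q' a) := ⟨h.1, h.2, h'⟩

theorem cost_le (h : m.cost ≤ k) : Spec m k (fun _ => True) := ⟨h, trivial⟩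

end Spec

/-- After `c` steps that have been spent before, the computation stays within a total of `k` steps,
and its result satisfies `Q`. -/
def Within {α : Type} (c : ℕ) (m : Run α) (k : ℕ) (Q : α → Prop) : Prop :=
  c + m.cost ≤ k ∧ Q m.val

namespace Within

variable {α β : Type} {m : Run α} {f : α → Run β} {c j k k₁ : ℕ} {Q Q' : α → Prop}
  {R : β → Prop}

theorem spec (h : Within 0 m k Q) : Spec m k Q := ⟨by simpa using h.1, h.2⟩

theorem charge {a : α} (hk : c + j ≤ k) (h : Q a) : Within c (charge j a) k Q := ⟨hk, h⟩

theorem pure {a : α} (hk : c ≤ k) (h : Q a) : Within c (pure a : Run α) k Q := ⟨hk, h⟩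

/-- The steps spent so far are carried along as a symbolic sum, so a program is traversed once and
the budget is checked by a single inequality at each exit. -/
theorem bind (h₁ : Spec m k₁ Q) (h₂ : ∀ a, Q a → Within (c + k₁) (f a) k R) :
    Within c (m >>= f) k R := by
  obtain ⟨h3, h4⟩ := h₂ _ h₁.2
  have := h₁.1
  exact ⟨by rw [bind_cost]; omega, h4⟩

/-- A step of known cost without a result. -/
theorem tick {a : α} (h₂ : Within (c + j) (f a) k R) :
    Within c (SmartRepair.charge j a >>= f) k R :=
  bind (Q := fun b => b = a) (Spec.charge rfl) fun _ h => h ▸ h₂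

theorem last (h : Spec m k₁ Q) (hk : c + k₁ ≤ k) (hQ : ∀ a, Q a → Q' a) : Within c m k Q' :=
  ⟨by have := h.1; omega, hQ _ h.2⟩

theorem ite {p : Prop} [Decidable p] {m' : Run α} (h₁ : p → Within c m k Q)
    (h₂ : ¬p → Within c m' k Q) : Within c (if p then m else m') k Q := by
  split_ifs with h
  exacts [h₁ h, h₂ h]

/-- For a conditional in the middle of a program, whose continuation appears copied into both
branches: the continuation is analysed only once. -/
theorem ite_bind {p : Prop} [Decidable p] {m' : Run α}
    (h₁ : Spec (if p then m else m') k₁ Q) (h₂ : ∀ a, Q a → Within (c + k₁) (f a) k R) :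
    Within c (if p then m >>= f else m' >>= f) k R := by
  split_ifs with h <;> simp only [h, if_true, if_false] at h₁ <;> exact bind h₁ h₂

end Within

/-- After `c` steps that have been spent before, the computation stays within a total of `k` steps,
where `Φ` is the potential of the result. -/
def Amortized {α : Type} (c : ℕ) (m : Run α) (Φ : α → ℕ) (k : ℕ) (Q : α → Prop) : Prop :=
  c + m.cost + Φ m.val ≤ k ∧ Q m.val

namespace Amortized

variable {α β : Type} {m m' m'' : Run α} {f : α → Run β} {c j k k₁ : ℕ} {Φ : α → ℕ}
  {Ψ : β → ℕ} {Q Q' : α → Prop} {R : β → Prop}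

theorem charge {a : α} (hk : c + j + Φ a ≤ k) (h : Q a) :
    Amortized c (charge j a) Φ k Q := ⟨hk, h⟩

theorem bind (h₁ : Spec m k₁ Q) (h₂ : ∀ a, Q a → Amortized (c + k₁) (f a) Ψ k R) :
    Amortized c (m >>= f) Ψ k R := by
  obtain ⟨h3, h4⟩ := h₂ _ h₁.2
  have := h₁.1
  exact ⟨by rw [bind_cost, bind_val]; omega, h4⟩

/-- A step whose cost is partly paid for by a decrease of the potential. -/
theorem bind_amortized (h₁ : Amortized 0 m Φ k₁ Q)
    (h₂ : ∀ a d, d + Φ a ≤ k₁ → Q a → Amortized (c + d) (f a) Ψ k R) :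
    Amortized c (m >>= f) Ψ k R := by
  obtain ⟨h3, h4⟩ := h₂ _ m.cost (by simpa using h₁.1) h₁.2
  exact ⟨by rw [bind_cost, bind_val]; omega, h4⟩

theorem last (h : Spec m k₁ Q) (hk : ∀ a, Q a → c + k₁ + Φ a ≤ k ∧ Q' a) :
    Amortized c m Φ k Q' := by
  obtain ⟨h3, h4⟩ := hk _ h.2
  have := h.1
  exact ⟨by omega, h4⟩

theorem ite {p : Prop} [Decidable p] (h₁ : p → Amortized c m Φ k Q)
    (h₂ : ¬p → Amortized c m' Φ k Q) : Amortized c (if p then m else m') Φ k Q := by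
  split_ifs with h
  exacts [h₁ h, h₂ h]

theorem ite_ite_bind {p q : Prop} [Decidable p] [Decidable q]
    (h₁ : Spec (if p then m else if q then m' else m'') k₁ Q)
    (h₂ : ∀ a, Q a → Amortized (c + k₁) (f a) Ψ k R) :
    Amortized c (if p then m >>= f else if q then m' >>= f else m'' >>= f) Ψ k R := by
  split_ifs with h h' <;> simp only [h, if_true, if_false] at h₁
  · exact bind h₁ h₂
  · simp only [h', if_true] at h₁
    exact bind h₁ h₂
  · simp only [h', if_false] at h₁
    exact bind h₁ h₂

end Amortized

/-! ### Sums over lists -/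

section Sums

variable {α β : Type}

theorem sum_map_le_sum {l : List α} {f g : α → ℕ} (h : ∀ a ∈ l, f a ≤ g a) :
    (l.map f).sum ≤ (l.map g).sum := List.sum_le_sum h

theorem sum_map_le_mul {l : List α} {f : α → ℕ} {K : ℕ} (h : ∀ a ∈ l, f a ≤ K) :
    (l.map f).sum ≤ K * l.length := by
  induction l with
  | nil => simp
  | cons a l ih =>
    have h1 := h a (by simp)
    have h2 := ih fun b hb => h b (by simp [hb])
    simp only [List.map_cons, List.sum_cons, List.length_cons]
    linarith

theorem sum_map_add_const (l : List α) (f : α → ℕ) (k : ℕ) :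
    (l.map fun a => f a + k).sum = (l.map f).sum + k * l.length := by
  induction l with
  | nil => simp
  | cons a l ih => simp only [List.map_cons, List.sum_cons, List.length_cons, ih]; ring

theorem sum_map_mul_const (l : List α) (f : α → ℕ) (k : ℕ) :
    (l.map fun a => k * f a).sum = k * (l.map f).sum := by
  induction l with
  | nil => simp
  | cons a l ih => simp only [List.map_cons, List.sum_cons, ih]; ring

theorem sum_map_add (l : List α) (f g : α → ℕ) :
    (l.map fun a => f a + g a).sum = (l.map f).sum + (l.map g).sum := by
  induction l with
  | nil => simp
  | cons a l ih => simp only [List.map_cons, List.sum_cons, ih]; ring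

theorem le_sum_map {l : List α} {a : α} (h : a ∈ l) (f : α → ℕ) : f a ≤ (l.map f).sum :=
  List.single_le_sum (by simp) _ (List.mem_map_of_mem h)

theorem length_le_sum_map {l : List α} {f : α → ℕ} (h : ∀ a ∈ l, 1 ≤ f a) :
    l.length ≤ (l.map f).sum := by
  induction l with
  | nil => simp
  | cons a l ih =>
    have h1 := h a (by simp)
    have h2 := ih fun b hb => h b (by simp [hb])
    simp only [List.map_cons, List.sum_cons, List.length_cons]
    linarith

theorem sublist_sum_map_le {l l' : List α} (h : l.Sublist l') (f : α → ℕ) :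
    (l.map f).sum ≤ (l'.map f).sum := (h.map f).sum_le_sum (by simp)

theorem sum_map_filter_le (l : List α) (p : α → Bool) (f : α → ℕ) :
    ((l.filter p).map f).sum ≤ (l.map f).sum := sublist_sum_map_le List.filter_sublist f

theorem sum_map_flatten (ls : List (List α)) (f : α → ℕ) :
    (ls.flatten.map f).sum = (ls.map fun l => (l.map f).sum).sum := by
  induction ls with
  | nil => simp
  | cons l ls ih => rw [List.flatten_cons, List.map_append, List.sum_append, ih]; rfl

/-- Superadditivity of the cube: it turns cubic bounds for the single gaps into a cubic bound in
their total size. -/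
theorem sum_map_pow_three_le (l : List α) (f : α → ℕ) :
    (l.map fun a => f a ^ 3).sum ≤ (l.map f).sum ^ 3 := by
  induction l with
  | nil => simp
  | cons a l ih =>
    simp only [List.map_cons, List.sum_cons]
    nlinarith [Nat.zero_le (f a * (l.map f).sum * (f a + (l.map f).sum))]

/-- Components and runs are non-empty, so there are no more of them than elements. -/
theorem length_flatten_le {ls : List (List α)} (h : ∀ l ∈ ls, l ≠ []) :
    ls.length ≤ ls.flatten.length := by
  rw [List.length_flatten]
  exact length_le_sum_map fun l hl => List.length_pos_iff.2 (h l hl)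

end Sums

/-! ### Costs and results of the basic programs -/

section Basic

variable {α β σ : Type}

theorem mapR_val (f : α → Run β) (l : List α) : (mapR f l).val = l.map fun a => (f a).val := by
  induction l with
  | nil => rfl
  | cons a l ih => simp [mapR, ih]

theorem mapR_cost (f : α → Run β) (l : List α) :
    (mapR f l).cost = (l.map fun a => (f a).cost).sum + 2 * l.length + 1 := by
  induction l with
  | nil => rfl
  | cons a l ih => simp [mapR, ih]; ring

theorem Spec.mapR {f : α → Run β} {l : List α} {c : α → ℕ} (h : ∀ a ∈ l, (f a).cost ≤ c a) :
    Spec (mapR f l) ((l.map c).sum + 2 * l.length + 1)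
      (fun r => r = l.map fun a => (f a).val) := by
  refine ⟨?_, mapR_val f l⟩
  rw [mapR_cost]
  have := sum_map_le_sum h
  omega

theorem Spec.mapR_const {f : α → Run β} {l : List α} {K : ℕ} (h : ∀ a ∈ l, (f a).cost ≤ K) :
    Spec (SmartRepair.mapR f l) ((K + 2) * l.length + 1)
      (fun r => r = l.map fun a => (f a).val) := by
  refine ⟨?_, mapR_val f l⟩
  rw [mapR_cost]
  have := sum_map_le_mul h
  linarith

theorem partitionR_val (p : α → Run Bool) (l : List α) :
    (partitionR p l).val = (l.filter fun a => (p a).val, l.filter fun a => !(p a).val) := by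
  induction l with
  | nil => rfl
  | cons a l ih =>
    simp only [partitionR, bind_val, charge_val, ih]
    by_cases h : (p a).val <;> simp [h]

theorem partitionR_cost (p : α → Run Bool) (l : List α) :
    (partitionR p l).cost = (l.map fun a => (p a).cost).sum + 2 * l.length + 1 := by
  induction l with
  | nil => rfl
  | cons a l ih => simp [partitionR, ih]; ring

theorem filterR_val (p : α → Run Bool) (l : List α) :
    (filterR p l).val = l.filter fun a => (p a).val := by
  simp [filterR, partitionR_val]

theorem filterR_cost (p : α → Run Bool) (l : List α) :
    (filterR p l).cost = (l.map fun a => (p a).cost).sum + 2 * l.length + 1 := by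
  simp [filterR, partitionR_cost]

theorem Spec.filterR {p : α → Run Bool} {l : List α} {c : α → ℕ} (h : ∀ a ∈ l, (p a).cost ≤ c a) :
    Spec (filterR p l) ((l.map c).sum + 2 * l.length + 1)
      (fun r => r = l.filter fun a => (p a).val) := by
  refine ⟨?_, filterR_val p l⟩
  rw [filterR_cost]
  have := sum_map_le_sum h
  omega

theorem Spec.filterR_const {p : α → Run Bool} {l : List α} {K : ℕ} (h : ∀ a ∈ l, (p a).cost ≤ K) :
    Spec (SmartRepair.filterR p l) ((K + 2) * l.length + 1)
      (fun r => r = l.filter fun a => (p a).val) := by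
  refine ⟨?_, filterR_val p l⟩
  rw [filterR_cost]
  have := sum_map_le_mul h
  linarith

theorem findR_val (p : α → Run Bool) (l : List α) :
    (findR p l).val = l.find? fun a => (p a).val := by
  induction l with
  | nil => rfl
  | cons a l ih =>
    by_cases h : (p a).val <;> simp [findR, h, ih]

theorem findR_cost_le (p : α → Run Bool) (l : List α) :
    (findR p l).cost ≤ (l.map fun a => (p a).cost).sum + l.length + 1 := by
  induction l with
  | nil => simp [findR]
  | cons a l ih =>
    by_cases h : (p a).val <;> simp [findR, h] <;> omega

theorem Spec.findR {p : α → Run Bool} {l : List α} {c : α → ℕ} (h : ∀ a ∈ l, (p a).cost ≤ c a) :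
    Spec (findR p l) ((l.map c).sum + l.length + 1)
      (fun r => r = l.find? fun a => (p a).val) := by
  refine ⟨(findR_cost_le p l).trans ?_, findR_val p l⟩
  have := sum_map_le_sum h
  omega

theorem Spec.findR_const {p : α → Run Bool} {l : List α} {K : ℕ} (h : ∀ a ∈ l, (p a).cost ≤ K) :
    Spec (SmartRepair.findR p l) ((K + 1) * l.length + 1)
      (fun r => r = l.find? fun a => (p a).val) := by
  refine ⟨(findR_cost_le p l).trans ?_, findR_val p l⟩
  have := sum_map_le_mul h
  linarith

theorem anyR_val (p : α → Run Bool) (l : List α) :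
    (anyR p l).val = l.any fun a => (p a).val := by
  rw [Bool.eq_iff_iff]
  simp [anyR, findR_val, List.find?_isSome]

theorem anyR_cost_le (p : α → Run Bool) (l : List α) :
    (anyR p l).cost ≤ (l.map fun a => (p a).cost).sum + l.length + 2 := by
  have := findR_cost_le p l
  simp [anyR]; omega

theorem anyR_cost_le_sum {p : α → Run Bool} {l : List α} {c : α → ℕ}
    (h : ∀ a ∈ l, (p a).cost ≤ c a) : (anyR p l).cost ≤ (l.map c).sum + l.length + 2 := by
  have := anyR_cost_le p l
  have := sum_map_le_sum h
  omega

theorem anyR_cost_le_const {p : α → Run Bool} {l : List α} {K : ℕ} (h : ∀ a ∈ l, (p a).cost ≤ K) :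
    (anyR p l).cost ≤ (K + 1) * l.length + 2 := by
  have := anyR_cost_le p l
  have := sum_map_le_mul h
  linarith

theorem Spec.anyR {p : α → Run Bool} {l : List α} {c : α → ℕ} (h : ∀ a ∈ l, (p a).cost ≤ c a) :
    Spec (anyR p l) ((l.map c).sum + l.length + 2) (fun r => r = l.any fun a => (p a).val) :=
  ⟨anyR_cost_le_sum h, anyR_val p l⟩

theorem Spec.anyR_const {p : α → Run Bool} {l : List α} {K : ℕ} (h : ∀ a ∈ l, (p a).cost ≤ K) :
    Spec (SmartRepair.anyR p l) ((K + 1) * l.length + 2) (fun r => r = l.any fun a => (p a).val) :=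
  ⟨anyR_cost_le_const h, anyR_val p l⟩

theorem memR_cost_le (k : ℕ) (l : List ℕ) : (memR k l).cost ≤ 2 * l.length + 2 :=
  anyR_cost_le_const (by simp)

theorem memR_val (k : ℕ) (l : List ℕ) : (memR k l).val = decide (k ∈ l) := by
  rw [Bool.eq_iff_iff]
  simp [memR, anyR_val]

theorem concatR_val (ls : List (List α)) : (concatR ls).val = ls.flatten := by
  induction ls with
  | nil => rfl
  | cons l ls ih => simp [concatR, appendR, ih]

theorem concatR_cost (ls : List (List α)) :
    (concatR ls).cost = ls.flatten.length + ls.length + 1 := by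
  induction ls with
  | nil => rfl
  | cons l ls ih => simp [concatR, appendR, ih]; ring

theorem Spec.concatR (ls : List (List α)) :
    Spec (concatR ls) (ls.flatten.length + ls.length + 1) (fun r => r = ls.flatten) :=
  ⟨(concatR_cost ls).le, concatR_val ls⟩

theorem Spec.lengthR (l : List α) : Spec (lengthR l) (l.length + 1) (fun n => n = l.length) :=
  ⟨le_rfl, rfl⟩
theorem Spec.reverseR (l : List α) :
    Spec (reverseR l) (l.length + 1) (fun r => r = l.reverse) := ⟨le_rfl, rfl⟩
theorem Spec.appendR (l₁ l₂ : List α) :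
    Spec (appendR l₁ l₂) (l₁.length + 1) (fun r => r = l₁ ++ l₂) := ⟨le_rfl, rfl⟩
theorem Spec.lastR (l : List α) :
    Spec (lastR l) (l.length + 1) (fun r => r = l.getLast?) := ⟨le_rfl, rfl⟩
theorem Spec.arrayR (l : List α) :
    Spec (arrayR l) (l.length + 1) (fun r => r = l.toArray) := ⟨le_rfl, rfl⟩
theorem Spec.allocR (n : ℕ) (a : α) :
    Spec (allocR n a) (n + 1) (fun r => r = Array.replicate n a) := ⟨le_rfl, rfl⟩
theorem Spec.rangeR (a n : ℕ) :
    Spec (rangeR a n) (n + 1) (fun r => r = List.range' a n) := ⟨le_rfl, rfl⟩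
theorem Spec.zipR (l₁ : List α) (l₂ : List β) :
    Spec (zipR l₁ l₂) (l₁.length + 1) (fun r => r = l₁.zip l₂) := ⟨le_rfl, rfl⟩
theorem Spec.shiftR (l : List α) :
    Spec (shiftR l) (l.length + 1) (fun r => r = l.rotate 1) := ⟨le_rfl, rfl⟩
theorem Spec.numberR (l : List α) :
    Spec (numberR l) (l.length + 1) (fun r => r = l.zipIdx) := ⟨le_rfl, rfl⟩

/-! ### Folds and loops: invariants and potentials. -/

theorem foldR_val (f : β → α → Run β) (b : β) (l : List α) :
    (foldR f b l).val = l.foldl (fun b a => (f b a).val) b := by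
  induction l generalizing b with
  | nil => rfl
  | cons a l ih => simp [foldR, ih]

/-- Amortized cost of a fold: `Φ` is the potential of a state. The invariant may refer to the
elements that are still to be processed. -/
theorem foldR_amortized {f : β → α → Run β} (I : List α → β → Prop) (Φ : β → ℕ) (c : α → ℕ)
    (h : ∀ a l b, I (a :: l) b →
      I l (f b a).val ∧ (f b a).cost + Φ (f b a).val ≤ Φ b + c a)
    (l : List α) (b : β) (hb : I l b) :
    I [] (foldR f b l).val ∧
      (foldR f b l).cost + Φ (foldR f b l).val ≤ Φ b + (l.map c).sum + l.length + 1 := by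
  induction l generalizing b with
  | nil => simp [foldR, hb]; omega
  | cons a l ih =>
    obtain ⟨h1, h2⟩ := h a l b hb
    obtain ⟨h3, h4⟩ := ih _ h1
    refine ⟨by simpa [foldR] using h3, ?_⟩
    simp only [foldR, bind_cost, bind_val, charge_cost, List.map_cons, List.sum_cons,
      List.length_cons]
    omega

/-- Each element brings an allowance of `K`, plus one step of control. The bound on the final
potential is kept as well, because later operations on the state are charged against it. -/
theorem Spec.foldR_amortized {f : β → α → Run β} {l : List α} {b : β} (I : β → Prop) (Φ : β → ℕ)
    (K : ℕ) (hb : I b)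
    (h : ∀ a ∈ l, ∀ b, I b → I (f b a).val ∧ (f b a).cost + Φ (f b a).val ≤ Φ b + K) :
    Spec (foldR f b l) (Φ b + (K + 1) * l.length + 1)
      (fun b' => I b' ∧ Φ b' ≤ Φ b + (K + 1) * l.length + 1) := by
  have := SmartRepair.foldR_amortized (f := f) (fun l' b => I b ∧ ∀ a ∈ l', a ∈ l) Φ (fun _ => K)
    (fun a l' b hb => ⟨⟨(h a (hb.2 a (by simp)) b hb.1).1, fun x hx => hb.2 x (by simp [hx])⟩,
      (h a (hb.2 a (by simp)) b hb.1).2⟩) l b ⟨hb, fun _ h => h⟩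
  have e := this.2
  simp only [List.map_const', List.sum_replicate, smul_eq_mul] at e
  exact ⟨by linarith, this.1.1, by linarith⟩

/-- Since the invariant sees the unprocessed elements, it can state a conservation law: the size of
the accumulator plus that of the rest does not grow. -/
theorem Spec.foldR_rest {f : β → α → Run β} {l : List α} {b : β} (I : List α → β → Prop)
    (c : α → ℕ) (hb : I l b) (h : ∀ a l b, I (a :: l) b → Spec (f b a) (c a) (I l)) :
    Spec (foldR f b l) ((l.map c).sum + l.length + 1) (I []) := by
  have := SmartRepair.foldR_amortized (f := f) I (fun _ => 0) c
    (fun a l' b hb => ⟨(h a l' b hb).2, by have := (h a l' b hb).1; omega⟩) l b hb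
  exact ⟨by omega, this.1⟩

theorem Spec.foldR {f : β → α → Run β} {l : List α} {b : β} (I : β → Prop) (c : α → ℕ)
    (hb : I b) (h : ∀ a ∈ l, ∀ b, I b → Spec (f b a) (c a) I) :
    Spec (foldR f b l) ((l.map c).sum + l.length + 1) I := by
  have := SmartRepair.foldR_amortized (f := f) (fun l' b => I b ∧ ∀ a ∈ l', a ∈ l) (fun _ => 0) c
    (fun a l' b hb => ⟨⟨(h a (hb.2 a (by simp)) b hb.1).2, fun x hx => hb.2 x (by simp [hx])⟩,
      by have := (h a (hb.2 a (by simp)) b hb.1).1; omega⟩) l b ⟨hb, fun _ h => h⟩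
  exact ⟨by omega, this.1.1⟩

theorem Spec.foldR_const {f : β → α → Run β} {l : List α} {b : β} (I : β → Prop) (K : ℕ)
    (hb : I b) (h : ∀ a ∈ l, ∀ b, I b → Spec (f b a) K I) :
    Spec (SmartRepair.foldR f b l) ((K + 1) * l.length + 1) I := by
  refine (Spec.foldR I (fun _ => K) hb h).le ?_
  simp only [List.map_const', List.sum_replicate, smul_eq_mul]
  linarith

theorem foldR_cost_le {f : β → α → Run β} {l : List α} {b : β} {c : α → ℕ}
    (h : ∀ b, ∀ a ∈ l, (f b a).cost ≤ c a) : (foldR f b l).cost ≤ (l.map c).sum + l.length + 1 :=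
  (Spec.foldR (fun _ => True) c trivial fun a ha b _ => ⟨h b a ha, trivial⟩).1

theorem foldR_cost_le_const {f : β → α → Run β} {l : List α} {b : β} {K : ℕ}
    (h : ∀ b, ∀ a ∈ l, (f b a).cost ≤ K) : (foldR f b l).cost ≤ (K + 1) * l.length + 1 :=
  (Spec.foldR_const (fun _ => True) K trivial fun a ha b _ => ⟨h b a ha, trivial⟩).1

/-- Amortized cost of a loop. The invariant may refer to the number of remaining passes. -/
theorem whileR_amortized {body : σ → Run (σ × Bool)} (I : ℕ → σ → Prop) (Φ : σ → ℕ) (K : ℕ)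
    (h : ∀ n s, I (n + 1) s →
      I n (body s).val.1 ∧ (body s).cost + Φ (body s).val.1 ≤ Φ s + K)
    (n : ℕ) (s : σ) (hs : I n s) :
    (∃ m, I m (whileR body n s).val) ∧
      (whileR body n s).cost + Φ (whileR body n s).val ≤ Φ s + (K + 1) * n + 1 := by
  induction n generalizing s with
  | zero => exact ⟨⟨0, hs⟩, by simp [whileR]; omega⟩
  | succ n ih =>
    obtain ⟨h1, h2⟩ := h n s hs
    obtain ⟨h3, h4⟩ := ih _ h1
    have e : (K + 1) * (n + 1) = (K + 1) * n + K + 1 := by ring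
    by_cases hc : (body s).val.2
    · simp only [whileR, bind_val, bind_cost, hc, if_true, charge_cost]
      exact ⟨h3, by omega⟩
    · simp only [whileR, bind_val, bind_cost, hc, charge_cost]
      exact ⟨⟨n, h1⟩, by simp; nlinarith [Nat.zero_le ((K + 1) * n)]⟩

theorem Spec.whileR_amortized {body : σ → Run (σ × Bool)} {n : ℕ} {s : σ} (I : ℕ → σ → Prop)
    (Φ : σ → ℕ) (K : ℕ) (hs : I n s) (h : ∀ n s, I (n + 1) s →
      I n (body s).val.1 ∧ (body s).cost + Φ (body s).val.1 ≤ Φ s + K) :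
    Spec (whileR body n s) (Φ s + (K + 1) * n + 1) (fun s => ∃ m, I m s) := by
  obtain ⟨h1, h2⟩ := SmartRepair.whileR_amortized I Φ K h n s hs
  exact ⟨by omega, h1⟩

theorem Spec.whileR {body : σ → Run (σ × Bool)} {n : ℕ} {s : σ} (I : σ → Prop) (K : ℕ)
    (hs : I s) (h : ∀ s, I s → Spec (body s) K (fun r => I r.1)) :
    Spec (whileR body n s) ((K + 1) * n + 1) I := by
  obtain ⟨⟨_, h1⟩, h2⟩ := SmartRepair.whileR_amortized (fun _ => I) (fun _ => 0) K
    (fun _ s hs => ⟨(h s hs).2, by have := (h s hs).1; omega⟩) n s hs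
  exact ⟨by omega, h1⟩

/-- Cost of a loop in which every pass but the last is paid for by a decrease of the potential. -/
theorem whileR_decreasing {body : σ → Run (σ × Bool)} (I : σ → Prop) (Φ : σ → ℕ) (K : ℕ)
    (h : ∀ s, I s → I (body s).val.1 ∧
      ((body s).val.2 = true → (body s).cost + 1 + Φ (body s).val.1 ≤ Φ s) ∧
      ((body s).val.2 = false → (body s).cost + Φ (body s).val.1 ≤ Φ s + K))
    (n : ℕ) (s : σ) (hs : I s) :
    I (whileR body n s).val ∧
      (whileR body n s).cost + Φ (whileR body n s).val ≤ Φ s + K + 1 := by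
  induction n generalizing s with
  | zero => exact ⟨hs, by simp [whileR]; omega⟩
  | succ n ih =>
    obtain ⟨h1, h2, h3⟩ := h s hs
    obtain ⟨h4, h5⟩ := ih _ h1
    by_cases hc : (body s).val.2
    · simp only [whileR, bind_val, bind_cost, hc, if_true, charge_cost]
      have := h2 hc
      exact ⟨h4, by omega⟩
    · simp only [whileR, bind_val, bind_cost, hc, charge_cost]
      have := h3 (by simpa using hc)
      exact ⟨h1, by simp; omega⟩

theorem argmaxR_cost_le {f : α → Run ℝ} {l : List α} {c : α → ℕ} (h : ∀ a ∈ l, (f a).cost ≤ c a) :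
    (argmaxR f l).cost ≤ (l.map c).sum + 3 * l.length + 1 := by
  refine (foldR_cost_le (c := fun a => c a + 2) fun b a ha => by simpa using h a ha).trans ?_
  rw [sum_map_add_const]
  omega

theorem argminR_cost_le {f : α → Run ℝ} {l : List α} {c : α → ℕ} (h : ∀ a ∈ l, (f a).cost ≤ c a) :
    (argminR f l).cost ≤ (l.map c).sum + 3 * l.length + 1 := by
  refine (foldR_cost_le (c := fun a => c a + 2) fun b a ha => by simpa using h a ha).trans ?_
  rw [sum_map_add_const]
  omega

/-- Of the minimum only the membership matters: it shows that the closest pair found is the head of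
an actual row. -/
theorem argminR_mem {f : α → Run ℝ} {l : List α} : ∀ b ∈ (argminR f l).val, b.1 ∈ l := by
  unfold argminR
  rw [foldR_val]
  suffices H : ∀ (l' : List α) (o : Option (α × ℝ)), (∀ b ∈ o, b.1 ∈ l) → (∀ a ∈ l', a ∈ l) →
      ∀ b ∈ l'.foldl (fun best a => ((do
        let v ← f a
        charge 2 (match best with
          | none => some (a, v)
          | some b => if v < b.2 then some (a, v) else some b)) : Run (Option (α × ℝ))).val) o,
        b.1 ∈ l from H l none (by simp) (fun _ h => h)
  intro l'
  induction l' with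
  | nil => intro o ho _; simpa using ho
  | cons a l' ih =>
    intro o ho hl
    refine ih _ ?_ fun x hx => hl x (by simp [hx])
    have ha := hl a (by simp)
    intro b hb
    cases o with
    | none => simp at hb; subst hb; exact ha
    | some c =>
      simp only [bind_val, charge_val] at hb
      split_ifs at hb
      · simp at hb; subst hb; exact ha
      · simp at hb; subst hb; exact ho _ (by simp)

/-! ### Sorting and connected components. -/

theorem insertR_spec (key : α → ℝ) (a : α) (l : List α) :
    Spec (insertR key a l) (2 * l.length + 2) (fun r => r.Perm (a :: l)) := by
  induction l with
  | nil => exact ⟨by simp [insertR], by simp [insertR]⟩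
  | cons b l ih =>
    simp only [insertR]
    split_ifs
    · exact ⟨by simp, by simp⟩
    · refine (ih.bind (k₂ := 2) fun r hr => Spec.charge ?_).le (by simp; omega)
      exact (hr.cons b).trans (List.Perm.swap a b l)

theorem sortR_spec (key : α → ℝ) (l : List α) :
    Spec (sortR key l) ((2 * l.length + 3) * l.length + 1) (fun r => r.Perm l) := by
  have := foldR_amortized (f := fun acc a => insertR key a acc)
    (fun l' acc => (acc ++ l').Perm l) (fun _ => 0) (fun _ => 2 * l.length + 2)
    (fun a l' acc h => by
      obtain ⟨h1, h2⟩ := insertR_spec key a acc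
      refine ⟨((h2.append_right l').trans ?_).trans h, ?_⟩
      · exact (List.perm_middle (l₁ := acc)).symm
      · have := h.length_eq
        simp at this
        omega) l [] (by simp)
  refine ⟨?_, by have := this.1; rwa [List.append_nil] at this⟩
  have h2 := this.2
  simp only [List.map_const', List.sum_replicate, smul_eq_mul] at h2
  unfold sortR
  nlinarith

/-- A new element is compared with each earlier one at most once, since the components found so far
are a permutation of the processed elements. If a comparison costs at most a product of weights, the
total is at most the square of the total weight. -/
theorem componentsR_spec {rel : α → α → Run Bool} {l : List α} (w : α → ℕ) (K : ℕ)
    (hw : ∀ a, 1 ≤ w a) (h : ∀ a b, (rel a b).cost ≤ K * (w a * w b)) :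
    Spec (componentsR rel l) ((K + 20) * ((l.map w).sum + 1) ^ 2)
      (fun cs => cs.flatten.Perm l ∧ ∀ c ∈ cs, c ≠ []) := by
  set W := (l.map w).sum with hW
  have key := foldR_amortized (f := fun (comps : List (List α)) a => do
      let r ← partitionR (fun c => anyR (rel a) c) comps
      let c ← concatR r.1
      charge 2 ((a :: c) :: r.2))
    (fun l' cs => (cs.flatten ++ l').Perm l ∧ ∀ c ∈ cs, c ≠ []) (fun _ => 0)
    (fun a => K * (w a * W) + 10 * W + 10)
    (fun a l' cs hcs => by
      obtain ⟨hp, hn⟩ := hcs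
      have hlen := length_flatten_le hn
      have hflat : (cs.flatten.map w).sum ≤ W := by
        have := (hp.map w).sum_eq
        simp at this ⊢
        omega
      have hflen : cs.flatten.length ≤ W :=
        (length_le_sum_map fun a _ => hw a).trans hflat
      refine ⟨⟨?_, ?_⟩, ?_⟩
      · refine List.Perm.trans ?_ hp
        simp only [bind_val, charge_val, partitionR_val, concatR_val, List.flatten_cons,
          List.cons_append]
        refine List.Perm.trans (List.Perm.cons a (List.Perm.append_right l' ?_))
          (List.perm_middle (l₁ := cs.flatten)).symm
        rw [← List.flatten_append]
        exact (List.filter_append_perm _ cs).flatten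
      · simp only [bind_val, charge_val, partitionR_val, concatR_val, List.mem_cons]
        rintro c (rfl | hc)
        · simp
        · exact hn c (List.mem_of_mem_filter hc)
      · simp only [bind_cost, charge_cost, partitionR_val,
          partitionR_cost, concatR_cost]
        -- One scan of all components meets every earlier element at most once, so the weights add
        -- up to at most `W`; the `3 * W` is loop control.
        have e1 : (cs.map fun c => (anyR (rel a) c).cost).sum ≤ K * (w a * W) + 3 * W := by
          calc _ ≤ (cs.map fun c => K * w a * (c.map w).sum + c.length + 2).sum := by
                refine sum_map_le_sum fun c _ => ?_
                have := anyR_cost_le_sum (p := rel a) (l := c) (c := fun b => K * w a * w b)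
                  (fun b _ => (h a b).trans (by rw [mul_assoc]))
                rwa [sum_map_mul_const] at this
            _ = K * w a * (cs.flatten.map w).sum + cs.flatten.length + 2 * cs.length := by
                rw [sum_map_add_const, sum_map_add, sum_map_mul_const, sum_map_flatten,
                  List.length_flatten]
            _ ≤ _ := by
                have := Nat.mul_le_mul_left (K * w a) hflat
                nlinarith
        have e2 : (cs.filter fun c => (anyR (rel a) c).val).flatten.length ≤ cs.flatten.length := by
          simp only [List.length_flatten]
          exact sum_map_filter_le _ _ _
        have e3 : (cs.filter fun c => (anyR (rel a) c).val).length ≤ cs.length :=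
          List.length_filter_le _ _
        omega) l [] (by simp)
  obtain ⟨⟨h1, h2⟩, h3⟩ := key
  rw [List.append_nil] at h1
  refine ⟨?_, h1, h2⟩
  have hl : l.length ≤ W := length_le_sum_map fun a _ => hw a
  have e : (l.map fun a => K * (w a * W) + 10 * W + 10).sum = K * W * W + (10 * W + 10) * l.length := by
    have : ∀ a, K * (w a * W) + 10 * W + 10 = K * W * w a + (10 * W + 10) := fun a => by ring
    simp only [this]
    rw [sum_map_add_const, sum_map_mul_const]
  rw [e] at h3
  have := Nat.mul_le_mul_left (10 * W + 10) hl
  unfold componentsR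
  nlinarith

end Basic

/-! ### Triangulations and shortest paths -/

/-- Number of triangles. -/
def Tree.size : Tree → ℕ
  | .leaf => 0
  | .node _ l r => l.size + r.size + 1

theorem descend_spec (n v : ℕ) (t : Tree) (x y : ℕ) :
    Spec (descend n v t x y) (20 * t.size + 10) (fun r => r.length ≤ t.size) := by
  induction t generalizing x y with
  | leaf => exact ⟨by simp [descend], by simp [descend]⟩
  | node z l r ihl ihr =>
    simp only [descend, Tree.size]
    split_ifs with h₁ h₂
    · exact ⟨by simp, by simp⟩
    · exact ((ihl x z).bind fun a ha => Spec.charge (by simp; omega)).le (by omega)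
    · exact ((ihr z y).bind fun a ha => Spec.charge (by simp; omega)).le (by omega)

theorem ite_descend_spec (c : Bool) (n v : ℕ) (l r : Tree) (x y z w : ℕ) :
    Spec (if c then descend n v l x y else descend n v r z w) (20 * (l.size + r.size) + 10)
      (fun p => p.length ≤ l.size + r.size) := by
  split_ifs
  · exact ((descend_spec n v l x y).le (by omega)).imp fun a ha => by omega
  · exact ((descend_spec n v r z w).le (by omega)).imp fun a ha => by omega

/-- The search follows a single branch until the two vertices separate; from there one descent is
made for each of them. Hence the linear cost, and the factor two in the length. -/
theorem sleeveIn_spec (n i j : ℕ) (t : Tree) (x y : ℕ) :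
    Spec (sleeveIn n i j t x y) (60 * t.size + 60) (fun r => r.length ≤ 2 * t.size) := by
  induction t generalizing x y with
  | leaf => exact ⟨by simp [sleeveIn], by simp [sleeveIn]⟩
  | node z l r ihl ihr =>
    simp only [sleeveIn, Tree.size]
    refine Within.spec (Within.ite (fun _ => ?_) fun _ => Within.ite (fun _ => ?_) fun _ => ?_)
    · exact Within.tick (Within.last (ihl x z) (by omega) fun a ha => by omega)
    · exact Within.tick (Within.last (ihr z y) (by omega) fun a ha => by omega)
    · refine Within.ite_bind (ite_descend_spec _ n i l r x z z y) fun ui hui => ?_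
      refine Within.ite_bind (ite_descend_spec _ n j l r x z z y) fun uj huj => ?_
      refine Within.bind (Spec.reverseR ui) fun ri hri => Within.tick ?_
      subst hri
      refine Within.last (Spec.appendR _ uj) ?_ fun p hp => ?_
      · simp; omega
      · simp [hp]; omega

theorem sleeve_spec (t : Triang) (i j : ℕ) :
    Spec (sleeve t i j) (60 * (t.t₁.size + t.t₂.size) + 100)
      (fun r => r.length ≤ 2 * (t.t₁.size + t.t₂.size)) := by
  unfold sleeve
  refine Within.spec (Within.ite (fun _ => ?_) fun _ => Within.ite (fun _ => ?_) fun _ => ?_)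
  · exact Within.last (sleeveIn_spec _ _ _ _ _ _) (by omega) fun a ha => by omega
  · exact Within.last (sleeveIn_spec _ _ _ _ _ _) (by omega) fun a ha => by omega
  · refine Within.ite_bind (ite_descend_spec _ _ i t.t₁ t.t₂ _ _ _ _) fun ui hui => ?_
    refine Within.ite_bind (ite_descend_spec _ _ j t.t₂ t.t₁ _ _ _ _) fun uj huj => ?_
    refine Within.bind (Spec.reverseR ui) fun ri hri => Within.tick ?_
    subst hri
    refine Within.last (Spec.appendR _ uj.tail) ?_ fun p hp => ?_
    · simp; omega
    · simp [hp]; omega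

/-- The cells in use lie in order. -/
def Funnel.Ordered (f : Funnel) : Prop := f.lo ≤ f.apex ∧ f.apex ≤ f.hi

/-- The potential `26 * (hi - lo)` pays for removals from the deque: a removed vertex releases 25
steps for the pass and one for control. Only the order of `lo`, `apex`, `hi` is used, not the shape
of the funnel. -/
theorem addRight_spec (t : Triang) (w : ℕ) (f : Funnel) (hf : f.Ordered) :
    (addRight t w f).val.Ordered ∧
      (addRight t w f).cost + 26 * ((addRight t w f).val.hi - (addRight t w f).val.lo) ≤
        26 * (f.hi - f.lo) + 70 := by
  obtain ⟨h1, h2⟩ := hf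
  have key := whileR_decreasing (body := fun k => charge 25 (
    if f.apex < k then
      if 0 < orient (t.pts.getD (f.cells.getD (k - 1) 0) default)
        (t.pts.getD (f.cells.getD k 0) default) (t.pts.getD w default) then (k - 1, true)
      else (k, false)
    else if f.lo < k then
      if 0 ≤ orient (t.pts.getD (f.cells.getD k 0) default)
        (t.pts.getD (f.cells.getD (k - 1) 0) default) (t.pts.getD w default) then (k - 1, true)
      else (k, false)
    else (k, false))) (fun k => f.lo ≤ k ∧ k ≤ f.hi) (fun k => 26 * (k - f.lo)) 25
    (fun k hk => by
      simp only [charge_val, charge_cost]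
      split_ifs <;> simp <;> omega) (f.hi - f.lo + 1) f.hi (by simp; omega)
  simp only [addRight, bind_val, bind_cost, charge_val, charge_cost, Funnel.Ordered]
  generalize whileR _ _ _ = r at key ⊢
  omega

theorem addLeft_spec (t : Triang) (w : ℕ) (f : Funnel) (hf : f.Ordered) :
    (addLeft t w f).val.Ordered ∧
      (addLeft t w f).cost + 26 * ((addLeft t w f).val.hi - (addLeft t w f).val.lo) ≤
        26 * (f.hi - f.lo) + 70 := by
  obtain ⟨h1, h2⟩ := hf
  have key := whileR_decreasing (body := fun k => charge 25 (
    if k < f.apex then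
      if orient (t.pts.getD (f.cells.getD (k + 1) 0) default)
        (t.pts.getD (f.cells.getD k 0) default) (t.pts.getD w default) < 0 then (k + 1, true)
      else (k, false)
    else if k < f.hi then
      if orient (t.pts.getD (f.cells.getD k 0) default)
        (t.pts.getD (f.cells.getD (k + 1) 0) default) (t.pts.getD w default) ≤ 0 then
        (k + 1, true)
      else (k, false)
    else (k, false))) (fun k => f.lo ≤ k ∧ k ≤ f.hi) (fun k => 26 * (f.hi - k)) 25
    (fun k hk => by
      simp only [charge_val, charge_cost]
      split_ifs <;> simp <;> omega) (f.hi - f.lo + 1) f.lo (by simp; omega)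
  simp only [addLeft, bind_val, bind_cost, charge_val, charge_cost, Funnel.Ordered]
  generalize whileR _ _ _ = r at key ⊢
  omega

/-- The number of gates is linear in the number of triangles. Each gate adds at most two vertices to
the funnel, and all removals are paid for by earlier additions. -/
theorem geodesic_spec (t : Triang) (i j : ℕ) :
    Spec (geodesic t i j) (1000 * (t.n + t.t₁.size + t.t₂.size + 1))
      (fun p => p.length ≤ t.n + 1) := by
  unfold geodesic
  refine Within.spec (Within.bind (sleeve_spec t i j) fun gates hg => ?_)
  refine Within.bind (Spec.allocR _ _) fun cells _ => ?_
  refine Within.bind (Spec.allocR _ _) fun parent _ => ?_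
  -- A gate costs at most one insertion on each side, 70 steps each including the rise of the
  -- potential; the remaining 30 cover the tests.
  refine Within.bind (Spec.foldR_amortized Funnel.Ordered (fun f => 26 * (f.hi - f.lo)) 170
      (by simp [Funnel.Ordered]) fun g _ f hf => ?_) fun f hf => ?_
  · simp only [charge_bind]
    generalize (if inOpenArc t.n i j g.1 = true then g.1 else g.2) = r
    generalize (if inOpenArc t.n i j g.1 = true then g.2 else g.1) = l
    have hr := addRight_spec t r f hf
    have hl := addLeft_spec t l f hf
    have hrl := addLeft_spec t l (addRight t r f).val hr.1
    split_ifs <;> simp only [bind_val, bind_cost] <;>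
      (try split_ifs) <;> (try simp only [charge_val, charge_cost]) <;>
      first | exact ⟨hf, by omega⟩ | exact ⟨hl.1, by omega⟩ | exact ⟨hr.1, by omega⟩ |
        exact ⟨hrl.1, by omega⟩
  · have hj := addRight_spec t j f hf.1
    refine Within.bind (Spec.cost_le (k := 26 * (f.hi - f.lo) + 70) (by omega)) fun f' _ => ?_
    -- Each pass adds one vertex and uses up one unit of fuel. This bounds the length of the path
    -- without knowing that the parent pointers are acyclic.
    refine Within.bind (Spec.whileR_amortized (fun m s => s.1.length + m ≤ t.n + 1) (fun _ => 0) 4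
      (by simp) fun m s hs => ?_) fun r hr => Within.pure ?_ ?_
    · simp only [charge_val, charge_cost]
      split_ifs <;> simp <;> omega
    · simp only [Nat.sub_self, mul_zero, zero_add] at hf ⊢
      omega
    · obtain ⟨m, hm⟩ := hr
      omega

theorem geodesicPts_spec (t : Triang) (i j : ℕ) :
    Spec (geodesicPts t i j) (1100 * (t.n + t.t₁.size + t.t₂.size + 1))
      (fun p => p.length ≤ t.n + 1) := by
  unfold geodesicPts
  refine Within.spec (Within.bind (geodesic_spec t i j) fun p hp => ?_)
  refine Within.last (Spec.mapR_const (K := 1) (by simp)) (by omega) fun q hq => ?_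
  simpa [hq] using hp

/-- The size of the parts of a triangulation during ear clipping: remaining vertices and triangles
that have been cut off. -/
def clipSize (l : List ClipVertex) : ℕ := (l.map fun v => v.tree.size + 1).sum

theorem length_le_clipSize (l : List ClipVertex) : l.length ≤ clipSize l :=
  length_le_sum_map fun _ _ => by omega

theorem earR_cost_le (a b c : ClipVertex) (l : List ClipVertex) :
    (earR a b c l).cost ≤ 41 * l.length + 12 := by
  have := anyR_cost_le_const (l := l) (K := 40) (p := fun (v : ClipVertex) => charge 40 (
    v.idx != a.idx && v.idx != b.idx && v.idx != c.idx &&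
    decide (0 ≤ orient a.pt b.pt v.pt) && decide (0 ≤ orient b.pt c.pt v.pt) &&
    decide (0 ≤ orient c.pt a.pt v.pt))) (by simp)
  simp only [earR, bind_cost, charge_cost]
  omega

theorem refreshHead_spec (l : List ClipVertex) :
    Spec (refreshHead l) (42 * l.length + 20)
      (fun l' => clipSize l' = clipSize l ∧ l'.length = l.length) := by
  unfold refreshHead
  refine Within.spec (Within.bind (Spec.lastR l) fun z hz => ?_)
  split
  · rename_i b c r a
    refine Within.bind (Spec.cost_le (earR_cost_le a b c _)) fun e _ => ?_
    exact Within.charge (by simp only [List.length_cons]; omega) (by simp [clipSize])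
  · exact Within.pure (by omega) ⟨rfl, rfl⟩

theorem clipSize_rotate (l : List ClipVertex) : clipSize (l.rotate 1) = clipSize l :=
  ((List.rotate_perm l 1).map _).sum_eq

theorem toEar_spec (acc l : List ClipVertex) :
    Spec (toEar acc l) (acc.length + 4 * l.length + 5)
      (fun o => ∀ p ∈ o, (p.1 :: p.2).Perm (acc ++ l)) := by
  induction l generalizing acc with
  | nil => exact ⟨by simp [toEar], by simp [toEar]⟩
  | cons v l ih =>
    simp only [toEar]
    refine Within.spec (Within.ite (fun _ => ?_) fun _ => ?_)
    · refine Within.bind (Spec.reverseR acc) fun a ha => ?_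
      refine Within.bind (Spec.appendR l a) fun r hr => ?_
      subst ha hr
      refine Within.charge (by simp; omega) ?_
      simp only [Option.mem_def, Option.some.injEq]
      rintro _ rfl
      refine List.Perm.trans (List.Perm.cons v ?_) (List.perm_middle (l₁ := acc)).symm
      exact List.perm_append_comm.trans (List.Perm.append_right l (List.reverse_perm acc))
    · refine Within.tick (Within.last (ih (v :: acc)) (by simp; omega) fun o ho p hp => ?_)
      exact (ho p hp).trans (List.perm_middle (l₁ := acc)).symm

/-- Clipping is linear because the ear test is repeated only for the two neighbours of the vertex
that has been cut off. -/
theorem clipEar_spec (l : List ClipVertex) :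
    Spec (clipEar l) (100 * l.length + 100) (fun r => clipSize r.1 ≤ clipSize l) := by
  unfold clipEar
  refine Within.spec (Within.bind (Spec.lengthR l) fun n hn => ?_)
  refine Within.ite (fun _ => Within.pure (by omega) le_rfl) fun _ => ?_
  refine Within.bind (toEar_spec [] l) fun o ho => ?_
  split
  · exact Within.pure (by simp; omega) le_rfl
  · rename_i v r
    have hp := ho _ rfl
    have hs := (hp.map fun v : ClipVertex => v.tree.size + 1).sum_eq
    have hl := hp.length_eq
    refine Within.bind (Spec.reverseR r) fun rev hrev => ?_
    split
    · exact Within.pure (by simp at hl ⊢; omega) le_rfl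
    · rename_i a rev'
      have hr : r = rev'.reverse ++ [a] := by
        have := congrArg List.reverse hrev
        simpa using this.symm
      subst hr
      refine Within.bind (Spec.reverseR rev') fun r' hr' => ?_
      subst hr'
      refine Within.bind (refreshHead_spec _) fun l₁ hl₁ => ?_
      refine Within.bind (Spec.shiftR l₁) fun l₂ hl₂ => ?_
      subst hl₂
      refine Within.bind (refreshHead_spec _) fun l₃ hl₃ => Within.pure ?_ ?_
      · simp [hl₁.2] at hl ⊢
        omega
      -- The new node at `a` joins the trees of `a` and `v` and adds one triangle, in exchange for
      -- the lost vertex `v`: the total size is unchanged.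
      · rw [clipSize_rotate, hl₁.1] at hl₃
        rw [hl₃.1]
        simp [clipSize, Tree.size] at hs ⊢
        omega

/-- The triangulation has the size of that of a polygon with at most `n` vertices. -/
def Triang.Sized (t : Triang) (n : ℕ) : Prop := t.n ≤ n ∧ t.t₁.size + t.t₂.size ≤ n + 1

theorem Triang.Sized.mono {t : Triang} {m n : ℕ} (h : t.Sized m) (hmn : m ≤ n) : t.Sized n :=
  ⟨h.1.trans hmn, h.2.trans (by omega)⟩

/-- A linear number of ear tests and of clippings, each of linear cost. As `clipSize` starts at the
number of vertices and never grows, it bounds the number of triangles. -/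
theorem triangulate_spec (p : Poly) :
    Spec (triangulate p) (300 * (p.length + 1) ^ 2) (fun t => t.Sized p.length) := by
  unfold triangulate
  refine Within.spec (Within.bind (Spec.lengthR p) fun n hn => ?_)
  refine Within.bind (Spec.arrayR p) fun pts _ => ?_
  refine Within.bind (Spec.numberR p) fun pn hpn => ?_
  refine Within.bind (Spec.mapR_const (K := 4) (by simp)) fun l hl => ?_
  have hpl : pn.length = p.length := by simp [hpn]
  have h0 : clipSize l = p.length := by
    simp [hl, clipSize, Function.comp_def, Tree.size, hpl]
  refine Within.bind (Spec.foldR_const (fun l' => clipSize l' ≤ p.length) (43 * p.length + 21)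
    h0.le fun a _ l' hl' => ?_) fun l' hl' => ?_
  · have := length_le_clipSize l'
    refine Within.spec (Within.bind (refreshHead_spec l') fun l₁ h₁ => ?_)
    refine Within.last (Spec.shiftR l₁) (by omega) fun l₂ h₂ => ?_
    rw [h₂, clipSize_rotate]
    omega
  refine Within.bind (Spec.whileR (fun l' => clipSize l' ≤ p.length) (100 * p.length + 100)
    hl' fun l₁ h₁ => ?_) fun l'' hl'' => ?_
  · have := length_le_clipSize l₁
    exact ((clipEar_spec l₁).le (by omega)).imp fun r hr => hr.trans h₁
  · subst hn
    rw [hpl]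
    refine Within.charge (by nlinarith) ?_
    split
    · rename_i a b c _
      simp [clipSize] at hl''
      exact ⟨le_rfl, by simp [Tree.size]; omega⟩
    · exact ⟨le_rfl, by simp [Tree.size]⟩

theorem Triang.Sized.geodesic {t : Triang} {n : ℕ} (h : t.Sized n) (i j : ℕ) :
    Spec (geodesic t i j) (2000 * (n + 1)) (fun p => p.length ≤ n + 1) := by
  obtain ⟨h1, h2⟩ := h
  exact ((geodesic_spec t i j).le (by omega)).imp fun p hp => by omega

theorem Triang.Sized.geodesicPts {t : Triang} {n : ℕ} (h : t.Sized n) (i j : ℕ) :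
    Spec (geodesicPts t i j) (2200 * (n + 1)) (fun p => p.length ≤ n + 1) := by
  obtain ⟨h1, h2⟩ := h
  exact ((geodesicPts_spec t i j).le (by omega)).imp fun p hp => by omega

/-! ### Subdivisions of a gap -/

theorem same_iff {a b : Pt} : same a b = true ↔ a = b := by
  cases a; cases b; simp [same]

/-- A closed polygon with at least three vertices, without repeated vertices, whose edges carry
sub-boundary numbers below `B`. -/
structure GoodLoop (B : ℕ) (l : Loop) : Prop where
  three_le : 3 ≤ l.length
  nodup : (l.map GapEdge.a).Nodup
  chain : l.map GapEdge.b = (l.map GapEdge.a).rotate 1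
  sub_lt : ∀ e ∈ l, e.sub < B

theorem GoodLoop.rotate {B : ℕ} {l : Loop} (h : GoodLoop B l) (k : ℕ) : GoodLoop B (l.rotate k) where
  three_le := by simpa using h.three_le
  nodup := by rw [List.map_rotate]; exact List.nodup_rotate.2 h.nodup
  chain := by rw [List.map_rotate, List.map_rotate, h.chain, List.rotate_rotate,
    List.rotate_rotate, add_comm]
  sub_lt e he := h.sub_lt e (List.mem_rotate.1 he)

/-- A loop is a cyclic object, so it may be cut open at any edge; the two ends of a chord are
brought to the front in this way. -/
theorem GoodLoop.swap {B : ℕ} {p q : Loop} (h : GoodLoop B (p ++ q)) : GoodLoop B (q ++ p) := by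
  have := h.rotate p.length
  rwa [List.rotate_append_length_eq] at this

theorem GoodLoop.chain_cons {B : ℕ} {e : GapEdge} {l : Loop} (h : GoodLoop B (e :: l)) :
    e.b :: l.map GapEdge.b = l.map GapEdge.a ++ [e.a] := by
  simpa using h.chain

/-- A chord between two vertices that are not adjacent cuts off a polygon. -/
theorem GoodLoop.chord {B : ℕ} {e f : GapEdge} {p q : Loop}
    (h : GoodLoop B (e :: p ++ f :: q)) (hef : ∀ g ∈ e :: p ++ f :: q, ¬(g.a = e.a ∧ g.b = f.a)) :
    GoodLoop B (e :: p ++ [⟨f.a, e.a, 0, none, false⟩]) := by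
  have hc : e.b :: p.map GapEdge.b ++ f.b :: q.map GapEdge.b =
      (p.map GapEdge.a ++ [f.a]) ++ (q.map GapEdge.a ++ [e.a]) := by
    have := h.chain_cons
    simpa using this
  have hp := (List.append_inj hc (by simp)).1
  refine ⟨?_, ?_, ?_, ?_⟩
  -- If nothing lies between, the edge `e` itself runs from `e.a` to `f.a`, which is excluded.
  · cases p with
    | nil =>
      exfalso
      simp only [List.map_nil, List.nil_append, List.cons.injEq] at hp
      exact hef e (by simp) ⟨rfl, hp.1⟩
    | cons _ _ => simp
  · have := h.nodup
    rw [List.map_append, List.map_cons (l := q)] at this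
    rw [List.map_append]
    exact this.sublist (List.Sublist.append (List.Sublist.refl _) (by simp))
  · simp only [List.cons_append, List.map_cons, List.map_append, List.map_nil]
    rw [List.rotate_cons_succ]
    simp only [List.rotate_zero]
    rw [← List.cons_append, hp]
  · intro g hg
    rw [List.mem_append] at hg
    rcases hg with hg | hg
    · exact h.sub_lt g (List.mem_append_left _ hg)
    · have := h.sub_lt e (by simp)
      simp at hg
      subst hg
      simp
      omega

/-- Sum of the excesses of the numbers of edges over two. -/
def excess (ls : List Loop) : ℕ := (ls.map fun l => l.length - 2).sum

@[simp] theorem excess_nil : excess [] = 0 := rfl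
@[simp] theorem excess_cons (l : Loop) (ls : List Loop) :
    excess (l :: ls) = (l.length - 2) + excess ls := by simp [excess]
@[simp] theorem excess_append (ls ls' : List Loop) :
    excess (ls ++ ls') = excess ls + excess ls' := by simp [excess]

/-- A loop with `k ≥ 3` edges has `k ≤ 3 * (k - 2)`, so the conserved excess controls the total
number of edges. -/
theorem sum_length_le_excess {B : ℕ} {ls : List Loop} (h : ∀ l ∈ ls, GoodLoop B l) :
    (ls.map List.length).sum ≤ 3 * excess ls := by
  unfold excess
  rw [← sum_map_mul_const]
  exact sum_map_le_sum fun l hl => by have := (h l hl).three_le; omega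

theorem length_le_excess {B : ℕ} {ls : List Loop} (h : ∀ l ∈ ls, GoodLoop B l) :
    ls.length ≤ excess ls :=
  length_le_sum_map fun l hl => by have := (h l hl).three_le; omega

theorem splitAt_spec (x : Pt) (acc l : List GapEdge) :
    Spec (splitAt x acc l) (acc.length + 6 * l.length + 6)
      (fun o => ∀ p ∈ o, p.1 ++ p.2 = acc.reverse ++ l ∧ ∃ e q, p.2 = e :: q ∧ e.a = x) := by
  induction l generalizing acc with
  | nil => exact ⟨by simp [splitAt], by simp [splitAt]⟩
  | cons e l ih =>
    simp only [splitAt]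
    refine Within.spec (Within.ite (fun h => ?_) fun _ => ?_)
    · refine Within.bind (Spec.reverseR acc) fun r hr => ?_
      subst hr
      refine Within.charge (by simp) ?_
      simp only [Option.mem_def, Option.some.injEq]
      rintro _ rfl
      exact ⟨rfl, e, l, rfl, same_iff.1 h⟩
    · refine Within.tick (Within.last (ih (e :: acc)) (by simp; omega) fun o ho p hp => ?_)
      simpa using ho p hp

/-- The two parts have two edges more than the whole, one copy of the chord each, so subtracting two
per loop makes the size additive. That the chord is not an edge already keeps both parts at three
edges or more. -/
theorem splitLoop_spec {B : ℕ} {x y : Pt} {l : Loop} (hl : GoodLoop B l) (hxy : x ≠ y)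
    (h₁ : ∀ e ∈ l, ¬(e.a = x ∧ e.b = y)) (h₂ : ∀ e ∈ l, ¬(e.a = y ∧ e.b = x)) :
    Spec (splitLoop x y l) (20 * l.length + 20)
      (fun ls => (∀ l' ∈ ls, GoodLoop B l') ∧ excess ls = l.length - 2 ∧ ls.length ≤ 2) := by
  unfold splitLoop
  refine Within.spec (Within.bind (splitAt_spec x [] l) fun o ho => ?_)
  have triv : (∀ l' ∈ [l], GoodLoop B l') ∧ excess [l] = l.length - 2 ∧ [l].length ≤ 2 := by
    simp [hl]
  split
  · exact Within.pure (by simp; omega) triv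
  · rename_i p q
    obtain ⟨hpq, e, q, rfl, rfl⟩ := ho _ rfl
    simp only [List.reverse_nil, List.nil_append] at hpq
    subst hpq
    refine Within.bind (Spec.appendR _ _) fun l' hl' => ?_
    refine Within.bind (splitAt_spec y [] l') fun o ho => ?_
    have hl'g : GoodLoop B l' := hl' ▸ hl.swap
    have hll : l'.length = (p ++ e :: q).length := by simp [hl']; omega
    have hmem : ∀ g, g ∈ l' → g ∈ p ++ e :: q := fun g hg => by
      rw [hl'] at hg; simp at hg ⊢; tauto
    split
    · exact Within.pure (by simp at hll ⊢; omega) triv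
    · rename_i p' q'
      obtain ⟨hpq, f, q', rfl, rfl⟩ := ho _ rfl
      simp only [List.reverse_nil, List.nil_append] at hpq
      -- The list now starts with the edge from `x`, so an empty first part would mean `x = y`.
      cases p' with
      | nil =>
        simp [hl'] at hpq
        exact absurd (by rw [hpq.1]) hxy
      | cons e' p' =>
        have hee : e' = e := by simp [hl'] at hpq; exact hpq.1
        subst hee
        clear hl'
        subst hpq
        refine Within.bind (Spec.appendR _ _) fun u hu => ?_
        refine Within.bind (Spec.appendR _ _) fun v hv => ?_
        subst hu hv
        refine Within.pure (by simp at hll ⊢; omega) ⟨?_, ?_, by simp⟩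
        · have := hl'g.chord fun g hg => h₁ g (hmem g hg)
          have := hl'g.swap.chord fun g hg => h₂ g (hmem g (by simp at hg ⊢; tauto))
          simp only [List.mem_cons, List.not_mem_nil, or_false]
          rintro _ (rfl | rfl) <;> assumption
        · have := hl'g.three_le
          simp at hll this ⊢
          omega

/-- A subdivision into polygons with total excess at most `n`. -/
structure Subdivision (B n : ℕ) (ls : List Loop) : Prop where
  good : ∀ l ∈ ls, GoodLoop B l
  excess_le : excess ls ≤ n

theorem Subdivision.length_le {B n : ℕ} {ls : List Loop} (h : Subdivision B n ls) :
    ls.length ≤ n := (length_le_excess h.good).trans h.excess_le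

theorem Subdivision.sum_length_le {B n : ℕ} {ls : List Loop} (h : Subdivision B n ls) :
    (ls.map List.length).sum ≤ 3 * n :=
  (sum_length_le_excess h.good).trans (Nat.mul_le_mul_left 3 h.excess_le)

theorem GoodLoop.subdivision {B : ℕ} {l : Loop} (h : GoodLoop B l) :
    Subdivision B (l.length - 2) [l] := ⟨by simp [h], by simp⟩

theorem isEdge_iff {x y : Pt} {e : GapEdge} : isEdge x y e = true ↔ e.a = x ∧ e.b = y := by
  simp [isEdge, same_iff]

/-- The bound on the number of loops holds because the chord is inserted in at most one loop; it
matters afterwards, when a new vertex can lengthen every loop. -/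
theorem addChord_spec {B n : ℕ} {ls : List Loop} (h : Subdivision B n ls) (x y : Pt) :
    Spec (addChord ls x y) (200 * n + 20)
      (fun r => Subdivision B n r ∧ r.length ≤ ls.length + 1) := by
  have hlen := h.length_le
  have hsum := h.sum_length_le
  unfold addChord
  refine Within.spec (Within.bind (Spec.anyR (c := fun l => 11 * l.length + 2) fun l _ =>
      anyR_cost_le_const (by simp)) fun old hold => ?_)
  rw [sum_map_add_const, sum_map_mul_const]
  refine Within.ite (fun _ => Within.pure (by omega) ⟨h, by omega⟩) fun hno => ?_
  have hno' : ∀ l ∈ ls, ∀ e ∈ l, ¬(e.a = x ∧ e.b = y) ∧ ¬(e.a = y ∧ e.b = x) := by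
    intro l hl e he
    rw [hold] at hno
    simp only [List.any_eq_true, not_exists, not_and, anyR_val, charge_val, Bool.or_eq_true,
      not_or, isEdge_iff] at hno
    simpa using hno l hl e he
  -- The flag in the state records whether a loop has been split already; it accounts for the single
  -- additional loop.
  refine Within.bind (Spec.foldR_rest (fun (rest : List Loop) (s : List Loop × Bool) =>
      (∀ l ∈ rest, l ∈ ls) ∧ (∀ l ∈ s.1, GoodLoop B l) ∧ excess s.1 + excess rest ≤ n ∧
      s.1.length + rest.length ≤ ls.length + (if s.2 then 1 else 0))
    (fun l => 30 * l.length + 50)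
    ⟨fun _ h => h, by simp, by simpa using h.excess_le, by simp⟩ ?_) fun r hr => ?_
  · rintro l rest s ⟨h1, h2, h3, h4⟩
    have hl := h1 l (by simp)
    have h1' : ∀ l ∈ rest, l ∈ ls := fun l' h' => h1 l' (by simp [h'])
    simp only [excess_cons, List.length_cons] at h3 h4
    refine Within.spec (Within.bind (Spec.anyR_const (K := 4) (by simp)) fun hx _ => ?_)
    refine Within.bind (Spec.anyR_const (K := 4) (by simp)) fun hy _ => ?_
    refine Within.ite (fun hc => ?_) fun hc => ?_
    · simp only [Bool.and_eq_true, Bool.not_eq_true', ← Bool.not_eq_true, same_iff] at hc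
      refine Within.bind (splitLoop_spec (h.good l hl) hc.2 (fun e he => (hno' l hl e he).1)
        (fun e he => (hno' l hl e he).2)) fun ls' hls' => ?_
      refine Within.bind (Spec.appendR _ _) fun ls'' hls'' => ?_
      subst hls''
      refine Within.charge (by omega) ⟨h1', ?_, ?_, ?_⟩
      · intro l' hl'
        rcases List.mem_append.1 hl' with h' | h'
        exacts [hls'.1 l' h', h2 l' h']
      · simp only [excess_append]
        omega
      · simp only [hc.1.2, Bool.false_eq_true, if_false, if_true, List.length_append] at h4 ⊢
        omega
    · refine Within.charge (by omega) ⟨h1', ?_, ?_, ?_⟩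
      · simp only [List.mem_cons]
        rintro l' (rfl | h')
        exacts [h.good _ hl, h2 l' h']
      · simp only [excess_cons]
        omega
      · simp only [List.length_cons]
        omega
  · rw [sum_map_add_const, sum_map_mul_const]
    obtain ⟨-, h2, h3, h4⟩ := hr
    refine Within.pure (by omega) ⟨⟨h2, by simpa using h3⟩, ?_⟩
    simp only [List.length_nil] at h4
    split_ifs at h4 <;> omega

/-- No two edges of a loop run along the same segment. -/
theorem GoodLoop.not_opposite {B : ℕ} {e f : GapEdge} {l : Loop} (h : GoodLoop B (e :: l))
    (hf : f ∈ l) : ¬(f.a = e.b ∧ f.b = e.a) := by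
  rintro ⟨h1, h2⟩
  have hc := h.chain_cons
  have hn := h.nodup
  have h3 := h.three_le
  match l, hf, h, hc, hn, h3 with
  | f₀ :: g :: l, hf, h, hc, hn, h3 =>
    simp only [List.map_cons, List.cons_append, List.cons.injEq] at hc
    have hff : f = f₀ := by
      refine List.inj_on_of_nodup_map hn (List.mem_cons_of_mem _ hf) (by simp) ?_
      rw [h1, hc.1]
    subst hff
    simp only [List.map_cons, List.nodup_cons, List.mem_cons, not_or] at hn
    exact hn.1.2.1 (by rw [← h2, hc.2.1])

theorem GoodLoop.insert {B : ℕ} {e : GapEdge} {l : Loop} {p : Pt} (h : GoodLoop B (e :: l))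
    (hp : ∀ f ∈ e :: l, f.a ≠ p) :
    GoodLoop B ({ e with b := p } :: { e with a := p } :: l) where
  three_le := by have := h.three_le; simp at this ⊢; omega
  nodup := by
    have := h.nodup
    simp only [List.map_cons, List.nodup_cons, List.mem_cons, not_or, List.mem_map,
      not_exists, not_and] at this ⊢
    exact ⟨⟨hp e (by simp), this.1⟩, fun f hf => hp f (by simp [hf]), this.2⟩
  chain := by
    have := h.chain_cons
    simp only [List.map_cons, List.rotate_cons_succ, List.rotate_zero]
    rw [this]
    simp
  sub_lt f hf := by
    simp only [List.mem_cons] at hf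
    have he := h.sub_lt e (by simp)
    rcases hf with rfl | rfl | hf
    exacts [he, he, h.sub_lt f (by simp [hf])]

/-- In a loop with at least three distinct vertices, at most one edge runs along a given segment, in
either direction. Hence at most one edge is subdivided. -/
theorem GoodLoop.addPoint {B : ℕ} {l : Loop} (h : GoodLoop B l) (x y p : Pt)
    (hp : ∀ e ∈ l, e.a ≠ p) :
    GoodLoop B (l.flatMap fun e =>
      if isEdge x y e || isEdge y x e then [{ e with b := p }, { e with a := p }] else [e]) ∧
    (l.flatMap fun e => if isEdge x y e || isEdge y x e then
      [{ e with b := p }, { e with a := p }] else [e]).length ≤ l.length + 1 := by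
  set g := fun e : GapEdge => if isEdge x y e || isEdge y x e then
      [{ e with b := p }, { e with a := p }] else [e] with hg
  have keep : ∀ l : Loop, (∀ e ∈ l, (isEdge x y e || isEdge y x e) = false) → l.flatMap g = l := by
    intro l
    induction l with
    | nil => simp
    | cons e l ih =>
      intro hl
      have := hl e (by simp)
      rw [List.flatMap_cons, ih fun f hf => hl f (by simp [hf])]
      simp only [hg, this, Bool.false_eq_true, if_false, List.singleton_append]
  by_cases hex : ∃ e ∈ l, (isEdge x y e || isEdge y x e) = true
  · obtain ⟨e, he, hm⟩ := hex
    obtain ⟨l₁, l₂, rfl⟩ := List.append_of_mem he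
    have h' := h.swap
    rw [List.cons_append] at h'
    have hothers : ∀ f ∈ l₂ ++ l₁, (isEdge x y f || isEdge y x f) = false := by
      intro f hf
      rw [← Bool.not_eq_true]
      intro hmf
      have hne : f.a ≠ e.a := by
        have := h'.nodup
        simp only [List.map_cons, List.nodup_cons, List.mem_map, not_exists, not_and] at this
        exact this.1 f hf
      have hno := h'.not_opposite hf
      simp only [Bool.or_eq_true, isEdge_iff] at hm hmf
      rcases hm with ⟨rfl, rfl⟩ | ⟨rfl, rfl⟩ <;> rcases hmf with ⟨ha, hb⟩ | ⟨ha, hb⟩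
      exacts [hne ha, hno ⟨ha, hb⟩, hno ⟨ha, hb⟩, hne ha]
    have hge : g e = [{ e with b := p }, { e with a := p }] := by
      simp only [hg, hm, if_true]
    have hval : (l₁ ++ e :: l₂).flatMap g =
        l₁ ++ ({ e with b := p } :: { e with a := p } :: l₂) := by
      rw [List.flatMap_append, List.flatMap_cons, hge,
        keep l₁ fun f hf => hothers f (by simp [hf]), keep l₂ fun f hf => hothers f (by simp [hf])]
      rfl
    rw [hval]
    refine ⟨?_, by simp; omega⟩
    refine GoodLoop.swap (p := { e with b := p } :: { e with a := p } :: l₂) ?_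
    refine h'.insert fun f hf => hp f ?_
    simp at hf ⊢
    tauto
  · push Not at hex
    rw [keep l fun e he => by simpa using hex e he]
    exact ⟨h, by omega⟩

/-- Each loop gains at most one edge, so the excess grows by at most the number of loops. This is
the only operation on subdivisions that increases it. -/
theorem addPoint_spec {B n : ℕ} {ls : List Loop} (h : Subdivision B n ls) (x y p : Pt) :
    Spec (addPoint ls x y p) (100 * n + 20) (Subdivision B (n + ls.length)) := by
  have hlen := h.length_le
  have hsum := h.sum_length_le
  have key : ∀ l ∈ ls, Spec (do
      let old ← anyR (fun e => charge 4 (same e.a p)) l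
      if old then return l else do
        let parts ← mapR (fun (e : GapEdge) => charge 12 (
          if isEdge x y e || isEdge y x e then [{ e with b := p }, { e with a := p }] else [e])) l
        concatR parts : Run Loop) (21 * l.length + 10)
      (fun l' => GoodLoop B l' ∧ l'.length ≤ l.length + 1) := by
    intro l hl
    refine Within.spec (Within.bind (Spec.anyR_const (K := 4) (by simp)) fun old hold => ?_)
    refine Within.ite (fun _ => Within.pure (by omega) ⟨h.good l hl, by omega⟩) fun hno => ?_
    have hp : ∀ e ∈ l, e.a ≠ p := by
      rw [hold] at hno
      simpa [same_iff] using hno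
    have := (h.good l hl).addPoint x y p hp
    refine Within.bind (Spec.mapR_const (K := 12) (by simp)) fun parts hparts => ?_
    have hpl : parts.length = l.length := by simp [hparts]
    have hfl : parts.flatten = l.flatMap fun e => if isEdge x y e || isEdge y x e then
      [{ e with b := p }, { e with a := p }] else [e] := by
      rw [hparts, List.flatMap_def]; rfl
    rw [← hfl] at this
    refine Within.last (Spec.concatR parts) (by omega) fun l' hl' => ?_
    rwa [hl']
  unfold addPoint
  refine ((Spec.mapR fun l hl => (key l hl).1).le ?_).imp fun r hr => ?_
  · rw [sum_map_add_const, sum_map_mul_const]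
    omega
  · subst hr
    constructor
    · simp only [List.mem_map]
      rintro _ ⟨l, hl, rfl⟩
      exact (key l hl).2.1
    · have := h.excess_le
      unfold excess at this ⊢
      rw [List.map_map]
      refine (sum_map_le_sum (g := fun l => (l.length - 2) + 1) fun l hl => ?_).trans ?_
      · have h1 := (key l hl).2.2
        have h2 := (h.good l hl).three_le
        simp only [Function.comp]
        omega
      · rw [sum_map_add_const]
        omega

/-- Changing the labels of the edges. -/
theorem GoodLoop.recolor {B : ℕ} {l : Loop} (h : GoodLoop B l) {g : GapEdge → GapEdge}
    (ha : ∀ e, (g e).a = e.a) (hb : ∀ e, (g e).b = e.b) (hs : ∀ e, e.sub < B → (g e).sub < B) :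
    GoodLoop B (l.map g) where
  three_le := by simpa using h.three_le
  nodup := by simpa [Function.comp_def, ha] using h.nodup
  chain := by simpa [Function.comp_def, ha, hb] using h.chain
  sub_lt := by
    simp only [List.mem_map]
    rintro _ ⟨e, he, rfl⟩
    exact hs e (h.sub_lt e he)

theorem Subdivision.recolor {B n : ℕ} {ls : List Loop} (h : Subdivision B n ls)
    {g : GapEdge → GapEdge} (ha : ∀ e, (g e).a = e.a) (hb : ∀ e, (g e).b = e.b)
    (hs : ∀ e, e.sub < B → (g e).sub < B) : Subdivision B n (ls.map fun l => l.map g) where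
  good := by
    simp only [List.mem_map]
    rintro _ ⟨l, hl, rfl⟩
    exact (h.good l hl).recolor ha hb hs
  excess_le := by
    have := h.excess_le
    simpa [excess, Function.comp_def] using this

theorem recolorR_spec {B n : ℕ} {ls : List Loop} (h : Subdivision B n ls)
    {g : GapEdge → GapEdge} (ha : ∀ e, (g e).a = e.a) (hb : ∀ e, (g e).b = e.b)
    (hs : ∀ e, e.sub < B → (g e).sub < B) :
    Spec (mapR (mapR fun e => charge 12 (g e)) ls) (50 * n + 1) (Subdivision B n) := by
  have hlen := h.length_le
  have hsum := h.sum_length_le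
  refine ((Spec.mapR (c := fun l => 14 * l.length + 1) fun l _ =>
    (Spec.mapR_const (by simp)).1).le ?_).imp fun r hr => ?_
  · rw [sum_map_add_const, sum_map_mul_const]
    omega
  · have : r = ls.map fun l => l.map g := by simp [hr, mapR_val]
    rw [this]
    exact h.recolor ha hb hs

theorem pathEdges_spec (p : List Pt) :
    Spec (pathEdges p) (p.length + 1) (fun es => es.length ≤ p.length) :=
  (Spec.zipR p p.tail).imp fun es h => by simp [h]

/-- Every edge of the path costs one chord and one recolouring, both linear; the first preserves the
excess, and the second does not touch the geometry. -/
theorem cutPath_spec {B n : ℕ} {ls : List Loop} (h : Subdivision B n ls) (path : List Pt) {sub : ℕ}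
    (hsub : sub < B) (unit : Option ℕ) :
    Spec (cutPath ls path sub unit) (260 * (n + 1) * (path.length + 1)) (Subdivision B n) := by
  unfold cutPath
  refine Within.spec (Within.bind (pathEdges_spec path) fun es hes => ?_)
  refine Within.last (Spec.foldR_const (Subdivision B n) (250 * n + 25) h fun s _ ls hls => ?_) ?_
    fun _ h => h
  · refine Within.spec (Within.bind (addChord_spec hls s.1 s.2) fun ls' hls' => ?_)
    refine Within.last (recolorR_spec hls'.1 (fun e => ?_) (fun e => ?_) fun e he => ?_)
      (by omega) fun _ h => h
    all_goals split_ifs <;> first | rfl | assumption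
  · nlinarith

/-! ### Runs and sub-boundaries of a loop. -/

theorem runsR_spec {α : Type} (eq : α → α → Bool) (l : List α) :
    Spec (runsR eq l) (20 * l.length + 20)
      (fun gs => (∃ k, gs.flatten = l.rotate k) ∧ ∀ g ∈ gs, g ≠ []) := by
  unfold runsR
  refine Within.spec (Within.bind (Spec.reverseR l) fun rev hrev => ?_)
  refine Within.bind (Spec.foldR_rest (fun (rest : List α) (gs : List (List α)) =>
    rest.reverse ++ gs.flatten = l ∧ ∀ g ∈ gs, g ≠ []) (fun _ => 5) (by simp [hrev]) ?_)
    fun gs hgs => ?_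
  · rintro a rest gs ⟨h1, h2⟩
    refine Spec.charge ?_
    split
    · rename_i b g gs'
      split_ifs
      · refine ⟨by simpa using h1, ?_⟩
        simp only [List.mem_cons] at h2 ⊢
        rintro g' (rfl | h')
        exacts [by simp, h2 g' (Or.inr h')]
      · refine ⟨by simpa using h1, ?_⟩
        simp only [List.mem_cons] at h2 ⊢
        rintro g' (rfl | h')
        exacts [by simp, h2 g' h']
    · refine ⟨by simpa using h1, ?_⟩
      simp only [List.mem_cons] at h2 ⊢
      rintro g' (rfl | h')
      exacts [by simp, h2 g' h']
  obtain ⟨h1, h2⟩ := hgs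
  simp only [List.reverse_nil, List.nil_append] at h1
  have hrl : rev.length = l.length := by simp [hrev]
  have hgl := length_flatten_le h2
  rw [h1] at hgl
  have h0 : (∃ k, gs.flatten = l.rotate k) ∧ ∀ g ∈ gs, g ≠ [] := ⟨⟨0, by simp [h1]⟩, h2⟩
  have hc : (List.map (fun _ => 5) rev).sum = 5 * l.length := by
    simp [hrl, mul_comm]
  rw [hc, hrl]
  split
  · rename_i g g' gs'
    refine Within.bind (Spec.reverseR _) fun rest hrest => ?_
    simp only [List.length_cons] at hgl ⊢
    split
    · rename_i x t y h rest'
      refine Within.ite (fun _ => ?_) fun _ => ?_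
      · refine Within.bind (Spec.appendR _ _) fun first hfirst => ?_
        refine Within.bind (Spec.reverseR _) fun mid hmid => ?_
        have hgs' : g' :: gs' = rest'.reverse ++ [y :: h] := by
          have := congrArg List.reverse hrest
          simpa using this.symm
        rw [hgs'] at h1 h2
        have hgl' : gs'.length + 1 = rest'.length + 1 := by
          simpa using congrArg List.length hgs'
        have hyl : (y :: h).length ≤ l.length := by rw [← h1]; simp; omega
        -- When the last run continues in the first one, it is moved to the front: a rotation by the
        -- total length of all other runs.
        refine Within.charge (by simp at hgl hyl ⊢; omega) ⟨⟨((x :: t) ++ rest'.reverse.flatten).length, ?_⟩, ?_⟩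
        · have : l = ((x :: t) ++ rest'.reverse.flatten) ++ (y :: h) := by rw [← h1]; simp
          rw [this, List.rotate_append_length_eq, hfirst, hmid]
          simp
        · rw [hfirst, hmid]
          simp only [List.mem_cons]
          rintro g'' (rfl | h')
          · simp
          · exact h2 g'' (by simp at h' ⊢; tauto)
      · exact Within.charge (by omega) h0
    · exact Within.pure (by omega) h0
  · exact Within.charge (by omega) h0

/-- Bounds for the sub-boundaries of a polygon with `n` edges. -/
structure SubsBound (B n : ℕ) (subs : List Sub) : Prop where
  length_le : subs.length ≤ n
  sum_pts_le : (subs.map fun s => s.pts.length).sum ≤ 2 * n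
  id_lt : ∀ s ∈ subs, s.id < B

theorem SubsBound.mono {B m n : ℕ} {subs : List Sub} (h : SubsBound B m subs) (hmn : m ≤ n) :
    SubsBound B n subs :=
  ⟨h.length_le.trans hmn, h.sum_pts_le.trans (by omega), h.id_lt⟩

/-- A run of `m` edges has `m + 1` points. Since runs are non-empty, there are at most as many runs
as edges, which gives the factor two. -/
theorem subBoundaries_spec {B : ℕ} {l : Loop} (h : ∀ e ∈ l, e.sub < B) :
    Spec (subBoundaries l) (100 * l.length + 100)
      (fun r => SubsBound B l.length r.1 ∧ r.2.length = l.length) := by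
  unfold subBoundaries
  refine Within.spec (Within.bind (Spec.lengthR l) fun n hn => ?_)
  refine Within.bind (runsR_spec _ l) fun runs hruns => ?_
  obtain ⟨⟨k, hk⟩, hne⟩ := hruns
  have hfl : runs.flatten.length = l.length := by simp [hk]
  have hrl := length_flatten_le hne
  have hsl : (runs.map List.length).sum = l.length := by rw [← hfl, List.length_flatten]
  have hmem : ∀ g ∈ runs, ∀ e ∈ g, e.sub < B := fun g hg e he => h e (by
    have : e ∈ runs.flatten := List.mem_flatten_of_mem hg he
    rw [hk] at this
    exact List.mem_rotate.1 this)
  refine Within.bind (Spec.foldR_rest (fun (rest : List (List GapEdge)) (s : List Sub × ℕ) =>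
    s.1.length + rest.length ≤ runs.length ∧
    (s.1.map fun s => s.pts.length).sum + (rest.map fun g => g.length + 1).sum ≤ 2 * l.length ∧
    (∀ s' ∈ s.1, Sub.id s' < B) ∧ (∀ g ∈ rest, g ∈ runs))
    (fun g => 6 * g.length + 20) ?_ ?_) fun r hr => ?_
  · refine ⟨by simp, ?_, by simp, fun _ h => h⟩
    rw [sum_map_add_const, hsl]
    simp
    omega
  · rintro g rest s ⟨h1, h2, h3, h4⟩
    simp only [List.length_cons, List.map_cons, List.sum_cons] at h1 h2
    refine Within.spec (Within.bind (Spec.lengthR g) fun m hm => ?_)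
    refine Within.bind (Spec.lastR g) fun z hz => ?_
    refine Within.bind (Spec.mapR_const (K := 1) (by simp)) fun ps hps => ?_
    refine Within.bind (Spec.appendR _ _) fun ps' hps' => ?_
    have hpl : ps.length = g.length := by simp [hps]
    have hpl' : ps'.length ≤ g.length + 1 := by
      rw [hps', List.length_append, hpl]
      cases z <;> simp
    refine Within.charge (by omega) ?_
    have h4' : ∀ g ∈ rest, g ∈ runs := fun g' h' => h4 g' (by simp [h'])
    split
    · rename_i e g'
      refine ⟨by simp; omega, by simp at h2 hpl' ⊢; omega, ?_, h4'⟩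
      simp only [List.mem_cons]
      rintro s' (rfl | h')
      · exact hmem (e :: g') (h4 (e :: g') List.mem_cons_self) e List.mem_cons_self
      · exact h3 s' h'
    · exact ⟨by omega, by simp at h2 ⊢; omega, h3, h4'⟩
  · obtain ⟨h1, h2, h3, -⟩ := hr
    simp only [List.length_nil, List.map_nil, List.sum_nil, add_zero] at h1 h2
    rw [sum_map_add_const, sum_map_mul_const, hsl]
    refine Within.bind (Spec.reverseR _) fun subs hsubs => ?_
    refine Within.bind (Spec.concatR runs) fun es hes => ?_
    have hel : es.length = l.length := by rw [hes, hfl]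
    refine Within.bind (Spec.mapR_const (K := 1) (by simp)) fun vs hvs => ?_
    refine Within.pure (by omega) ⟨⟨?_, ?_, ?_⟩, by simp [hvs, hel]⟩
    · simp [hsubs]; omega
    · simpa [hsubs] using h2
    · simpa [hsubs] using h3

/-- Quadratic for each sub-boundary: its shortest path has linearly many edges, and each of them is
cut in linear time. The factor `subs.length + 1` is kept, because the lemma is used both for all
sub-boundaries of a gap and for just two. -/
theorem convexify_spec {B m : ℕ} {l : Loop} (hl : GoodLoop B l) {subs : List Sub}
    (hs : SubsBound B m subs) {t : Triang} (ht : t.Sized l.length) :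
    Spec (convexify l subs t) (3000 * (l.length + 1) ^ 2 * (subs.length + 1))
      (Subdivision B (l.length - 2)) := by
  unfold convexify
  refine (Spec.foldR_const _ (2200 * (l.length + 1) + 260 * (l.length + 1) * (l.length + 2) + 1)
    hl.subdivision fun s hsm ls hls => ?_).le ?_
  · refine Within.spec (Within.ite (fun _ => ?_) fun _ => ?_)
    · refine Within.bind (ht.geodesicPts _ _) fun p hp => ?_
      refine Within.last (cutPath_spec hls p (hs.id_lt s hsm) _) ?_ fun _ h => h
      have : 260 * (l.length - 2 + 1) * (p.length + 1) ≤ 260 * (l.length + 1) * (l.length + 2) :=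
        Nat.mul_le_mul (Nat.mul_le_mul_left 260 (by omega)) (by omega)
      linarith
    · exact Within.charge (by omega) hls
  · have := hl.three_le
    generalize l.length = n at *
    generalize subs.length = k at *
    have e : 2200 * (n + 1) + 260 * (n + 1) * (n + 2) + 1 + 1 ≤ 3000 * (n + 1) ^ 2 := by nlinarith
    have := Nat.mul_le_mul_right k e
    nlinarith

/-- Total size of polygons that have been assigned. -/
def partWeight (ps : List Part) : ℕ := (ps.map fun p => p.1.length + 1).sum

@[simp] theorem partWeight_nil : partWeight [] = 0 := rfl
@[simp] theorem partWeight_cons (p : Part) (ps : List Part) :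
    partWeight (p :: ps) = p.1.length + 1 + partWeight ps := by simp [partWeight]
@[simp] theorem partWeight_append (ps qs : List Part) :
    partWeight (ps ++ qs) = partWeight ps + partWeight qs := by simp [partWeight]

theorem length_le_partWeight (ps : List Part) : ps.length ≤ partWeight ps :=
  length_le_sum_map fun _ _ => by omega

theorem loopEdges_spec (l : Loop) :
    Spec (loopEdges l) (3 * l.length + 1) (fun es => es.length = l.length) :=
  (Spec.mapR_const (K := 1) (by simp)).imp fun es h => by simp [h]

/-- An assigned loop with `k ≥ 3` edges has weight `k + 1 ≤ 25 * (k - 2)`, so it is paid for by the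
excess that leaves the remaining gaps. The generous factor 25 is chosen for the triangular case of
the gap step. -/
theorem sortLoops_spec {B n : ℕ} {ls : List Loop} (h : Subdivision B n ls) :
    Spec (sortLoops ls) (50 * n + 20)
      (fun r => (∀ l ∈ r.2, GoodLoop B l) ∧ partWeight r.1 + 25 * excess r.2 ≤ 25 * n ∧
        r.1.length ≤ n ∧ r.2.length ≤ n) := by
  have hlen := h.length_le
  have hsum := h.sum_length_le
  unfold sortLoops
  refine ((Spec.foldR_rest (fun (rest : List Loop) (s : List Part × List Loop) =>
    (∀ l ∈ rest, l ∈ ls) ∧ (∀ l ∈ s.2, GoodLoop B l) ∧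
      partWeight s.1 + 25 * excess s.2 + 25 * excess rest ≤ 25 * n ∧
      s.1.length + rest.length ≤ ls.length ∧ s.2.length + rest.length ≤ ls.length)
    (fun l => 5 * l.length + 10)
    ⟨fun _ h => h, by simp, by simpa using h.excess_le, by simp, by simp⟩ ?_).le ?_).imp
    fun r hr => ?_
  · rintro l rest s ⟨h1, h2, h3, h4, h5⟩
    have hl := h.good l (h1 l (by simp))
    have h1' : ∀ l ∈ rest, l ∈ ls := fun l' h' => h1 l' (by simp [h'])
    have hl3 := hl.three_le
    simp only [excess_cons, List.length_cons] at h3 h4 h5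
    refine Within.spec (Within.bind (Spec.findR_const (K := 1) (by simp)) fun o _ => ?_)
    split
    · refine Within.charge (by omega) ⟨h1', ?_, ?_, ?_, ?_⟩
      · simp only [List.mem_cons]
        rintro l' (rfl | h')
        exacts [hl, h2 l' h']
      all_goals simp; omega
    · refine Within.bind (loopEdges_spec l) fun es hes => ?_
      refine Within.charge (by omega) ?_
      split
      · exact ⟨h1', h2, by simp; omega, by simp; omega, by simp; omega⟩
      · exact ⟨h1', h2, by omega, by omega, by omega⟩
  · rw [sum_map_add_const, sum_map_mul_const]
    omega
  · obtain ⟨-, h2, h3, h4, h5⟩ := hr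
    simp at h3 h4 h5
    exact ⟨h2, h3, by omega, by omega⟩

/-! ### Filling gaps with few sub-boundaries -/

theorem ringEdges_spec (p : Poly) :
    Spec (ringEdges p) (2 * p.length + 2) (fun es => es = p.zip (p.rotate 1)) := by
  unfold ringEdges
  refine Within.spec (Within.bind (Spec.shiftR p) fun q hq => ?_)
  exact Within.last (Spec.zipR p q) (by omega) fun es h => by rw [h, hq]

theorem touchR_cost_le (es fs : List Seg) :
    (touchR es fs).cost ≤ (11 * fs.length + 3) * es.length + 2 :=
  anyR_cost_le_const fun _ _ => anyR_cost_le_const (by simp)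

theorem cornerR_cost_le (prev next : Sub) : (cornerR prev next).cost ≤ prev.pts.length + 51 := by
  unfold cornerR
  refine (Within.spec (Q := fun _ => True) (Within.bind (Spec.reverseR _) fun rp _ => ?_)).1
  split
  · exact Within.charge (by omega) trivial
  · exact Within.pure (by omega) trivial

theorem length_nearer_le (v p q : Pt) : (nearer v p q).length ≤ 1 := by
  unfold nearer
  split_ifs <;> simp

theorem fillRegion_spec (s : Sub) (v w m mv mw : Pt) :
    Spec (do
      let p ← appendR s.pts (nearer w m mw ++ [m] ++ nearer v m mv)
      let es ← ringEdges p
      let _ ← charge 40 ()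
      return (es, s.unit) : Run (List Seg × Option ℕ)) (3 * s.pts.length + 60)
      (fun r => r.1.length ≤ s.pts.length + 3) := by
  have h1 := length_nearer_le w m mw
  have h2 := length_nearer_le v m mv
  refine Within.spec (Within.bind (Spec.appendR _ _) fun p hp => ?_)
  have hpl : p.length ≤ s.pts.length + 3 := by simp [hp]; omega
  refine Within.bind (ringEdges_spec p) fun es hes => Within.tick ?_
  exact Within.pure (by omega) (by simpa [hes] using hpl)

/-- Each of the three outer regions exceeds its sub-boundary by at most three edges, and the inner
triangle contributes at most three triangles. With one unit of weight per part this adds `3 * 4 + 3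
* 4 = 24`. -/
theorem fillThree_spec (s₀ s₁ s₂ : Sub) :
    Spec (fillThree s₀ s₁ s₂) (100 * (s₀.pts.length + s₁.pts.length + s₂.pts.length) + 3000)
      (fun ps => partWeight ps ≤ s₀.pts.length + s₁.pts.length + s₂.pts.length + 24 ∧
        ps.length ≤ 6) := by
  unfold fillThree
  refine Within.spec (Within.bind (Spec.cost_le (cornerR_cost_le _ _)) fun ⟨v₀, d₀⟩ _ => ?_)
  refine Within.bind (Spec.cost_le (cornerR_cost_le _ _)) fun ⟨v₁, d₁⟩ _ => ?_
  refine Within.bind (Spec.cost_le (cornerR_cost_le _ _)) fun ⟨v₂, d₂⟩ _ => ?_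
  refine Within.tick ?_
  refine Within.bind (fillRegion_spec s₀ _ _ _ _ _) fun r₀ h₀ => ?_
  refine Within.bind (fillRegion_spec s₁ _ _ _ _ _) fun r₁ h₁ => ?_
  refine Within.bind (fillRegion_spec s₂ _ _ _ _ _) fun r₂ h₂ => ?_
  refine Within.bind (ringEdges_spec _) fun sides hsides => ?_
  have hside : sides.length = 3 := by
    rw [hsides]
    split_ifs <;> simp
  have htri : ∀ m₀ m₁ m₂ : Pt, (if 0 < orient m₀ m₁ m₂ then [m₀, m₁, m₂] else
      [m₀, m₂, m₁]).length = 3 := fun _ _ _ => by split_ifs <;> simp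
  rw [htri]
  refine Within.ite_bind (k₁ := 33 * (r₀.1.length + r₁.1.length + r₂.1.length) + 400)
    (Q := fun inner : List (List Seg × Option ℕ) => inner.length ≤ 3 ∧ ∀ r ∈ inner, r.1.length = 3)
    (Within.spec (Within.ite (fun _ => Within.charge (by omega) (by simp)) fun _ => ?_))
    fun inner hinner => ?_
  · refine Within.last (Spec.mapR_const
      (K := 11 * (r₀.1.length + r₁.1.length + r₂.1.length) + 90) fun e _ => ?_)
      (by rw [hside]; omega) fun r hr => ?_
    · have := (Spec.findR (l := [r₀, r₁, r₂]) (c := fun r => 11 * r.1.length + 5)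
        (p := fun (r : List Seg × Option ℕ) => touchR [e] r.1)
        fun r _ => (touchR_cost_le [e] r.1).trans (by simp)).1
      simp only [bind_cost, charge_cost]
      simp at this
      omega
    · rw [hr]
      simp only [List.length_map, hside, List.mem_map, bind_val, charge_val]
      refine ⟨le_rfl, ?_⟩
      rintro _ ⟨_, _, rfl⟩
      rfl
  · refine Within.bind (Spec.appendR _ _) fun all hall => ?_
    have hal : all.length ≤ 6 := by simp [hall]; omega
    have hsum : (all.map fun r => r.1.length + 1).sum ≤
        s₀.pts.length + s₁.pts.length + s₂.pts.length + 24 := by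
      have := sum_map_le_mul (l := inner) (f := fun r => r.1.length + 1) (K := 4)
        fun r hr => by rw [hinner.2 r hr]
      simp [hall] at this ⊢
      omega
    refine Within.last (Spec.foldR_rest (fun (rest : List (List Seg × Option ℕ)) (ps : List Part) =>
      partWeight ps + (rest.map fun r => r.1.length + 1).sum ≤
        s₀.pts.length + s₁.pts.length + s₂.pts.length + 24 ∧ ps.length + rest.length ≤ 6)
      (fun _ => 2) ⟨by simpa only [partWeight_nil, Nat.zero_add] using hsum, by simpa using hal⟩ ?_) ?_
      fun ps hps => by simpa using hps
    · rintro r rest ps ⟨h1, h2⟩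
      refine Spec.charge ?_
      simp only [List.map_cons, List.sum_cons, List.length_cons] at h1 h2
      split
      · simp only [partWeight_cons, List.length_cons]; omega
      · exact ⟨by omega, by omega⟩
    · simp
      omega

theorem fillExteriorThree_spec {B : ℕ} {l : Loop} (hl : GoodLoop B l) {t : Triang}
    (ht : t.Sized l.length) (s₁ s₂ x : Sub) :
    Spec (fillExteriorThree l t s₁ s₂ x) (20 * x.pts.length + 3000 * (l.length + 1) ^ 2)
      (Subdivision B (l.length - 2)) := by
  unfold fillExteriorThree
  refine Within.spec (Within.bind (Spec.numberR _) fun xs hxs => ?_)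
  have hxl : xs.length = x.pts.length := by simp [hxs]
  refine Within.bind (Spec.cost_le (argminR_cost_le (c := fun _ => 8) (by simp))) fun best _ => ?_
  refine Within.bind (ht.geodesicPts _ _) fun p hp => ?_
  refine Within.bind (pathEdges_spec p) fun es hes => ?_
  refine Within.last (Spec.foldR_const (Subdivision B (l.length - 2)) (250 * l.length + 25)
    hl.subdivision fun s _ ls hls => ?_) ?_ fun _ h => h
  · refine Within.spec (Within.bind (addChord_spec hls s.1 s.2) fun ls' hls' => ?_)
    refine Within.last (recolorR_spec hls'.1 (fun e => ?_) (fun e => ?_) fun e he => ?_)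
      (by omega) fun _ h => h
    all_goals split_ifs <;> first | rfl | assumption
  · have : (List.map (fun _ => 8) xs).sum = 8 * x.pts.length := by simp [hxl, mul_comm]
    rw [this]
    have : es.length ≤ l.length + 1 := by omega
    have := Nat.mul_le_mul_left (250 * l.length + 26) this
    nlinarith

/-! ### Treating pairs of sub-boundaries -/

theorem distSubs_cost_le (s s' : Sub) :
    (distSubs s s').cost ≤ 300 * ((s.pts.length + 1) * (s'.pts.length + 1)) := by
  unfold distSubs
  refine (Within.spec (Q := fun _ => True)
    (Within.bind (pathEdges_spec _) fun es hes => ?_)).1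
  refine Within.bind (pathEdges_spec _) fun fs hfs => ?_
  refine Within.bind (Spec.cost_le (foldR_cost_le_const (K := 201 * fs.length + 1)
    fun b e _ => foldR_cost_le_const (by simp))) fun r _ => ?_
  refine Within.charge ?_ trivial
  have := Nat.mul_le_mul hfs hes
  nlinarith

/-- The weight of a pair of sub-boundaries. -/
def Pair.weight (p : Pair) : ℕ := (p.fst.pts.length + 1) * (p.snd.pts.length + 1)

/-- Up to a constant factor, this is what measuring or trying all pairs costs beyond shortest paths.
-/
def rowsWeight (rows : List (List Pair)) : ℕ :=
  (rows.map fun row => (row.map Pair.weight).sum).sum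

/-- The paths of a cut have at most `n` vertices. -/
def Cut.Short (n : ℕ) : Cut → Prop
  | .join _ _ β₁ β₂ => β₁.length ≤ n ∧ β₂.length ≤ n
  | .extend _ path => path.length ≤ n

theorem closestFirst_spec (row : List Pair) :
    Spec (closestFirst row) (5 * row.length + 1) (fun r => r.Perm row) := by
  unfold closestFirst
  refine ((Spec.foldR_rest (fun (rest : List Pair) (acc : List Pair) => (acc ++ rest).Perm row)
    (fun _ => 4) (by simp) ?_).le (by simp; omega)).imp fun r h => by simpa using h
  intro p rest acc h
  refine Spec.charge (List.Perm.trans ?_ h)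
  split
  · simp
  · rename_i q r
    have : ((p :: q :: r) ++ rest).Perm ((q :: r) ++ p :: rest) := List.perm_middle.symm
    split_ifs
    · exact this
    · exact (List.Perm.swap p q (r ++ rest)).trans this

theorem dropCommon_spec (ps qs : List Pt) :
    Spec (dropCommon ps qs) (5 * ps.length + 5)
      (fun r => r.1.length ≤ ps.length ∧ r.2.length ≤ qs.length) := by
  induction ps generalizing qs with
  | nil => exact ⟨by simp [dropCommon], by simp [dropCommon]⟩
  | cons p ps ih =>
    match ps, qs, ih with
    | [], qs, _ => exact ⟨by simp [dropCommon], by simp [dropCommon]⟩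
    | p' :: ps, [], _ => exact ⟨by simp [dropCommon], by simp [dropCommon]⟩
    | p' :: ps, [q], _ => exact ⟨by simp [dropCommon], by simp [dropCommon]⟩
    | p' :: ps, q :: q' :: qs, ih =>
      simp only [dropCommon]
      refine Within.spec (Within.ite (fun _ => Within.tick ?_) fun _ => ?_)
      · refine Within.last (ih (q' :: qs)) (by simp; omega) fun r hr => ?_
        simp at hr ⊢
        omega
      · exact Within.charge (by simp) (by simp)

theorem disjointR_cost_le (n : ℕ) (p q : List ℕ) :
    (disjointR n p q).cost ≤ n + 2 * p.length + 2 * q.length + 10 := by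
  unfold disjointR
  refine (Within.spec (Q := fun _ => True) (Within.bind (Spec.allocR _ _) fun m _ => ?_)).1
  refine Within.bind (Spec.cost_le (foldR_cost_le_const (K := 1) (by simp))) fun m' _ => ?_
  refine Within.bind (Spec.cost_le (anyR_cost_le_const (K := 1) (by simp))) fun h _ => ?_
  exact Within.charge (by omega) trivial

theorem tryJoin_spec {t : Triang} {n : ℕ} (ht : t.Sized n) (s s' : Sub) :
    Spec (tryJoin t s s') (10000 * (n + 1)) (fun o => ∀ c ∈ o, c.Short (2 * n + 4)) := by
  unfold tryJoin
  refine Within.spec (Within.bind (ht.geodesic _ _) fun α₁ h₁ => ?_)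
  refine Within.bind (ht.geodesic _ _) fun α₂ h₂ => ?_
  refine Within.bind (Spec.cost_le (disjointR_cost_le _ _ _)) fun free _ => ?_
  have := ht.1
  refine Within.ite (fun _ => ?_) fun _ => Within.pure (by omega) (by simp)
  refine Within.bind (ht.geodesicPts _ _) fun β₁ h₃ => ?_
  refine Within.bind (ht.geodesicPts _ _) fun β₂ h₄ => ?_
  refine Within.charge (by omega) ?_
  simp only [Option.mem_def, Option.some.injEq]
  rintro _ rfl
  exact ⟨by omega, by omega⟩

/-- The product term is the search for the exterior vertex closest to `s`; the shortest paths and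
their comparison are linear. -/
theorem tryExtend_spec {t : Triang} {n : ℕ} (ht : t.Sized n) (s x : Sub) :
    Spec (tryExtend t s x)
      (100 * ((s.pts.length + 1) * (x.pts.length + 1)) + 10000 * (n + 1))
      (fun o => ∀ c ∈ o, c.Short (2 * n + 4)) := by
  unfold tryExtend
  refine Within.spec (Within.bind (pathEdges_spec _) fun es hes => ?_)
  refine Within.bind (Spec.numberR _) fun xs hxs => ?_
  have hxl : xs.length = x.pts.length := by simp [hxs]
  refine Within.bind (Spec.cost_le (argminR_cost_le (c := fun _ => 53 * es.length + 3)
    fun v _ => ?_)) fun best _ => ?_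
  · have := argminR_cost_le (l := es) (c := fun _ => 50)
      (f := fun e => charge 50 (distPtSeg v.1 e)) (by simp)
    simp only [List.map_const', List.sum_replicate, smul_eq_mul] at this
    simp only [bind_cost, charge_cost]
    omega
  refine Within.bind (ht.geodesicPts _ _) fun γ₁ h₁ => ?_
  refine Within.bind (ht.geodesicPts _ _) fun γ₂ h₂ => ?_
  refine Within.bind (dropCommon_spec γ₁ γ₂) fun r hr => ?_
  refine Within.bind (Spec.reverseR _) fun back hback => ?_
  refine Within.bind (Spec.appendR _ _) fun path hpath => ?_
  have hpl : path.length ≤ 2 * n + 2 := by simp [hpath, hback]; omega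
  have hbl : back.length ≤ n + 1 := by simp [hback]; omega
  refine Within.bind (Spec.lengthR _) fun l₁ _ => ?_
  refine Within.bind (Spec.lengthR _) fun l₂ _ => ?_
  refine Within.bind (Spec.zipR _ _) fun ps hps => ?_
  have hpsl : ps.length ≤ path.length := by simp [hps]
  refine Within.bind (Spec.anyR_const (K := 4) (by simp)) fun differ _ => ?_
  refine Within.charge ?_ ?_
  · have e : (List.map (fun _ => 53 * es.length + 3) xs).sum =
        (53 * es.length + 3) * x.pts.length := by simp [hxl, mul_comm]
    rw [e, hxl]
    have h3 := Nat.mul_le_mul_right x.pts.length hes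
    have h4 : (s.pts.length + 1) * (x.pts.length + 1) =
      s.pts.length * x.pts.length + s.pts.length + x.pts.length + 1 := by ring
    rw [h4]
    have h5 : (53 * es.length + 3) * x.pts.length =
      53 * (es.length * x.pts.length) + 3 * x.pts.length := by ring
    rw [h5]
    generalize es.length * x.pts.length = u at *
    generalize s.pts.length * x.pts.length = v at *
    linarith
  · intro c hc
    split_ifs at hc
    · simp only [Option.mem_def, Option.some.injEq] at hc
      subst hc
      exact (by omega : path.length ≤ 2 * n + 4)
    · simp at hc

/-! ### The table of treated pairs -/

/-- The table has `B` rows and columns. -/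
def Table.Square (m : Table) (B : ℕ) : Prop := m.width = B ∧ m.cells.size = B * B

/-- Number of cells that have not been marked. -/
def Table.unmarked (m : Table) : ℕ := m.cells.toList.count false

theorem Table.Square.mark {m : Table} {B : ℕ} (h : m.Square B) (i j : ℕ) : (m.mark i j).Square B :=
  ⟨h.1, by simpa [Table.mark] using h.2⟩

theorem cell_lt {B i j : ℕ} (hi : i < B) (hj : j < B) : i * B + j < B * B := by
  have : (i + 1) * B ≤ B * B := Nat.mul_le_mul_right B hi
  nlinarith

theorem cell_inj {B i j i' j' : ℕ} (hj : j < B) (hj' : j' < B) (h : i * B + j = i' * B + j') :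
    i = i' ∧ j = j' := by
  have hB : 0 < B := by omega
  have h1 : (i * B + j) / B = i := by
    rw [mul_comm, Nat.mul_add_div hB, Nat.div_eq_of_lt hj, add_zero]
  have h2 : (i' * B + j') / B = i' := by
    rw [mul_comm, Nat.mul_add_div hB, Nat.div_eq_of_lt hj', add_zero]
  have : i = i' := by rw [← h1, h, h2]
  subst this
  exact ⟨rfl, by omega⟩

theorem count_false_set_true_le (l : List Bool) (i : ℕ) : (l.set i true).count false ≤ l.count false := by
  by_cases h : i < l.length
  · rw [List.count_set h]
    simp
  · rw [List.set_eq_of_length_le (by omega)]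

/-- Of the two writes, the first hits an unmarked cell and the second cannot unmark anything. The
bounds on `i` and `j` are needed because a cell outside the table also reads as unmarked. -/
theorem Table.unmarked_mark_lt {m : Table} {B i j : ℕ} (h : m.Square B) (hi : i < B) (hj : j < B)
    (hm : m.get i j = false) : (m.mark i j).unmarked + 1 ≤ m.unmarked := by
  have hlt : i * m.width + j < m.cells.toList.length := by
    rw [h.1]; simpa [h.2] using cell_lt hi hj
  have hget : m.cells.toList[i * m.width + j] = false := by
    simp only [Table.get, Array.getD_eq_getD_getElem?] at hm
    rw [Array.getElem?_eq_getElem (by simpa using hlt)] at hm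
    simpa using hm
  simp only [Table.unmarked, Table.mark, Array.toList_setIfInBounds]
  refine (Nat.add_le_add_right (count_false_set_true_le _ _) 1).trans ?_
  rw [List.count_set hlt, hget]
  have : 0 < m.cells.toList.count false :=
    List.count_pos_iff.2 (hget ▸ List.getElem_mem hlt)
  simp only [BEq.rfl, if_true, Bool.true_beq, Bool.false_eq_true, if_false, add_zero]
  omega

/-- Marking changes exactly the cells of the pair in its two orders, as different pairs of numbers
below the width have different cells. -/
theorem Table.get_mark {m : Table} {B i j i' j' : ℕ} (h : m.Square B) (hi : i < B) (hj : j < B)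
    (hj' : j' < B) (hm : m.get i' j' = false) (h₁ : ¬(i' = i ∧ j' = j)) (h₂ : ¬(i' = j ∧ j' = i)) :
    (m.mark i j).get i' j' = false := by
  have e₁ : i * m.width + j ≠ i' * m.width + j' := fun e => by
    rw [h.1] at e
    have := cell_inj hj hj' e
    exact h₁ ⟨this.1.symm, this.2.symm⟩
  have e₂ : j * m.width + i ≠ i' * m.width + j' := fun e => by
    rw [h.1] at e
    have := cell_inj hi hj' e
    exact h₂ ⟨this.1.symm, this.2.symm⟩
  simp only [Table.get, Table.mark, Array.getD_eq_getD_getElem?, Array.getElem?_setIfInBounds,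
    if_neg e₁, if_neg e₂] at hm ⊢
  exact hm

/-! ### Going through the candidate pairs -/

/-- Rows of pairs of sub-boundaries (with numbers below `B`, in an order given by `pos`) that have not
been marked in the table: every pair occurs once, and the rows belong to different first members. -/
structure Candidates (B n : ℕ) (pos : ℕ → ℕ) (bad : Table) (rows : List (List Pair)) : Prop where
  length_le : rows.length ≤ n
  row_le : ∀ r ∈ rows, r.length ≤ n
  apart : rows.Pairwise fun r r' => ∀ p ∈ r, ∀ p' ∈ r', p.fst.id ≠ p'.fst.id
  uniform : ∀ r ∈ rows, ∀ p ∈ r, ∀ p' ∈ r, p.fst.id = p'.fst.id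
  nodup : ∀ r ∈ rows, (r.map fun p => p.snd.id).Nodup
  pos_lt : ∀ r ∈ rows, ∀ p ∈ r, pos p.fst.id < pos p.snd.id
  id_lt : ∀ r ∈ rows, ∀ p ∈ r, p.fst.id < B ∧ p.snd.id < B
  unmarked : ∀ r ∈ rows, ∀ p ∈ r, bad.get p.fst.id p.snd.id = false

theorem rowsWeight_append (rows rows' : List (List Pair)) :
    rowsWeight (rows ++ rows') = rowsWeight rows + rowsWeight rows' := by simp [rowsWeight]

theorem rowsWeight_cons (r : List Pair) (rows : List (List Pair)) :
    rowsWeight (r :: rows) = (r.map Pair.weight).sum + rowsWeight rows := by simp [rowsWeight]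

/-- Removing and marking a pair. -/
theorem Candidates.remove {B n : ℕ} {pos : ℕ → ℕ} {bad : Table} {R R' : List (List Pair)}
    {p : Pair} {rest r' : List Pair} (h : Candidates B n pos bad (R ++ (p :: rest) :: R'))
    (hr : r'.Perm rest) (hB : bad.Square B) :
    Candidates B n pos (bad.mark p.fst.id p.snd.id) (R ++ r' :: R') := by
  have hp := h.id_lt (p :: rest) (by simp) p (by simp)
  have hmem : ∀ r ∈ R ++ r' :: R', ∀ q ∈ r, ∃ r₀ ∈ R ++ (p :: rest) :: R', q ∈ r₀ := by
    intro r hr₁ q hq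
    simp only [List.mem_append, List.mem_cons] at hr₁
    rcases hr₁ with h₁ | rfl | h₁
    · exact ⟨r, by simp [h₁], hq⟩
    · exact ⟨p :: rest, by simp, by simp [hr.mem_iff.1 hq]⟩
    · exact ⟨r, by simp [h₁], hq⟩
  have hap := h.apart
  rw [List.pairwise_append, List.pairwise_cons] at hap
  have hne : ∀ r ∈ R ++ r' :: R', ∀ q ∈ r, ¬(q.fst.id = p.fst.id ∧ q.snd.id = p.snd.id) := by
    rintro r hr₁ q hq ⟨e₁, e₂⟩
    simp only [List.mem_append, List.mem_cons] at hr₁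
    rcases hr₁ with h₁ | rfl | h₁
    · exact hap.2.2 r h₁ (p :: rest) (by simp) q hq p (by simp) e₁
    · have := h.nodup (p :: rest) (by simp)
      simp only [List.map_cons, List.nodup_cons, List.mem_map, not_exists, not_and] at this
      exact this.1 q (hr.mem_iff.1 hq) e₂
    · exact hap.2.1.1 r h₁ p (by simp) q hq e₁.symm
  refine ⟨by simpa using h.length_le, ?_, ?_, ?_, ?_, ?_, ?_, ?_⟩
  · intro r hr₁
    simp only [List.mem_append, List.mem_cons] at hr₁
    rcases hr₁ with h₁ | rfl | h₁
    · exact h.row_le r (by simp [h₁])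
    · have := h.row_le (p :: rest) (by simp)
      rw [hr.length_eq]
      simp at this
      omega
    · exact h.row_le r (by simp [h₁])
  · rw [List.pairwise_append, List.pairwise_cons]
    refine ⟨hap.1, ⟨fun r₁ h₁ q hq => hap.2.1.1 r₁ h₁ q (by simp [hr.mem_iff.1 hq]), hap.2.1.2⟩, ?_⟩
    intro r₁ h₁ r₂ h₂ q hq q' hq'
    simp only [List.mem_cons] at h₂
    rcases h₂ with rfl | h₂
    · exact hap.2.2 r₁ h₁ (p :: rest) (by simp) q hq q' (by simp [hr.mem_iff.1 hq'])
    · exact hap.2.2 r₁ h₁ r₂ (by simp [h₂]) q hq q' hq'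
  · intro r hr₁ q hq q' hq'
    simp only [List.mem_append, List.mem_cons] at hr₁
    rcases hr₁ with h₁ | rfl | h₁
    · exact h.uniform r (by simp [h₁]) q hq q' hq'
    · exact h.uniform (p :: rest) (by simp) q (by simp [hr.mem_iff.1 hq]) q'
        (by simp [hr.mem_iff.1 hq'])
    · exact h.uniform r (by simp [h₁]) q hq q' hq'
  · intro r hr₁
    simp only [List.mem_append, List.mem_cons] at hr₁
    rcases hr₁ with h₁ | rfl | h₁
    · exact h.nodup r (by simp [h₁])
    · have := h.nodup (p :: rest) (by simp)
      rw [List.map_cons, List.nodup_cons] at this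
      exact (hr.map _).nodup_iff.2 this.2
    · exact h.nodup r (by simp [h₁])
  · intro r hr₁ q hq
    obtain ⟨r₀, h₀, hq₀⟩ := hmem r hr₁ q hq
    exact h.pos_lt r₀ h₀ q hq₀
  · intro r hr₁ q hq
    obtain ⟨r₀, h₀, hq₀⟩ := hmem r hr₁ q hq
    exact h.id_lt r₀ h₀ q hq₀
  · intro r hr₁ q hq
    obtain ⟨r₀, h₀, hq₀⟩ := hmem r hr₁ q hq
    refine Table.get_mark hB hp.1 hp.2 (h.id_lt r₀ h₀ q hq₀).2 (h.unmarked r₀ h₀ q hq₀)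
      (hne r hr₁ q hq) ?_
    -- Marking is symmetric, so a candidate with the two members exchanged has to be excluded as
    -- well; the order `pos` of the members forbids it.
    rintro ⟨e₁, e₂⟩
    have h₁ := h.pos_lt r₀ h₀ q hq₀
    have h₂ := h.pos_lt (p :: rest) (by simp) p (by simp)
    rw [e₁, e₂] at h₁
    omega

/-- Measuring a pair costs the product of the sizes of its members, and these products sum to at
most the square of the total size. Hence all distances together cost `O(n ^ 2)`. Distinct numbers
make the position in the list an order on the members. -/
theorem candidateRows_spec {B n : ℕ} {subs : List Sub} (hs : SubsBound B n subs)
    (hid : (subs.map Sub.id).Nodup) (bad : Table) :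
    Spec (candidateRows subs bad) (4000 * (n + 1) ^ 2)
      (fun rows => Candidates B n (fun i => (subs.map Sub.id).idxOf i) bad rows ∧
        rowsWeight rows ≤ 9 * n ^ 2) := by
  set S := (subs.map fun s => s.pts.length + 1).sum with hS
  -- At most `2 * n` points altogether, and one more for each of the at most `n` sub-boundaries.
  have hSn : S ≤ 3 * n := by
    have h1 := hs.sum_pts_le
    have h2 := hs.length_le
    rw [hS, sum_map_add_const]
    omega
  have hlen := hs.length_le
  have hidx : ∀ p ∈ subs.zipIdx, (subs.map Sub.id).idxOf p.1.id = p.2 := by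
    intro p hp
    rw [List.mem_zipIdx_iff_getElem?] at hp
    obtain ⟨hlt, he⟩ := List.getElem?_eq_some_iff.1 hp
    have := hid.idxOf_getElem p.2 (by simpa using hlt)
    simpa [he] using this
  have hmem : ∀ p ∈ subs.zipIdx, p.1 ∈ subs := by
    intro p hp
    rw [List.mem_zipIdx_iff_getElem?] at hp
    exact List.mem_of_getElem? hp
  have hfst : subs.zipIdx.map (fun p => p.1.id) = subs.map Sub.id := by
    conv_rhs => rw [← List.zipIdx_map_fst 0 subs]
    rw [List.map_map]
    rfl
  have hSz : (subs.zipIdx.map fun q => q.1.pts.length + 1).sum = S := by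
    rw [hS]
    conv_rhs => rw [← List.zipIdx_map_fst 0 subs]
    rw [List.map_map]
    rfl
  have hzl : subs.zipIdx.length = subs.length := by simp
  unfold candidateRows
  refine Within.spec (Within.bind (Spec.lengthR subs) fun s hsl => ?_)
  refine Within.bind (Spec.numberR subs) fun sn hsn => ?_
  subst hsn
  have key : ∀ p ∈ subs.zipIdx, Spec (do
      let later ← filterR (fun (q : Sub × ℕ) => charge 12 (
        decide (p.2 + 1 < q.2) && decide (q.2 + 1 < p.2 + s) &&
        (p.1.unit.isSome || q.1.unit.isSome) && !bad.get p.1.id q.1.id)) subs.zipIdx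
      let row ← mapR (fun (q : Sub × ℕ) => do
        let d ← distSubs p.1 q.1
        charge 3 (⟨d, p.1, q.1⟩ : Pair)) later
      closestFirst row : Run (List Pair)) (300 * S * (p.1.pts.length + 1) + (40 * n + 10))
      (fun row => row.length ≤ n ∧ (∀ x ∈ row, x.fst = p.1 ∧ x.snd ∈ subs ∧
        (subs.map Sub.id).idxOf p.1.id < (subs.map Sub.id).idxOf x.snd.id ∧
        bad.get p.1.id x.snd.id = false) ∧ (row.map fun x => x.snd.id).Nodup ∧
        (row.map Pair.weight).sum ≤ S * (p.1.pts.length + 1)) := by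
    intro p hp
    refine Within.spec (Within.bind (Spec.filterR_const (K := 12) (by simp)) fun later hlater => ?_)
    have hsub : later.Sublist subs.zipIdx := hlater ▸ List.filter_sublist
    have hll : later.length ≤ n := hsub.length_le.trans (by omega)
    have hls : (later.map fun q => q.1.pts.length + 1).sum ≤ S :=
      (sublist_sum_map_le hsub _).trans hSz.le
    refine Within.bind (Spec.mapR
      (c := fun q => 300 * (p.1.pts.length + 1) * (q.1.pts.length + 1) + 3) fun q _ => ?_)
      fun row hrow => ?_
    · have := distSubs_cost_le p.1 q.1
      simp only [bind_cost, charge_cost]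
      nlinarith
    have hrl : row.length = later.length := by simp [hrow]
    refine Within.last (closestFirst_spec row) ?_ fun r hr => ⟨?_, ?_, ?_, ?_⟩
    · rw [sum_map_add_const, sum_map_mul_const, hzl]
      have := Nat.mul_le_mul_left (300 * (p.1.pts.length + 1)) hls
      nlinarith
    · rw [hr.length_eq]; omega
    · intro x hx
      have hx' := hr.mem_iff.1 hx
      rw [hrow, List.mem_map] at hx'
      obtain ⟨q, hq, rfl⟩ := hx'
      have hqs := hsub.subset hq
      rw [hlater, List.mem_filter] at hq
      simp only [charge_val, Bool.and_eq_true, decide_eq_true_eq, Bool.not_eq_true'] at hq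
      refine ⟨rfl, hmem q hqs, ?_, hq.2.2⟩
      simp only [bind_val, charge_val]
      rw [hidx p hp, hidx q hqs]
      omega
    · refine (hr.map _).nodup_iff.2 ?_
      rw [hrow, List.map_map]
      have : (later.map fun q => q.1.id).Nodup :=
        (hfst ▸ hid : (subs.zipIdx.map fun q => q.1.id).Nodup).sublist (hsub.map _)
      exact this
    · rw [(hr.map Pair.weight).sum_eq, hrow, List.map_map]
      have : (later.map (Pair.weight ∘ fun a => (do
          let d ← distSubs p.1 a.1
          charge 3 (⟨d, p.1, a.1⟩ : Pair) : Run Pair).val)).sum =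
          (p.1.pts.length + 1) * (later.map fun q => q.1.pts.length + 1).sum := by
        rw [← sum_map_mul_const]; rfl
      rw [this, mul_comm]
      exact Nat.mul_le_mul_right _ hls
  refine Within.last (Spec.mapR fun p hp => (key p hp).1) ?_ fun rows hrows => ⟨⟨?_, ?_, ?_, ?_, ?_, ?_, ?_, ?_⟩, ?_⟩
  · rw [sum_map_add_const, sum_map_mul_const, hSz, hzl]
    have h1 : 300 * S * S ≤ 300 * (3 * n) * (3 * n) := by gcongr
    have h2 : (40 * n + 10) * subs.length ≤ (40 * n + 10) * n := by gcongr
    nlinarith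
  · simpa [hrows] using hlen
  all_goals subst hrows
  · simp only [List.mem_map]
    rintro _ ⟨p, hp, rfl⟩
    exact (key p hp).2.1
  · rw [List.pairwise_map]
    have : (subs.zipIdx.map fun p => p.1.id).Nodup := hfst ▸ hid
    rw [List.Nodup, List.pairwise_map] at this
    refine this.imp_of_mem fun {p p'} hp hp' hne x hx x' hx' => ?_
    rw [((key p hp).2.2.1 x hx).1, ((key p' hp').2.2.1 x' hx').1]
    exact hne
  · simp only [List.mem_map]
    rintro _ ⟨p, hp, rfl⟩ x hx x' hx'
    rw [((key p hp).2.2.1 x hx).1, ((key p hp).2.2.1 x' hx').1]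
  · simp only [List.mem_map]
    rintro _ ⟨p, hp, rfl⟩
    exact (key p hp).2.2.2.1
  · simp only [List.mem_map]
    rintro _ ⟨p, hp, rfl⟩ x hx
    obtain ⟨h1, -, h3, -⟩ := (key p hp).2.2.1 x hx
    rw [h1]; exact h3
  · simp only [List.mem_map]
    rintro _ ⟨p, hp, rfl⟩ x hx
    obtain ⟨h1, h2, -, -⟩ := (key p hp).2.2.1 x hx
    rw [h1]; exact ⟨hs.id_lt _ (hmem p hp), hs.id_lt _ h2⟩
  · simp only [List.mem_map]
    rintro _ ⟨p, hp, rfl⟩ x hx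
    obtain ⟨h1, -, -, h4⟩ := (key p hp).2.2.1 x hx
    rw [h1]; exact h4
  · rw [rowsWeight, List.map_map]
    refine (sum_map_le_sum (g := fun p => S * (p.1.pts.length + 1)) fun p hp =>
      (key p hp).2.2.2.2).trans ?_
    rw [sum_map_mul_const, hSz]
    nlinarith

/-- Remove the first pair of a row that belongs to `p`. -/
noncomputable def dropHead (p : Pair) (row : List Pair) : Run (List Pair) := match row with
  | q :: rest => if q.fst.id == p.fst.id then closestFirst rest else charge 2 row
  | [] => charge 1 []

/-- One pass of the search for a cut. -/
noncomputable def cutPass (t : Triang) (st : List (List Pair) × Option Cut × Table) :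
    Run ((List (List Pair) × Option Cut × Table) × Bool) := do
  let heads ← foldR (fun (hs : List Pair) (row : List Pair) => charge 2 (match row with
    | p :: _ => p :: hs
    | [] => hs)) [] st.1
  match ← argminR (fun (p : Pair) => charge 1 p.dist) heads with
  | none => charge 1 (st, false)
  | some (p, _) => do
    let c ← if p.fst.unit.isNone then tryExtend t p.snd p.fst
      else if p.snd.unit.isNone then tryExtend t p.fst p.snd
      else tryJoin t p.fst p.snd
    match c with
    | some c => charge 5 ((st.1, some c, st.2.2), false)
    | none => do
      let rows ← mapR (dropHead p) st.1
      charge 10 ((rows, none, st.2.2.mark p.fst.id p.snd.id), true)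

/-- Names the loop body, so that one pass can be analysed by itself. -/
theorem findCut_eq (t : Triang) (subs : List Sub) (bad : Table) : findCut t subs bad = (do
    let rows ← candidateRows subs bad
    let s ← lengthR subs
    let r ← whileR (cutPass t) (s * s + 1) (rows, none, bad)
    return r.2) := by
  unfold findCut
  refine congrArg _ (funext fun rows => congrArg _ (funext fun s => ?_))
  refine congrArg (fun b => (whileR b (s * s + 1) (rows, none, bad) >>= fun r => pure r.2)) ?_
  funext st
  unfold cutPass
  refine congrArg _ (funext fun heads => congrArg _ (funext fun o => ?_))
  cases o with
  | none => rfl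
  | some b =>
    obtain ⟨p, v⟩ := b
    have h : ∀ rows : List (List Pair), mapR (dropHead p) rows =
      mapR (fun (row : List Pair) => match row with
          | q :: rest => if q.fst.id == p.fst.id then closestFirst rest else charge 2 row
          | [] => charge 1 []) rows := fun rows => by
        congr 1
    simp only [h]

theorem dropHead_other {p : Pair} {row : List Pair} (h : ∀ q ∈ row, q.fst.id ≠ p.fst.id) :
    (dropHead p row).val = row ∧ (dropHead p row).cost ≤ 2 := by
  cases row with
  | nil => exact ⟨rfl, by simp [dropHead]⟩
  | cons q rest =>
    have : (q.fst.id == p.fst.id) = false := by simpa using h q (by simp)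
    simp [dropHead, this]

theorem dropHead_self (p : Pair) (rest : List Pair) :
    Spec (dropHead p (p :: rest)) (5 * rest.length + 1) (fun r => r.Perm rest) := by
  simpa [dropHead] using closestFirst_spec rest

/-- Only the row of a pair is affected by its removal. -/
theorem mapR_dropHead_spec {B n : ℕ} {pos : ℕ → ℕ} {bad : Table} {R R' : List (List Pair)}
    {p : Pair} {rest : List Pair} (h : Candidates B n pos bad (R ++ (p :: rest) :: R')) :
    Spec (mapR (dropHead p) (R ++ (p :: rest) :: R')) (9 * n + 3)
      (fun rows => ∃ r', rows = R ++ r' :: R' ∧ r'.Perm rest) := by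
  have hap := h.apart
  rw [List.pairwise_append, List.pairwise_cons] at hap
  have h₁ : ∀ r ∈ R, (dropHead p r).val = r ∧ (dropHead p r).cost ≤ 2 := fun r hr =>
    dropHead_other fun q hq => hap.2.2 r hr (p :: rest) (by simp) q hq p (by simp)
  have h₂ : ∀ r ∈ R', (dropHead p r).val = r ∧ (dropHead p r).cost ≤ 2 := fun r hr =>
    dropHead_other fun q hq => (hap.2.1.1 r hr p (by simp) q hq).symm
  have h₃ := dropHead_self p rest
  constructor
  · rw [mapR_cost]
    have e₁ := sum_map_le_mul fun r hr => (h₁ r hr).2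
    have e₂ := sum_map_le_mul fun r hr => (h₂ r hr).2
    have e₃ := h₃.1
    have e₄ := h.length_le
    have e₅ := h.row_le (p :: rest) (by simp)
    simp only [List.map_append, List.map_cons, List.sum_append, List.sum_cons, List.length_append,
      List.length_cons] at e₄ e₅ ⊢
    omega
  · refine ⟨(dropHead p (p :: rest)).val, ?_, h₃.2⟩
    rw [mapR_val, List.map_append, List.map_cons]
    congr 1
    · exact (List.map_congr_left fun r hr => (h₁ r hr).1).trans (List.map_id' R)
    · congr 1
      exact (List.map_congr_left fun r hr => (h₂ r hr).1).trans (List.map_id' R')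

/-- Invariant of the search for a cut. -/
structure CutState (B n : ℕ) (pos : ℕ → ℕ) (st : List (List Pair) × Option Cut × Table) :
    Prop where
  candidates : Candidates B n pos st.2.2 st.1
  weight_le : rowsWeight st.1 ≤ 9 * n ^ 2
  square : st.2.2.Square B
  short : ∀ c ∈ st.2.1, c.Short (2 * n + 4)

/-- Potential of the search for a cut. -/
def cutPotential (n : ℕ) (st : List (List Pair) × Option Cut × Table) : ℕ :=
  11000 * (n + 1) * st.2.2.unmarked + 100 * rowsWeight st.1

/-- A rejected pair is paid for twice over: the part proportional to its weight by its removal from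
the rows, and the linear part by the cell newly marked. The conditional term expresses that a pass
after which the loop goes on is fully paid for, control included, while the last pass may cost a
further `O(n ^ 2)`. -/
theorem cutPass_amortized {B n : ℕ} {pos : ℕ → ℕ} {t : Triang} (ht : t.Sized n)
    {st : List (List Pair) × Option Cut × Table} (h : CutState B n pos st) :
    Amortized 0 (cutPass t st)
      (fun r => cutPotential n r.1 + if r.2 then 12000 * (n + 1) ^ 2 + 1 else 0)
      (cutPotential n st + 12000 * (n + 1) ^ 2) (fun r => CutState B n pos r.1) := by
  obtain ⟨rows, c₀, bad⟩ := st
  have hlen := h.candidates.length_le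
  simp only at hlen
  unfold cutPass
  refine Amortized.bind (Spec.foldR_rest (fun (rest : List (List Pair)) (hs : List Pair) =>
    (∀ r ∈ rest, r ∈ rows) ∧ (∀ p ∈ hs, ∃ r, p :: r ∈ rows) ∧
      hs.length + rest.length ≤ rows.length) (fun _ => 2) (by simp) ?_) fun heads hheads => ?_
  · rintro row rest hs ⟨h1, h2, h3⟩
    simp only [List.length_cons] at h3
    refine Spec.charge ⟨fun r hr => h1 r (by simp [hr]), ?_⟩
    split
    · rename_i p r
      simp only [List.mem_cons, List.length_cons]
      refine ⟨?_, by omega⟩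
      rintro q (rfl | hq)
      · exact ⟨r, h1 _ (by simp)⟩
      · exact h2 q hq
    · exact ⟨h2, by omega⟩
  obtain ⟨-, hh, hhl⟩ := hheads
  simp only [List.length_nil, add_zero] at hhl
  refine Amortized.bind (Q := fun o => True ∧ ∀ b ∈ o, b.1 ∈ heads) (Spec.and (Spec.cost_le
    (argminR_cost_le (c := fun _ => 1) (by simp))) argminR_mem) fun o ho => ?_
  simp only [List.map_const', List.sum_replicate, smul_eq_mul]
  split
  · refine Amortized.charge ?_ h
    simp only [Bool.false_eq_true, if_false]
    nlinarith
  rename_i p v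
  obtain ⟨rest, hrest⟩ := hh p (ho.2 _ rfl)
  obtain ⟨R, R', hR⟩ := List.append_of_mem hrest
  subst hR
  have hpw : p.weight ≤ 9 * n ^ 2 := by
    have := h.weight_le
    simp only [rowsWeight_append, rowsWeight_cons, List.map_cons, List.sum_cons] at this
    omega
  refine Amortized.ite_ite_bind (k₁ := 100 * p.weight + 10000 * (n + 1))
    (Q := fun o => ∀ c ∈ o, c.Short (2 * n + 4)) ?_ fun c hc => ?_
  · refine Within.spec (Within.ite (fun _ => ?_) fun _ => Within.ite (fun _ => ?_) fun _ => ?_)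
    · refine Within.last (tryExtend_spec ht _ _) ?_ fun _ h => h
      rw [Pair.weight, mul_comm (p.fst.pts.length + 1)]
      omega
    · refine Within.last (tryExtend_spec ht _ _) ?_ fun _ h => h
      rw [Pair.weight]
      omega
    · exact Within.last (tryJoin_spec ht _ _) (by omega) fun _ h => h
  split
  · rename_i c
    refine Amortized.charge ?_ ⟨h.candidates, h.weight_le, h.square, hc⟩
    simp only [Bool.false_eq_true, if_false, cutPotential]
    nlinarith
  · refine Amortized.bind (mapR_dropHead_spec h.candidates) fun rows' hrows' => ?_
    obtain ⟨r', rfl, hr'⟩ := hrows'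
    have hid := h.candidates.id_lt (p :: rest) (by simp) p (by simp)
    have hun := Table.unmarked_mark_lt h.square hid.1 hid.2
      (h.candidates.unmarked (p :: rest) (by simp) p (by simp))
    have hw : rowsWeight (R ++ (p :: rest) :: R') = rowsWeight (R ++ r' :: R') + p.weight := by
      simp only [rowsWeight_append, rowsWeight_cons, List.map_cons, List.sum_cons,
        (hr'.map Pair.weight).sum_eq]
      omega
    refine Amortized.charge ?_ ⟨h.candidates.remove hr' h.square, ?_, h.square.mark _ _, by simp⟩
    · simp only [if_true, cutPotential] at hun ⊢
      rw [hw]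
      have := Nat.mul_le_mul_left (11000 * (n + 1)) hun
      nlinarith
    · have := h.weight_le
      simp only at this ⊢
      omega

/-- The rows are built anew at each call, so their weight belongs to the quadratic cost of the call.
Only the marks persist and serve as potential between calls; the fuel of the loop plays no role. -/
theorem findCut_amortized {B n : ℕ} {t : Triang} (ht : t.Sized n) {subs : List Sub}
    (hs : SubsBound B n subs) (hid : (subs.map Sub.id).Nodup) {bad : Table} (hB : bad.Square B) :
    Amortized 0 (findCut t subs bad) (fun r => 11000 * (n + 1) * r.2.unmarked)
      (11000 * (n + 1) * bad.unmarked + 20000 * (n + 1) ^ 2)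
      (fun r => r.2.Square B ∧ ∀ c ∈ r.1, c.Short (2 * n + 4)) := by
  rw [findCut_eq]
  refine Amortized.bind (candidateRows_spec hs hid bad) fun rows hrows => ?_
  refine Amortized.bind (Spec.lengthR subs) fun s _ => ?_
  obtain ⟨h1, h2⟩ := whileR_decreasing (body := cutPass t)
    (CutState B n fun i => (subs.map Sub.id).idxOf i) (cutPotential n) (12000 * (n + 1) ^ 2)
    (fun st hst => by
      obtain ⟨h1, h2⟩ := cutPass_amortized ht hst
      refine ⟨h2, fun e => ?_, fun e => ?_⟩
      · simp only [e, if_true] at h1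
        omega
      · simp only [e, Bool.false_eq_true, if_false] at h1
        omega) (s * s + 1) (rows, none, bad) ⟨hrows.1, hrows.2, hB, by simp⟩
  have := hs.length_le
  refine ⟨?_, h1.square, h1.short⟩
  simp only [bind_cost, bind_val, pure_cost, pure_val, cutPotential] at h2 ⊢
  nlinarith [hrows.2]

/-! ### Carrying out a cut -/

theorem repeatsR_spec (l : List ℕ) :
    Spec (repeatsR l) (3 * (l.length + 1) ^ 2) (fun b => b = false → l.Nodup) := by
  induction l with
  | nil => exact ⟨by simp [repeatsR], by simp⟩
  | cons a l ih =>
    simp only [repeatsR]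
    refine Within.spec (Within.bind (Q := fun b => b = decide (a ∈ l))
      ⟨memR_cost_le a l, memR_val a l⟩ fun b hb => ?_)
    refine Within.ite (fun _ => Within.charge (by simp; nlinarith) (by simp)) fun h => ?_
    refine Within.tick (Within.last ih (by simp; nlinarith) fun r hr e => ?_)
    simp only [hb, decide_eq_true_eq] at h
    exact List.nodup_cons.2 ⟨h, hr e⟩

theorem onlyUnit_cost_le (subs : List Sub) : (onlyUnit subs).cost ≤ 5 * subs.length + 10 := by
  unfold onlyUnit
  refine (Within.spec (Q := fun _ => True)
    (Within.bind (Spec.findR_const (K := 1) (by simp)) fun o _ => ?_)).1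
  split
  · exact Within.pure (by omega) trivial
  · refine Within.bind (Spec.anyR_const (K := 2) (by simp)) fun other _ => ?_
    exact Within.charge (by omega) trivial

theorem breakAt_spec (p : Pt) (acc l : List Pt) :
    Spec (breakAt p acc l) (6 * l.length + 6)
      (fun o => ∀ r ∈ o, r.1.length ≤ acc.length + l.length ∧ r.2.length ≤ l.length) := by
  induction l generalizing acc with
  | nil => exact ⟨by simp [breakAt], by simp [breakAt]⟩
  | cons q l ih =>
    simp only [breakAt]
    refine Within.spec (Within.ite (fun _ => ?_) fun _ => ?_)
    · refine Within.charge (by omega) ?_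
      simp only [Option.mem_def, Option.some.injEq]
      rintro _ rfl
      simp
    · refine Within.tick (Within.last (ih (q :: acc)) (by simp; omega) fun o ho r hr => ?_)
      have := ho r hr
      simp at this ⊢
      omega

theorem insertPoint_spec (p : Pt) (e : Seg) (path : List Pt) :
    Spec (insertPoint p e path) (20 * path.length + 20) (fun r => r.length ≤ 2 * path.length) := by
  unfold insertPoint
  refine Within.spec (Within.bind (Spec.mapR_const (K := 5) (by simp)) fun parts hparts => ?_)
  have h1 : parts.length = path.length := by simp [hparts]
  have h2 : parts.flatten.length ≤ 2 * path.length := by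
    rw [List.length_flatten, hparts, List.map_map]
    refine sum_map_le_mul fun q _ => ?_
    simp only [Function.comp, charge_val]
    split_ifs <;> simp
  exact Within.last (Spec.concatR parts) (by omega) fun r hr => by rw [hr]; exact h2

/-- A crossing splits the loop in at most two, and the crossing point can add one edge to each part.
The excess may thus rise from `l.length - 2` to `l.length`, but no further. -/
theorem meetPaths_spec {B k : ℕ} {l : Loop} (hl : GoodLoop B l) {β₁ β₂ : List Pt}
    (h₁ : β₁.length ≤ k) (h₂ : β₂.length ≤ k) :
    Spec (meetPaths l β₁ β₂) (100 * (k + 1) ^ 2 + 400 * (l.length + 1))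
      (fun r => Subdivision B l.length r.1 ∧ r.2.2.1.length ≤ 2 * k ∧ r.2.2.2.length ≤ 2 * k) := by
  have hl3 := hl.three_le
  have hsub : Subdivision B l.length [l] := ⟨hl.subdivision.good, by simp⟩
  have hk : (5 * k + 3) * k + 1 + ((41 * k + 4) * k + 1) + (2 * k + 1) + 2 * (k + 1) +
      2 * (20 * k + 20) + 40 ≤ 100 * (k + 1) ^ 2 := by nlinarith
  unfold meetPaths
  refine Within.spec (Within.bind (k₁ := (5 * k + 3) * k + 1) (Q := fun _ => True)
    (Spec.cost_le ?_) fun o _ => ?_)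
  · refine (Spec.findR_const (K := 5 * k + 2) fun p _ => ?_).1.trans ?_
    · exact (anyR_cost_le_const (K := 4) (by simp)).trans (by omega)
    · have := Nat.mul_le_mul_left (5 * k + 3) h₁
      linarith
  split
  · exact Within.charge (by omega) ⟨hsub, by simp only; omega, by simp only; omega⟩
  · refine Within.bind (pathEdges_spec β₁) fun es hes => ?_
    refine Within.bind (pathEdges_spec β₂) fun fs hfs => ?_
    refine Within.bind (k₁ := (41 * k + 4) * k + 1) (Q := fun r => r.length ≤ k) ?_
      fun pairs hpairs => ?_
    · refine ((Spec.mapR_const (K := 41 * k + 2) fun e _ => ?_).le ?_).imp fun r hr => ?_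
      · have := (Spec.findR_const (l := fs) (K := 40) (p := fun f => charge 40 (properCross e f))
          (by simp)).1
        simp only [bind_cost, charge_cost]
        omega
      · have := Nat.mul_le_mul_left (41 * k + 4) (hes.trans h₁)
        linarith
      · simp [hr]; omega
    refine Within.bind (Spec.findR_const (K := 1) (by simp)) fun o _ => ?_
    obtain _ | _ | ⟨e, f⟩ := o
    · exact Within.pure (by omega) ⟨hsub, by simp only; omega, by simp only; omega⟩
    · exact Within.pure (by omega) ⟨hsub, by simp only; omega, by simp only; omega⟩
    · refine Within.bind (Spec.charge (Q := fun _ => True) trivial) fun p _ => ?_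
      refine Within.bind (addChord_spec hl.subdivision e.1 e.2) fun ls hls => ?_
      refine Within.bind (addPoint_spec hls.1 e.1 e.2 p) fun ls' hls' => ?_
      refine Within.bind (insertPoint_spec p e β₁) fun γ₁ hγ₁ => ?_
      refine Within.bind (insertPoint_spec p f β₂) fun γ₂ hγ₂ => ?_
      have h2 : ls.length ≤ 2 := by simpa using hls.2
      refine Within.pure (by omega) ⟨⟨hls'.good, ?_⟩, by simp only; omega, by simp only; omega⟩
      have := hls'.excess_le
      simp only
      omega

theorem applyCut_spec {B n fresh : ℕ} {l : Loop} (hl : GoodLoop B l) (hn : l.length ≤ n)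
    (hf : fresh + 1 < B) {c : Cut} (hc : c.Short (2 * n + 4)) :
    Spec (applyCut l fresh c) (50000 * (n + 1) ^ 2) (Subdivision B l.length) := by
  have hl3 := hl.three_le
  have hsub : Subdivision B l.length [l] := ⟨hl.subdivision.good, by simp⟩
  cases c with
  | extend s path =>
    refine (cutPath_spec hsub path (by omega) s.unit).le ?_
    have : 260 * (l.length + 1) * (path.length + 1) ≤ 260 * (n + 1) * (2 * n + 5) :=
      Nat.mul_le_mul (Nat.mul_le_mul_left 260 (by omega)) (by have : path.length ≤ 2 * n + 4 := hc; omega)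
    nlinarith
  | join s s' β₁ β₂ =>
    unfold applyCut
    refine Within.spec (Within.bind (meetPaths_spec hl hc.1 hc.2) fun ⟨ls, p, γ₁, γ₂⟩ hr => ?_)
    obtain ⟨hls, hγ₁, hγ₂⟩ := hr
    simp only at hls hγ₁ hγ₂
    refine Within.bind (breakAt_spec p [] γ₁) fun o₁ ho₁ => ?_
    refine Within.bind (breakAt_spec p [] γ₂) fun o₂ ho₂ => ?_
    split
    · rename_i pa pc pb pd
      have e₁ := ho₁ _ rfl
      have e₂ := ho₂ _ rfl
      simp only [List.length_nil, zero_add] at e₁ e₂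
      refine Within.bind (Spec.reverseR _) fun ap hap => ?_
      refine Within.bind (Spec.appendR _ _) fun apb hapb => ?_
      refine Within.bind (Spec.reverseR _) fun cp hcp => ?_
      refine Within.bind (Spec.appendR _ _) fun cpd hcpd => ?_
      -- Two halves of paths with at most `2 * (2 * n + 4)` vertices each, after insertion of the
      -- crossing point.
      have f₁ : apb.length ≤ 8 * n + 16 := by simp [hapb, hap]; omega
      have f₂ : cpd.length ≤ 8 * n + 16 := by simp [hcpd, hcp]; omega
      have f₃ : ap.length = pa.length := by simp [hap]
      have f₄ : cp.length = pc.length := by simp [hcp]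
      refine Within.bind (cutPath_spec hls apb (by omega) _) fun ls' hls' => ?_
      refine Within.last (cutPath_spec hls' cpd hf _) ?_ fun _ h => h
      have g₁ : 260 * (l.length + 1) * (apb.length + 1) ≤ 260 * (n + 1) * (8 * n + 17) :=
        Nat.mul_le_mul (Nat.mul_le_mul_left 260 (by omega)) (by omega)
      have g₂ : 260 * (l.length + 1) * (cpd.length + 1) ≤ 260 * (n + 1) * (8 * n + 17) :=
        Nat.mul_le_mul (Nat.mul_le_mul_left 260 (by omega)) (by omega)
      nlinarith
    · refine Within.pure ?_ hsub
      nlinarith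

/-! ### Working on a gap -/

/-- Invariant of the work on a gap, with at most `fuel` steps to go. -/
structure GapInvariant (B W fuel : ℕ) (st : GapState) : Prop where
  good : ∀ l ∈ st.todo, GoodLoop B l
  square : st.bad.Square B
  fresh_le : st.fresh + 2 * fuel ≤ B
  weight_le : partWeight st.parts + 25 * excess st.todo + 50 * fuel ≤ W

/-- The common end of the branches that subdivide the gap, stated for an arbitrary subdivision. -/
theorem proceed_spec {B n : ℕ} {loops : List Loop} (h : Subdivision B n loops) (st : GapState) :
    Spec (do
      let (ps, gaps) ← sortLoops loops
      let ps ← appendR ps st.parts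
      let gaps ← appendR gaps st.todo
      return ({ st with parts := ps, todo := gaps }, true) : Run (GapState × Bool)) (60 * n + 30)
      (fun r => r.1.bad = st.bad ∧ r.1.fresh = st.fresh ∧
        (∀ l ∈ r.1.todo, GoodLoop B l ∨ l ∈ st.todo) ∧
        partWeight r.1.parts + 25 * excess r.1.todo ≤
          partWeight st.parts + 25 * excess st.todo + 25 * n) := by
  refine Within.spec (Within.bind (sortLoops_spec h) fun ⟨ps, gaps⟩ hr => ?_)
  obtain ⟨h1, h2, h3, h4⟩ := hr
  simp only at h1 h2 h3 h4
  refine Within.bind (Spec.appendR _ _) fun ps' hps' => ?_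
  refine Within.bind (Spec.appendR _ _) fun gaps' hgaps' => ?_
  subst hps' hgaps'
  refine Within.pure (by omega) ⟨rfl, rfl, ?_, ?_⟩
  · intro l hl
    rcases List.mem_append.1 hl with h' | h'
    exacts [Or.inl (h1 l h'), Or.inr h']
  · simp only [partWeight_append, excess_append]
    omega

/-- Apart from rejected pairs, a step is quadratic in the size of the loop, and the weight invariant
bounds that size by `L + 2`. Rejected pairs are charged to the table. Each step consumes two new
numbers and 50 units of weight at most, both reserved in the invariant for every remaining step. -/
theorem gapStep_amortized {B W L fuel : ℕ} {st : GapState} (h : GapInvariant B W (fuel + 1) st)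
    (hW : W ≤ 25 * L) :
    Amortized 0 (gapStep st) (fun r => 11000 * (L + 3) * r.1.bad.unmarked)
      (11000 * (L + 3) * st.bad.unmarked + 100000 * (L + 3) ^ 2)
      (fun r => GapInvariant B W fuel r.1) := by
  obtain ⟨todo, parts, bad, fresh⟩ := st
  obtain ⟨hgood, hsq, hfr, hwt⟩ := h
  simp only at hgood hsq hfr hwt
  unfold gapStep
  cases todo with
  | nil =>
    refine Amortized.charge ?_ ⟨hgood, hsq, by simp only; omega, by simp only; omega⟩
    simp only
    nlinarith
  | cons l todo =>
    simp only
    have hl := hgood l (by simp)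
    have hl3 := hl.three_le
    have hgood' : ∀ l ∈ todo, GoodLoop B l := fun l' h' => hgood l' (by simp [h'])
    simp only [excess_cons] at hwt
    have hlL : l.length ≤ L + 2 := by omega
    -- The polygons made from `l` may have total excess `l.length`, two more than `l` has; the 50
    -- units released by the step pay for this.
    have inv : ∀ st' : GapState, st'.bad.Square B → st'.fresh ≤ fresh + 2 →
        (∀ l' ∈ st'.todo, GoodLoop B l' ∨ l' ∈ todo) →
        partWeight st'.parts + 25 * excess st'.todo ≤
          partWeight parts + 25 * excess todo + 25 * l.length → GapInvariant B W fuel st' :=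
      fun st' h1 h2 h3 h4 => ⟨fun l' h' => (h3 l' h').elim id (hgood' l'), h1, by omega, by omega⟩
    refine Amortized.bind (subBoundaries_spec hl.sub_lt) fun ⟨subs, poly⟩ hsp => ?_
    obtain ⟨hsubs, hpoly⟩ := hsp
    simp only at hsubs hpoly
    have hsl := hsubs.length_le
    refine Amortized.bind (Spec.mapR_const (K := 1) (by simp)) fun ids hids => ?_
    have hids' : ids = subs.map Sub.id := by simpa using hids
    have hil : ids.length = subs.length := by simp [hids]
    refine Amortized.bind (repeatsR_spec ids) fun rep hrep => ?_
    refine Amortized.bind (Spec.cost_le (onlyUnit_cost_le subs)) fun only _ => ?_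
    refine Amortized.bind (Spec.anyR_const (K := 1) (by simp)) fun found _ => ?_
    refine Amortized.bind (triangulate_spec poly) fun t ht => ?_
    rw [hpoly] at ht ⊢
    -- The steps spent before the case distinction; they are replaced by one quadratic bound to keep
    -- the arithmetic of the branches small.
    set c₀ := 0 + (100 * List.length l + 100) + ((1 + 2) * subs.length + 1) +
      3 * (ids.length + 1) ^ 2 + (5 * subs.length + 10) + ((1 + 1) * subs.length + 2) +
      300 * (List.length l + 1) ^ 2 with hc₀
    have hc₀' : c₀ ≤ 500 * (L + 3) ^ 2 := by
      have e1 : (ids.length + 1) ^ 2 ≤ (L + 3) ^ 2 := Nat.pow_le_pow_left (by omega) 2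
      have e2 : (l.length + 1) ^ 2 ≤ (L + 3) ^ 2 := Nat.pow_le_pow_left (by omega) 2
      have e3 : L + 3 ≤ (L + 3) ^ 2 := by nlinarith
      rw [hc₀]
      linarith
    clear_value c₀
    generalize hD : 11000 * (L + 3) = D at *
    have hLsq : (l.length + 1) ^ 2 ≤ (L + 3) ^ 2 := Nat.pow_le_pow_left (by omega) 2
    have hL1 : L + 3 ≤ (L + 3) ^ 2 := by nlinarith
    refine Amortized.ite (fun _ => ?_) fun hrf => ?_
    · exact Amortized.charge (by simp only; omega) (inv _ hsq (by simp) (fun l' h' => Or.inr h')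
        (by simp))
    have hnodup : (subs.map Sub.id).Nodup := by
      rw [← hids']
      refine hrep ?_
      simp only [Bool.or_eq_true, not_or] at hrf
      simpa using hrf.1
    split
    · rename_i u
      refine Amortized.bind (loopEdges_spec l) fun es hes => ?_
      refine Amortized.charge (by simp only; omega) (inv _ hsq (by simp) (fun l' h' => Or.inr h') ?_)
      simp only [partWeight_cons]
      omega
    · rename_i s₁ s₂ hsub
      simp only at hsub
      subst hsub
      -- With just two sub-boundaries the bound for convexification is quadratic.
      refine Amortized.bind (convexify_spec hl hsubs ht) fun loops hloops => ?_
      refine Amortized.last (proceed_spec hloops ⟨todo, parts, bad, fresh⟩) fun r hr => ?_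
      obtain ⟨h1, h2, h3, h4⟩ := hr
      simp only at h1 h2 h3 h4
      refine ⟨?_, inv _ (h1 ▸ hsq) (by omega) h3 (by omega)⟩
      simp only [h1, List.length_cons, List.length_nil]
      linarith
    · rename_i s₀ s₁ s₂ hsub
      simp only at hsub
      subst hsub
      have hpts : s₀.pts.length + s₁.pts.length + s₂.pts.length ≤ 2 * l.length := by
        have := hsubs.sum_pts_le
        simp at this
        omega
      have ext : ∀ a b c : Sub, c.pts.length ≤ 2 * l.length → Amortized c₀ (do
          let loops ← fillExteriorThree l t a b c
          let (ps, gaps) ← sortLoops loops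
          let ps ← appendR ps parts
          let gaps ← appendR gaps todo
          return (({ todo := gaps, parts := ps, bad := bad, fresh := fresh } : GapState), true))
          (fun r => D * r.1.bad.unmarked) (D * bad.unmarked + 100000 * (L + 3) ^ 2)
          (fun r => GapInvariant B W fuel r.1) := by
        intro a b c hc
        refine Amortized.bind (fillExteriorThree_spec hl ht a b c) fun loops hloops => ?_
        refine Amortized.last (proceed_spec hloops ⟨todo, parts, bad, fresh⟩) fun r hr => ?_
        obtain ⟨h1, h2, h3, h4⟩ := hr
        simp only at h1 h2 h3 h4
        refine ⟨?_, inv _ (h1 ▸ hsq) (by omega) h3 (by omega)⟩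
        simp only [h1]
        omega
      refine Amortized.ite (fun _ => ext _ _ _ (by omega)) fun _ => ?_
      refine Amortized.ite (fun _ => ext _ _ _ (by omega)) fun _ => ?_
      refine Amortized.ite (fun _ => ext _ _ _ (by omega)) fun _ => ?_
      refine Amortized.bind (fillThree_spec s₀ s₁ s₂) fun ps hps => ?_
      refine Amortized.bind (Spec.appendR _ _) fun ps' hps' => ?_
      refine Amortized.charge (by simp only; omega) ⟨hgood', hsq, by simp only; omega, ?_⟩
      simp only [hps', partWeight_append]
      omega
    · refine Amortized.bind_amortized (findCut_amortized (ht.mono hlL) (hsubs.mono hlL) hnodup hsq)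
        fun ⟨c, bad'⟩ d hd hcb => ?_
      obtain ⟨hsq', hc⟩ := hcb
      simp only at hd hsq' hc
      rw [show L + 2 + 1 = L + 3 by omega, hD] at hd
      split
      · refine Amortized.charge (by simp only; omega) (inv _ hsq' (by simp)
          (fun l' h' => Or.inr h') (by simp))
      · rename_i c hcc
        refine Amortized.bind (applyCut_spec hl hlL (fresh := fresh) (by omega) (hc c hcc))
          fun loops hloops => ?_
        refine Amortized.last (proceed_spec hloops ⟨todo, parts, bad', fresh + 2⟩) fun r hr => ?_
        obtain ⟨h1, h2, h3, h4⟩ := hr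
        simp only at h1 h2 h3 h4
        refine ⟨?_, inv _ (h1 ▸ hsq') (by omega) h3 (by omega)⟩
        simp only [h1]
        rw [show L + 2 + 1 = L + 3 by omega]
        omega

/-! ### Closing all gaps -/

theorem GoodLoop.mono {B B' : ℕ} {l : Loop} (h : GoodLoop B l) (hB : B ≤ B') : GoodLoop B' l :=
  ⟨h.three_le, h.nodup, h.chain, fun e he => (h.sub_lt e he).trans_le hB⟩

theorem SubsBound.mono_id {B B' n : ℕ} {subs : List Sub} (h : SubsBound B n subs) (hB : B ≤ B') :
    SubsBound B' n subs :=
  ⟨h.length_le, h.sum_pts_le, fun s hs => (h.id_lt s hs).trans_le hB⟩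

theorem count_false_replicate_le (n : ℕ) (w : ℕ) :
    (⟨w, Array.replicate n false⟩ : Table).unmarked = n := by
  simp [Table.unmarked]

/-- The edges of a simple polygon, with labels. -/
def IsRing (es : List Seg) : Prop :=
  ∃ p : Poly, p.Nodup ∧ 3 ≤ p.length ∧ es = p.zip (p.rotate 1)

theorem IsRing.map_fst {p : Poly} : (p.zip (p.rotate 1)).map Prod.fst = p :=
  List.map_fst_zip (by simp)

theorem IsRing.map_snd {p : Poly} : (p.zip (p.rotate 1)).map Prod.snd = p.rotate 1 :=
  List.map_snd_zip (by simp)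

/-- Cutting into cyclic runs only rotates the ring, so distinctness of the vertices and the chain
condition survive. The labels are numbers of non-empty runs and hence below the number of edges. -/
theorem goodLoop_of_runs {es : List (Seg × Option ℕ)} (hes : IsRing (es.map Prod.fst))
    {runs : List (List (Seg × Option ℕ))} {k : ℕ} (hk : runs.flatten = es.rotate k)
    (hne : ∀ g ∈ runs, g ≠ []) :
    GoodLoop es.length ((runs.zipIdx.map fun g => g.1.map fun e =>
      (⟨e.1.1, e.1.2, g.2, e.2, false⟩ : GapEdge)).flatten) := by
  obtain ⟨p, hp, h3, he⟩ := hes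
  have hlen : es.length = p.length := by
    have := congrArg List.length he
    simpa using this
  -- Whatever is read off an edge irrespective of its label is rotated along with the ring; used for
  -- initial and for terminal points.
  have key : ∀ {γ : Type} (φ : Seg → γ) (ψ : GapEdge → γ)
      (_ : ∀ (e : Seg × Option ℕ) (i : ℕ), ψ ⟨e.1.1, e.1.2, i, e.2, false⟩ = φ e.1),
      ((runs.zipIdx.map fun g => g.1.map fun e =>
        (⟨e.1.1, e.1.2, g.2, e.2, false⟩ : GapEdge)).flatten).map ψ =
        ((es.map Prod.fst).map φ).rotate k := by
    intro γ φ ψ h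
    rw [List.map_map, ← List.map_rotate, ← hk]
    conv_rhs => rw [← List.zipIdx_map_fst 0 runs]
    rw [List.map_flatten, List.map_flatten, List.map_map, List.map_map]
    congr 1
    refine List.map_congr_left fun g _ => ?_
    simp only [Function.comp, List.map_map]
    exact List.map_congr_left fun e _ => h e g.2
  have ka := key Prod.fst GapEdge.a fun _ _ => rfl
  have kb := key Prod.snd GapEdge.b fun _ _ => rfl
  rw [he, IsRing.map_fst] at ka
  rw [he, IsRing.map_snd] at kb
  have hll := congrArg List.length ka
  simp only [List.length_map, List.length_rotate] at hll
  refine ⟨by rw [hll]; exact h3, ?_, ?_, ?_⟩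
  · rw [ka]; exact List.nodup_rotate.2 hp
  · rw [ka, kb, List.rotate_rotate, List.rotate_rotate, add_comm]
  · intro e he'
    simp only [List.mem_flatten, List.mem_map] at he'
    obtain ⟨_, ⟨g, hg, rfl⟩, he''⟩ := he'
    obtain ⟨x, _, rfl⟩ := List.mem_map.1 he''
    have h1 : g.2 < runs.length := by
      have := List.snd_lt_of_mem_zipIdx hg
      simpa using this
    have h2 := length_flatten_le hne
    rw [hk, List.length_rotate] at h2
    exact h1.trans_le h2

/-- The cubic terms: convexification, the table with `B * B` cells at linear potential each, and `4
* n + 4` steps of quadratic cost. Isolated as pure arithmetic. -/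
theorem gapCost_le {n B s : ℕ} (hs : s ≤ n) (hB : B ≤ 9 * n + 8) :
    3000 * (n + 1) ^ 2 * (s + 1) + B * B + 11000 * (9 * n + 8 + 3) * (B * B) +
      (100000 * (9 * n + 8 + 3) ^ 2 + 1) * (4 * n + 4) ≤ 90000000 * (n + 1) ^ 3 := by
  have h1 : 3000 * (n + 1) ^ 2 * (s + 1) ≤ 3000 * (n + 1) ^ 2 * (n + 1) :=
    Nat.mul_le_mul_left _ (by omega)
  have h2 : B * B ≤ (11 * (n + 1)) * (11 * (n + 1)) := Nat.mul_le_mul (by omega) (by omega)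
  have h3 : 11000 * (9 * n + 8 + 3) * (B * B) ≤
      11000 * (11 * (n + 1)) * ((11 * (n + 1)) * (11 * (n + 1))) :=
    Nat.mul_le_mul (Nat.mul_le_mul_left _ (by omega)) h2
  have h4 : (100000 * (9 * n + 8 + 3) ^ 2 + 1) * (4 * n + 4) ≤
      (100000 * (11 * (n + 1)) ^ 2 + 1) * (4 * n + 4) := by gcongr; omega
  have h5 : (n + 1) ^ 2 ≤ (n + 1) ^ 3 := Nat.pow_le_pow_right (by omega) (by omega)
  have h6 : n + 1 ≤ (n + 1) ^ 3 := Nat.le_self_pow (by omega) _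
  have e1 : 3000 * (n + 1) ^ 2 * (n + 1) = 3000 * (n + 1) ^ 3 := by ring
  have e2 : (11 * (n + 1)) * (11 * (n + 1)) = 121 * (n + 1) ^ 2 := by ring
  have e3 : 11000 * (11 * (n + 1)) * (121 * (n + 1) ^ 2) = 14641000 * (n + 1) ^ 3 := by ring
  have e4 : (100000 * (11 * (n + 1)) ^ 2 + 1) * (4 * n + 4) =
    48400000 * (n + 1) ^ 3 + 4 * (n + 1) := by ring
  rw [e2] at h2 h3
  rw [e3] at h3
  rw [e4] at h4
  rw [e1] at h1
  linarith only [h1, h2, h3, h4, h5, h6]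

/-- The initial potential is linear times the number of cells, and linearly many steps get a
quadratic allowance each. The number of steps is bounded by the fuel, so it does not matter here
whether the gap is exhausted. -/
theorem closeGap_spec {es : List (Seg × Option ℕ)} (hes : IsRing (es.map Prod.fst)) :
    Spec (closeGap es) (100000000 * (es.length + 1) ^ 3)
      (fun ps => partWeight ps ≤ 500 * (es.length + 1)) := by
  have h3 : 3 ≤ es.length := by
    obtain ⟨p, hp, h3, he⟩ := hes
    have := congrArg List.length he
    simp at this
    omega
  set n := es.length with hn
  have hn2 : n + 1 ≤ (n + 1) ^ 3 := by nlinarith [sq_nonneg n]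
  have hn3 : (n + 1) ^ 2 ≤ (n + 1) ^ 3 := Nat.pow_le_pow_right (by omega) (by omega)
  unfold closeGap
  refine Within.spec (Within.bind (Spec.lengthR es) fun n' hn' => ?_)
  rw [← hn] at hn' ⊢
  refine Within.bind (runsR_spec _ es) fun runs hruns => ?_
  obtain ⟨⟨k, hk⟩, hne⟩ := hruns
  have hgood := goodLoop_of_runs hes hk hne
  have hfl : runs.flatten.length = n := by simp [hk, hn]
  have hrl := length_flatten_le hne
  have hsum : (runs.map List.length).sum = n := by rw [← hfl, List.length_flatten]
  refine Within.bind (Spec.numberR runs) fun runsN hrunsN => ?_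
  have hsumN : (runsN.map fun g => g.1.length).sum = n := by
    rw [← hsum]
    conv_rhs => rw [← List.zipIdx_map_fst 0 runs]
    rw [hrunsN, List.map_map]
    rfl
  have hNl : runsN.length = runs.length := by simp [hrunsN]
  refine Within.bind (Spec.mapR (c := fun g => 7 * g.1.length + 1) fun g _ =>
    (Spec.mapR_const (K := 5) (by simp)).1) fun ls hls => ?_
  rw [sum_map_add_const, sum_map_mul_const, hsumN]
  have hls' : ls.flatten = (runs.zipIdx.map fun g => g.1.map fun e =>
      (⟨e.1.1, e.1.2, g.2, e.2, false⟩ : GapEdge)).flatten := by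
    simp [hls, hrunsN, mapR_val]
  have hlsl : ls.length = runs.length := by simp [hls, hNl]
  refine Within.bind (Spec.concatR ls) fun l hl => ?_
  rw [← hl] at hls'
  rw [← hls', ← hn] at hgood
  have hll : l.length = n := by
    rw [hl, List.length_flatten, hls, List.map_map, ← hsumN]
    congr 1
    refine List.map_congr_left fun g _ => ?_
    simp [mapR_val]
  rw [← hl, hll]
  refine Within.bind (subBoundaries_spec hgood.sub_lt) fun ⟨subs, poly⟩ hsp => ?_
  obtain ⟨hsubs, hpoly⟩ := hsp
  simp only at hsubs hpoly
  rw [hll] at hsubs hpoly ⊢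
  have hsl := hsubs.length_le
  refine Within.bind (Spec.lengthR subs) fun s hs => ?_
  subst hs hn'
  refine Within.bind (Spec.cost_le (onlyUnit_cost_le subs)) fun o _ => ?_
  split
  · refine Within.bind (loopEdges_spec l) fun es' hes' => Within.pure ?_ ?_
    · rw [hll]; linarith
    · simp; omega
  · refine Within.bind (triangulate_spec poly) fun t ht => ?_
    rw [hpoly] at ht ⊢
    -- The width of the table exceeds the original numbers, which are below `n`, and leaves room for
    -- two new numbers per step.
    have hB : n ≤ subs.length + 2 * (4 * n + 4) := by omega
    generalize hBe : subs.length + 2 * (4 * n + 4) = B at *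
    have hgB := hgood.mono hB
    refine Within.bind (convexify_spec hgB (hsubs.mono_id hB) (hll ▸ ht)) fun loops hloops => ?_
    rw [hll] at hloops ⊢
    refine Within.bind (sortLoops_spec hloops) fun ⟨ps, gaps⟩ hsort => ?_
    obtain ⟨h1, h2, h5, h6⟩ := hsort
    simp only at h1 h2 h5 h6
    refine Within.bind (Spec.allocR _ _) fun cells hcells => ?_
    rw [hBe] at hcells ⊢
    -- The initial subdivision has excess at most `n - 2`, at 25 units each, and 50 units are set
    -- aside for every step.
    set W := 25 * (n - 2) + 50 * (4 * n + 4) with hW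
    refine Within.bind (Spec.whileR_amortized (fun m st => GapInvariant B W m st)
      (fun st => 11000 * (9 * n + 8 + 3) * st.bad.unmarked) (100000 * (9 * n + 8 + 3) ^ 2)
      ⟨h1, ⟨rfl, by simp [hcells]⟩, by simp only; omega, by simp only; omega⟩ fun m st hst => ?_)
      fun r hr => ?_
    -- The weight budget is at most `225 * n + 200`, so `L = 9 * n + 8` bounds the excess of a
    -- remaining loop throughout.
    · obtain ⟨h7, h8⟩ := gapStep_amortized hst (L := 9 * n + 8) (by omega)
      exact ⟨h8, by simp only at h7 ⊢; generalize 11000 * (9 * n + 8 + 3) * (gapStep st).val.1.bad.unmarked = z at *; omega⟩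
    · obtain ⟨m, hm⟩ := hr
      refine Within.pure ?_ ?_
      · subst hcells
        rw [count_false_replicate_le]
        have hB9 : B ≤ 9 * n + 8 := by omega
        have h4 := gapCost_le hsl hB9
        clear_value W
        linarith only [h4, hn2, hn3, hn, hrl, hfl, hNl, hlsl, hsl, Nat.sub_le n 2]
      · have := hm.weight_le
        omega

/-- Bounds for a list of pieces: number, total number of edges, number of owners; the simply connected
ones are bounded by simple polygons. -/
structure PiecesBound (N M : ℕ) (ps : List Piece) : Prop where
  length_le : ps.length ≤ M
  sum_edges_le : (ps.map fun q => q.edges.length).sum ≤ M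
  owners_le : ∀ q ∈ ps, q.owners.length ≤ N
  ring : ∀ q ∈ ps, q.simple = true → IsRing q.edges

theorem partWeight_flatten_le {pss : List (List Part)} {c : ℕ}
    (h : (pss.map partWeight).sum ≤ c) : partWeight pss.flatten ≤ c := by
  unfold partWeight
  rw [sum_map_flatten]
  exact h

/-- Finding the neighbours of the edges is quadratic in `M` altogether. Closing is cubic in each
gap, and the sizes of the gaps sum to at most `2 * M`. Only simply connected pieces are treated, and
these are bounded by rings. -/
theorem closeGaps_spec {N M : ℕ} {ps : List Piece} (h : PiecesBound N M ps) :
    Spec (closeGaps ps) (2000000000 * (M + 1) ^ 3) (fun parts => partWeight parts ≤ 1000 * M) := by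
  have hlen := h.length_le
  have hsum := h.sum_edges_le
  unfold closeGaps
  refine Within.spec (Within.bind (Spec.filterR_const (K := 2) (by simp)) fun gaps hgaps => ?_)
  have hsub : gaps.Sublist ps := hgaps ▸ List.filter_sublist
  have hgl : gaps.length ≤ M := hsub.length_le.trans hlen
  have hgs : (gaps.map fun q => q.edges.length + 1).sum ≤ 2 * M := by
    have := sublist_sum_map_le hsub fun q => q.edges.length
    rw [sum_map_add_const]
    omega
  have key : ∀ q ∈ gaps, Spec (do
      let es ← mapR (fun (e : Seg) => do
        let nb ← findR (fun (q' : Piece) =>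
          if q'.unit.isSome && q'.region == q.region then touchR [e] q'.edges
          else charge 2 false) ps
        charge 2 (e, nb.bind Piece.unit)) q.edges
      closeGap es : Run (List Part))
      ((20 * M + 10) * (q.edges.length + 1) + 100000000 * (q.edges.length + 1) ^ 3)
      (fun parts => partWeight parts ≤ 500 * (q.edges.length + 1)) := by
    intro q hq
    have hring : IsRing q.edges := by
      refine h.ring q (hsub.subset hq) ?_
      rw [hgaps, List.mem_filter] at hq
      simp only [charge_val, Bool.and_eq_true] at hq
      exact hq.2.2
    refine Within.spec (Within.bind (Spec.mapR_const (K := 20 * M + 5) fun e _ => ?_)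
      fun es hes => ?_)
    · have := (Spec.findR (l := ps) (c := fun q' => 11 * q'.edges.length + 5)
        (p := fun (q' : Piece) =>
          if q'.unit.isSome && q'.region == q.region then touchR [e] q'.edges
          else charge 2 false) fun q' _ => by
            have := touchR_cost_le [e] q'.edges
            split_ifs
            · simp at this; omega
            · simp only [charge_cost]; omega).1
      rw [sum_map_add_const, sum_map_mul_const] at this
      simp only [bind_cost, charge_cost]
      omega
    · have hel : es.length = q.edges.length := by simp [hes]
      have hes' : es.map Prod.fst = q.edges := by
        rw [hes, List.map_map]
        exact (List.map_congr_left fun _ _ => rfl).trans (List.map_id' _)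
      have := closeGap_spec (es := es) (by rw [hes']; exact hring)
      rw [hel] at this
      exact Within.last this (by nlinarith) fun _ h => h
  refine Within.bind (Spec.mapR fun q hq => (key q hq).1) fun parts hparts => ?_
  have hw : (parts.map partWeight).sum ≤ 1000 * M := by
    rw [hparts, List.map_map]
    refine (sum_map_le_sum (g := fun q => 500 * (q.edges.length + 1)) fun q hq =>
      (key q hq).2).trans ?_
    rw [sum_map_mul_const]
    omega
  have hw' := partWeight_flatten_le hw
  have hpl : parts.length = gaps.length := by simp [hparts]
  refine Within.last (Spec.concatR parts) ?_ fun r hr => by rw [hr]; exact hw'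
  have h1 := length_le_partWeight parts.flatten
  -- The passage from the sum of cubes to the cube of the sum.
  have h2 := sum_map_pow_three_le gaps fun q => q.edges.length + 1
  have h3 : (gaps.map fun q => q.edges.length + 1).sum ^ 3 ≤ (2 * M) ^ 3 := Nat.pow_le_pow_left hgs 3
  have h4 := Nat.mul_le_mul_left (20 * M + 10) hgs
  rw [sum_map_add, sum_map_mul_const, sum_map_mul_const, hpl]
  nlinarith [sq_nonneg M, pow_nonneg (Nat.zero_le M) 3]

/-! ### Refined tiling -/

theorem length_hits_le (s t : Seg) : (hits s t).length ≤ 2 := by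
  unfold hits
  simp only
  split_ifs <;> simp

theorem insertNewR_spec (t : ℝ) (l : List ℝ) :
    Spec (insertNewR t l) (3 * l.length + 1) (fun r => r.length ≤ l.length + 1) := by
  induction l with
  | nil => exact ⟨by simp [insertNewR], by simp [insertNewR]⟩
  | cons b l ih =>
    simp only [insertNewR]
    split_ifs
    · exact ⟨by simp; omega, by simp⟩
    · exact ⟨by simp; omega, by simp⟩
    · refine (ih.bind (k₂ := 3) fun r hr => Spec.charge ?_).le (by simp; omega)
      simpa using hr

/-- Starting from the parameters 0 and 1, each segment contributes at most two more; sorted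
insertion makes the cost quadratic. -/
theorem nodeSeg_spec (all : List Seg) (s : Seg) :
    Spec (nodeSeg all s) (150 * (all.length + 1) ^ 2)
      (fun r => r.length ≤ 2 * (all.length + 1)) := by
  unfold nodeSeg
  refine Within.spec (Within.bind (Spec.foldR_rest
    (fun rest ts => ts.length + 2 * rest.length ≤ 2 * (all.length + 1))
    (fun _ => 80 + ((6 * (all.length + 1) + 2) * 2 + 1)) (by simp; omega)
    fun t rest ts hts => ?_) fun ts hts => ?_)
  · simp only [List.length_cons] at hts
    refine Within.spec (Within.tick (Within.last (Spec.foldR_rest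
      (fun hs ts => ts.length + 2 * rest.length + hs.length ≤ 2 * (all.length + 1))
      (fun _ => 6 * (all.length + 1) + 1) ?_ fun h hs ts hts => ?_) ?_ fun r hr => ?_))
    · have := length_hits_le s t
      omega
    · simp only [List.length_cons] at hts
      obtain ⟨h1, h2⟩ := insertNewR_spec h ts
      exact ⟨by omega, by omega⟩
    · have := length_hits_le s t
      simp only [List.map_const', List.sum_replicate, smul_eq_mul]
      nlinarith
    · simpa using hr
  · simp only [List.map_const', List.sum_replicate, smul_eq_mul]
    simp only [List.length_nil] at hts
    refine Within.bind (Spec.mapR_const (K := 8) (by simp)) fun ps hps => ?_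
    have hl : ps.length = ts.length := by simp [hps]
    refine Within.last (Spec.zipR ps ps.tail) ?_ fun r hr => ?_
    · rw [hl]
      nlinarith
    · subst hr
      simp
      omega

theorem edgeCount_eq (T : List Poly) : edgeCount T = (T.map List.length).sum := rfl

theorem edgeCount_append (T T' : List Poly) : edgeCount (T ++ T') = edgeCount T + edgeCount T' := by
  simp [edgeCount]

theorem length_le_edgeCount {T : List Poly} (h : ∀ P ∈ T, 3 ≤ P.length) : T.length ≤ edgeCount T :=
  length_le_sum_map fun P hP => by have := h P hP; omega

theorem length_ringEdges (p : Poly) : (ringEdges p).val.length = p.length := by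
  rw [(ringEdges_spec p).2]
  simp

theorem mapR_ringEdges_spec (T : List Poly) :
    Spec (mapR ringEdges T) (2 * edgeCount T + 4 * T.length + 1)
      (fun r => r.length = T.length ∧ (r.map List.length).sum = edgeCount T) := by
  have := Spec.mapR (l := T) fun p _ => (ringEdges_spec p).1
  refine ⟨this.1.trans ?_, ?_⟩
  · rw [sum_map_add_const, sum_map_mul_const, edgeCount_eq]
    omega
  · rw [this.2]
    simp [Function.comp_def, length_ringEdges, edgeCount]

/-- There are `O(E ^ 2)` cut segments, and removing duplicates compares them pairwise, whence the
fourth power. -/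
theorem nodedUnion_spec {T : List Poly} (h : T.length ≤ edgeCount T) :
    Spec (nodedUnion T) (1000 * (edgeCount T + 1) ^ 4)
      (fun segs => segs.length ≤ 2 * (edgeCount T + 1) ^ 2) := by
  unfold nodedUnion
  refine Within.spec (Within.bind (mapR_ringEdges_spec T) fun rings hrings => ?_)
  obtain ⟨hr1, hr2⟩ := hrings
  generalize edgeCount T = E at *
  refine Within.bind (Spec.concatR rings) fun all hall => ?_
  have hal : all.length = E := by rw [hall, List.length_flatten, hr2]
  rw [← hall, hal, hr1]
  refine Within.bind (Spec.filterR_const (K := 4) (by simp)) fun es hes => ?_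
  have hel : es.length ≤ E := by
    rw [← hal, hes]
    exact List.length_filter_le _ _
  refine Within.bind (Spec.mapR_const (K := 150 * (es.length + 1) ^ 2) fun s _ =>
    (nodeSeg_spec es s).1) fun cut hcut => ?_
  refine Within.bind (Spec.concatR cut) fun cut' hcut' => ?_
  have hcl : cut.length = es.length := by simp [hcut]
  have hcl' : cut'.length ≤ 2 * (es.length + 1) * es.length := by
    rw [hcut', List.length_flatten, hcut, List.map_map]
    exact sum_map_le_mul fun s _ => (nodeSeg_spec es s).2
  rw [← hcut', hcl, hal]
  have hE1 : (es.length + 1) ^ 2 ≤ (E + 1) ^ 2 := Nat.pow_le_pow_left (by omega) 2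
  have hE2 : 2 * (es.length + 1) * es.length ≤ 2 * (E + 1) * E :=
    Nat.mul_le_mul (by omega) hel
  have hE3 : 150 * (es.length + 1) ^ 2 * es.length ≤ 150 * (E + 1) ^ 2 * E :=
    Nat.mul_le_mul (by omega) hel
  have hM : cut'.length ≤ 2 * (E + 1) ^ 2 := by nlinarith
  refine Within.last (Spec.foldR_rest
    (fun rest acc => acc.length + rest.length ≤ 2 * (E + 1) ^ 2)
    (fun _ => 11 * (2 * (E + 1) ^ 2) + 4) (by simpa using hM) fun e rest acc hacc => ?_) ?_ fun r hr => by
      simpa using hr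
  · simp only [List.length_cons] at hacc
    refine Within.spec (Within.bind (Spec.anyR_const (K := 10) (by simp)) fun old _ =>
      Within.charge (by omega) ?_)
    split_ifs
    · omega
    · simp only [List.length_cons]; omega
  · simp only [List.map_const', List.sum_replicate, smul_eq_mul]
    have h4 : cut'.length * (11 * (2 * (E + 1) ^ 2) + 4) ≤
      2 * (E + 1) ^ 2 * (11 * (2 * (E + 1) ^ 2) + 4) := Nat.mul_le_mul_right _ hM
    have e4 : 2 * (E + 1) ^ 2 * (11 * (2 * (E + 1) ^ 2) + 4) = 44 * (E + 1) ^ 4 + 8 * (E + 1) ^ 2 := by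
      ring
    have e5 : (150 * (es.length + 1) ^ 2 + 2) * es.length =
      150 * (es.length + 1) ^ 2 * es.length + 2 * es.length := by ring
    rw [e4] at h4
    rw [e5]
    have e6 : 150 * (E + 1) ^ 2 * E + 150 * (E + 1) ^ 2 = 150 * (E + 1) ^ 3 := by ring
    have p1 : E + 1 ≤ (E + 1) ^ 4 := Nat.le_self_pow (by omega) _
    have p2 : (E + 1) ^ 2 ≤ (E + 1) ^ 4 := Nat.pow_le_pow_right (by omega) (by omega)
    have p3 : (E + 1) ^ 3 ≤ (E + 1) ^ 4 := Nat.pow_le_pow_right (by omega) (by omega)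
    linarith

/-! ### Faces of the noded complex. -/

theorem popTo_spec (v : Pt) (acc st : List Pt) :
    Spec (popTo v acc st) (5 * st.length + 5) (fun r =>
      match r with
      | none => v ∉ st
      | some (c, st') => ∃ above below, st = above ++ v :: below ∧
          c = v :: (above.reverse ++ acc) ∧ st' = v :: below) := by
  induction st generalizing acc with
  | nil => exact ⟨by simp [popTo], by simp [popTo]⟩
  | cons w st ih =>
    unfold popTo
    split_ifs with hvw
    · rw [same_iff] at hvw
      subst hvw
      exact ⟨by simp, [], st, by simp⟩
    · rw [same_iff] at hvw
      refine Within.spec (Within.tick (Within.last (ih (w :: acc)) (by simp; omega) fun r hr => ?_))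
      match r, hr with
      | none, hr => simp [hvw, hr]
      | some (c, st'), hr =>
        obtain ⟨above, below, h1, h2, h3⟩ := hr
        exact ⟨w :: above, below, by simp [h1], by simp [h2], h3⟩

/-- Every vertex of the walk is at any time on the stack, in a finished cycle or still to come, so
total length is conserved. The stack never contains a repetition, and a cycle is cut off a piece of
it; this is why rings have distinct vertices. -/
theorem splitWalk_spec (walk : List Pt) :
    Spec (splitWalk walk) (30 * (walk.length + 1) ^ 2)
      (fun r => (r.map List.length).sum ≤ walk.length ∧
        ∀ c ∈ r, c.Nodup ∧ 3 ≤ c.length) := by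
  unfold splitWalk
  refine Within.spec (Within.bind (Spec.foldR_rest
    (fun rest s => s.1.length + (s.2.map List.length).sum + rest.length = walk.length ∧ s.1.Nodup ∧
      s.2.length + rest.length ≤ walk.length ∧ ∀ c ∈ s.2, c.Nodup)
    (fun _ => 5 * walk.length + 9) ⟨by simp, by simp, by simp, by simp⟩
    fun v rest s hs => ?_) fun r hr => ?_)
  · obtain ⟨h1, h2, h3, h4⟩ := hs
    simp only [List.length_cons] at h1 h3
    refine Within.spec (Within.bind (popTo_spec v [] s.1) fun p hp => Within.charge (by omega) ?_)
    match p, hp with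
    | none, hp =>
      exact ⟨by simp; omega, by simp [h2, hp], by simp only; omega, h4⟩
    | some (c, st'), hp =>
      obtain ⟨above, below, e1, e2, e3⟩ := hp
      rw [e1] at h1 h2
      have h5 : (v :: above.reverse).Nodup := by
        have := List.nodup_middle.1 h2
        rw [List.nodup_cons] at this ⊢
        simp only [List.mem_append, not_or, List.mem_reverse, List.nodup_reverse] at this ⊢
        exact ⟨this.1.1, (List.nodup_append.1 this.2).1⟩
      simp only [List.length_append, List.length_cons] at h1
      refine ⟨?_, ?_, ?_, ?_⟩
      · subst e2 e3; simp; omega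
      · subst e3; exact (List.nodup_append.1 h2).2.1
      · simp; omega
      · subst e2
        simp only [List.append_nil, List.mem_cons]
        rintro c (rfl | hc)
        · exact h5
        · exact h4 c hc
  · obtain ⟨h1, h2, h3, h4⟩ := hr
    simp only [List.length_nil] at h1 h3
    refine Within.bind (Spec.reverseR r.1) fun last hlast => ?_
    refine Within.last (Spec.filterR (c := fun c => c.length + 2) (by simp [lengthR])) ?_ fun r' hr' => ?_
    · simp only [List.map_const', List.sum_replicate, smul_eq_mul, List.map_cons, List.sum_cons,
        sum_map_add_const, List.length_cons, hlast, List.length_reverse]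
      have e : 30 * (walk.length + 1) ^ 2 =
        walk.length * (5 * walk.length + 9) + 25 * walk.length ^ 2 + 51 * walk.length + 30 := by ring
      rw [e]
      omega
    · subst hr'
      constructor
      · refine (sum_map_filter_le _ _ _).trans ?_
        simp [hlast]
        omega
      · intro c hc
        rw [List.mem_filter] at hc
        simp only [lengthR, bind_val, charge_val] at hc
        refine ⟨?_, of_decide_eq_true hc.2⟩
        rcases List.mem_cons.1 hc.1 with rfl | h
        · rw [hlast, List.nodup_reverse]; exact h2
        · exact h4 c h

theorem count_false_set_lt {vis : Array Bool} {i : ℕ} (h : vis.getD i true = false) :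
    (vis.setIfInBounds i true).toList.count false + 1 ≤ vis.toList.count false := by
  -- An index out of range would be read as visited, the default being `true`.
  have hlt : i < vis.toList.length := by
    by_contra hc
    rw [Array.getD_eq_getD_getElem?, Array.getElem?_eq_none (by simpa using hc)] at h
    simp at h
  have hget : vis.toList[i] = false := by
    rw [Array.getD_eq_getD_getElem?, Array.getElem?_eq_getElem (by simpa using hlt)] at h
    simpa using h
  rw [Array.toList_setIfInBounds, List.count_set hlt, hget]
  have : 0 < vis.toList.count false :=
    List.count_pos_iff.2 (hget ▸ List.getElem_mem hlt)
  simp only [BEq.rfl, if_true, Bool.true_beq, Bool.false_eq_true, if_false, add_zero]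
  omega

/-- The elements with distinct labels are counted at most once. -/
theorem sum_sum_filter_le {α : Type} (key : α → Option ℕ) (f : α → ℕ) (is : List ℕ) (his : is.Nodup)
    (l : List α) :
    (is.map fun i => ((l.filter fun a => key a == some i).map f).sum).sum ≤ (l.map f).sum := by
  induction is generalizing l with
  | nil => simp
  | cons i is ih =>
    rw [List.nodup_cons] at his
    -- The elements with key `i` are split off; the other keys differ from `i`, so for them nothing
    -- is lost by restricting to the rest.
    have h1 := ih his.2 (l.filter fun a => !(key a == some i))
    have h2 := ((List.filter_append_perm (fun a => key a == some i) l).map f).sum_eq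
    rw [List.map_append, List.sum_append] at h2
    rw [List.map_cons, List.sum_cons, ← h2]
    refine Nat.add_le_add_left (le_trans (le_of_eq ?_) h1) _
    congr 1
    refine List.map_congr_left fun j hj => ?_
    rw [List.filter_filter]
    congr 2
    refine List.filter_congr fun a _ => ?_
    have : i ≠ j := fun e => his.1 (e ▸ hj)
    cases hk : key a with
    | none => simp
    | some x =>
      by_cases hx : x = j
      · subst hx; simp [Ne.symm this]
      · simp [hx]

theorem insideR_cost_le (es : List Seg) (p : Pt) : (insideR es p).cost ≤ 51 * es.length + 3 := by
  unfold insideR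
  have := foldR_cost_le_const (K := 50) (l := es) (b := (false, false))
    (f := fun (s : Bool × Bool) e => charge 50 (s.1 || onSeg e p, xor s.2 (crossesRay e p)))
    (by simp)
  simp only [bind_cost, charge_cost]
  omega

theorem areaR_cost_le (es : List Seg) : (areaR es).cost ≤ 6 * es.length + 1 :=
  foldR_cost_le_const (K := 5) (by simp)

theorem nextEdge_cost_le (hs : List (Seg × ℕ)) (h : Seg) :
    (nextEdge hs h).cost ≤ 61 * hs.length + 3 := by
  unfold nextEdge
  exact (Within.spec (Within.bind (Spec.cost_le (foldR_cost_le_const (K := 60) (by simp)))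
    fun _ _ => Within.charge (Q := fun _ => True) (by omega) trivial)).1

/-- Bounds for the faces of a 1-complex. -/
structure FacesBound (n : ℕ) (fs : List Face) : Prop where
  length_le : fs.length ≤ n
  sum_edges_le : (fs.map fun f => f.edges.length).sum ≤ n
  ring : ∀ f ∈ fs, f.holes = [] → IsRing f.edges

/-- A traced half-edge turns from unvisited to visited, so all walks together have at most `n`
vertices, whatever the successor function is. The cost bound is crude: `O(n)` for each starting
half-edge. -/
theorem traceWalks_spec (n : ℕ) (next : ℕ → ℕ) (src : Seg → ℕ → Pt) {hn : List (Seg × ℕ)}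
    (hl : hn.length = n) :
    Spec (foldR (fun (s : Array Bool × List (List Pt)) (h : Seg × ℕ) => do
      let r ← whileR (fun (c : Array Bool × List Pt × ℕ) => charge 6 (
        if c.1.getD c.2.2 true then (c, false)
        else ((c.1.setIfInBounds c.2.2 true, src h.1 c.2.2 :: c.2.1, next c.2.2),
          true))) (n + 1) (s.1, [], h.2)
      let w ← reverseR r.2.1
      charge 2 (r.1, w :: s.2)) (Array.replicate n false, []) hn)
      (20 * (n + 1) ^ 2)
      (fun s => (s.2.map List.length).sum ≤ n ∧ s.2.length = n) := by
  refine ((Spec.foldR_rest (fun rest s => (s.2.map List.length).sum + s.1.toList.count false ≤ n ∧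
    s.2.length + rest.length = n) (fun _ => 8 * n + 14) ⟨by simp, by simp [hl]⟩
    fun h rest s hs => ?_).le ?_).imp fun s hs => ⟨by omega, by simpa using hs.2⟩
  · obtain ⟨h1, h2⟩ := hs
    simp only [List.length_cons] at h2
    refine Within.spec (Within.bind (Spec.whileR
      (fun c => c.2.1.length + c.1.toList.count false ≤ s.1.toList.count false) 6
      (by simp) fun c hc => Spec.charge ?_) fun r hr => ?_)
    · split_ifs with hv
      · exact hc
      · have := count_false_set_lt (Bool.eq_false_of_not_eq_true hv)
        simp only [List.length_cons]
        omega
    · refine Within.bind (Spec.reverseR r.2.1) fun w hw => Within.charge (by omega) ⟨?_, ?_⟩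
      · simp only [hw, List.map_cons, List.sum_cons, List.length_reverse]
        omega
      · simp
        omega
  · simp only [List.map_const', List.sum_replicate, smul_eq_mul, hl]
    nlinarith

theorem sum_zipIdx {α : Type} (l : List α) (f : α → ℕ) :
    (l.zipIdx.map fun a => f a.1).sum = (l.map f).sum := by
  conv_rhs => rw [← List.zipIdx_map_fst 0 l, List.map_map]
  rfl

/-- With `n` twice the number of segments, all rings together have at most `n` edges. Outer rings
and holes each contribute at most `n`, which gives four times the number of segments. Every search,
for successors and for surrounding rings, is a linear scan. -/
theorem polygonize_spec (segs : List Seg) :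
    Spec (polygonize segs) (10000 * (segs.length + 1) ^ 2)
      (FacesBound (4 * segs.length)) := by
  unfold polygonize
  refine Within.spec (Within.bind (Spec.mapR_const (K := 2) (by simp)) fun back hback => ?_)
  refine Within.bind (Spec.appendR segs back) fun hs hhs => ?_
  refine Within.bind (Spec.lengthR hs) fun n hn => ?_
  have hsn : n = 2 * segs.length := by simp [hn, hhs, hback]; omega
  rw [← hn]
  refine Within.bind (Spec.numberR hs) fun hN hhN => ?_
  have hNl : hN.length = n := by simp [hhN, hn]
  rw [← hn]
  refine Within.bind (Spec.mapR_const (K := 61 * n + 3) fun h _ =>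
    hNl ▸ nextEdge_cost_le hN h) fun nxtL hnxt => ?_
  have hxl : nxtL.length = n := by simp [hnxt, hn]
  rw [← hn]
  refine Within.bind (Spec.arrayR nxtL) fun nxt _ => ?_
  refine Within.bind (Spec.arrayR hs) fun src _ => ?_
  refine Within.bind (Spec.allocR n false) fun vis hvis => ?_
  subst hvis
  refine Within.bind (traceWalks_spec n (fun i => nxt.getD i 0) (fun d i => (src.getD i d).1) hNl)
    fun walks hwalks => ?_
  obtain ⟨hw1, hw2⟩ := hwalks
  rw [hxl, ← hn]
  have hwm : ∀ w ∈ walks.2, w.length ≤ n := fun w hw => (le_sum_map hw List.length).trans hw1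
  -- One factor of the quadratic cost is bounded by `n + 1`, so that the sum over all walks stays
  -- quadratic.
  refine Within.bind (Spec.mapR (c := fun w => 30 * (n + 1) * (w.length + 1)) fun w hw => ?_)
    fun rings₀ hrings₀ => ?_
  · have := (splitWalk_spec w).1
    have := hwm w hw
    nlinarith
  rw [sum_map_mul_const, sum_map_add_const, hw2]
  have hr₀l : rings₀.length = n := by simp [hrings₀, hw2]
  refine Within.bind (Spec.concatR rings₀) fun rings₁ hrings₁ => ?_
  have hr₁ : (rings₁.map List.length).sum ≤ n := by
    rw [hrings₁, sum_map_flatten, hrings₀, List.map_map]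
    exact (sum_map_le_sum fun w _ => (splitWalk_spec w).2.1).trans hw1
  have hr₁n : ∀ c ∈ rings₁, c.Nodup ∧ 3 ≤ c.length := by
    intro c hc
    rw [hrings₁, List.mem_flatten] at hc
    obtain ⟨l, hl, hcl⟩ := hc
    rw [hrings₀, List.mem_map] at hl
    obtain ⟨w, _, rfl⟩ := hl
    exact (splitWalk_spec w).2.2 c hcl
  have hr₁l : rings₁.length ≤ n :=
    (length_le_sum_map fun c hc => by have := (hr₁n c hc).2; omega).trans hr₁
  rw [← hrings₁, hr₀l]
  refine Within.bind (Spec.mapR (c := fun r => 8 * r.length + 4) fun r _ => ?_)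
    fun rings hrings => ?_
  · have h1 := (ringEdges_spec r).1
    have h2 := areaR_cost_le (ringEdges r).val
    rw [length_ringEdges] at h2
    simp only [bind_cost, charge_cost]
    omega
  rw [sum_map_add_const, sum_map_mul_const]
  have hrl : rings.length = rings₁.length := by simp [hrings]
  have hrs : (rings.map fun r => r.2.1.length).sum ≤ n := by
    rw [hrings, List.map_map]
    simpa [Function.comp_def, length_ringEdges] using hr₁
  have hrr : ∀ r ∈ rings, IsRing r.2.1 := by
    intro r hr
    rw [hrings, List.mem_map] at hr
    obtain ⟨c, hc, rfl⟩ := hr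
    exact ⟨c, (hr₁n c hc).1, (hr₁n c hc).2, (ringEdges_spec c).2⟩
  refine Within.bind (Spec.filterR_const (K := 1) (by simp)) fun outers houters => ?_
  have hol : outers.length ≤ n := by
    have := houters ▸ List.length_filter_le _ rings
    omega
  have hos : (outers.map fun r => r.2.1.length).sum ≤ n :=
    (houters ▸ sum_map_filter_le rings _ _).trans hrs
  have hor : ∀ r ∈ outers, IsRing r.2.1 := fun r hr =>
    hrr r (List.mem_of_mem_filter (houters ▸ hr))
  refine Within.bind (Spec.filterR_const (K := 1) (by simp)) fun inners hinners => ?_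
  have hil : inners.length ≤ n := by
    have := hinners ▸ List.length_filter_le _ rings
    omega
  have his : (inners.map fun r => r.2.1.length).sum ≤ n :=
    (hinners ▸ sum_map_filter_le rings _ _).trans hrs
  refine Within.bind (Spec.numberR outers) fun outersN houtersN => ?_
  have honl : outersN.length = outers.length := by simp [houtersN]
  have hons : (outersN.map fun o => o.1.2.1.length).sum ≤ n := by
    rw [houtersN, sum_zipIdx outers fun r => r.2.1.length]
    exact hos
  refine Within.bind (Spec.mapR_const (K := 70 * n + 20) fun r _ => ?_) fun owned howned => ?_
  · refine (Within.spec (Q := fun _ => True) (Within.bind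
      (Spec.filterR (c := fun o => 51 * o.1.2.1.length + 3) fun o _ => insideR_cost_le _ _)
      fun around haround => ?_)).1
    rw [sum_map_add_const, sum_map_mul_const]
    have hal : around.length ≤ outersN.length := haround ▸ List.length_filter_le _ _
    refine Within.bind (Spec.cost_le (argminR_cost_le (c := fun _ => 1) (by simp)))
      fun o _ => Within.charge ?_ trivial
    simp only [List.map_const', List.sum_replicate, smul_eq_mul]
    omega
  have howl : owned.length = inners.length := by simp [howned]
  have hows : (owned.map fun r => r.1.2.1.length).sum ≤ n := by
    rw [howned, List.map_map]
    exact his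
  have key : ∀ o ∈ outersN, Spec (do
      let hs ← filterR (fun (r : (Poly × List Seg × ℝ) × Option ℕ) => charge 1 (r.2 == some o.2)) owned
      let hp ← mapR (fun (r : (Poly × List Seg × ℝ) × Option ℕ) => charge 1 r.1.1) hs
      let he ← mapR (fun (r : (Poly × List Seg × ℝ) × Option ℕ) => charge 1 r.1.2.1) hs
      let he ← concatR he
      let es ← appendR o.1.2.1 he
      charge 1 { outer := o.1.1, holes := hp, edges := es : Face }) (20 * n + 20)
      (fun f => f.edges.length = o.1.2.1.length +
        ((owned.filter fun r => r.2 == some o.2).map fun r => r.1.2.1.length).sum ∧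
        (f.holes = [] → f.edges = o.1.2.1)) := by
    intro o ho
    have h1 : o.1.2.1.length ≤ n := (le_sum_map ho fun o => o.1.2.1.length).trans hons
    refine Within.spec (Within.bind (Spec.filterR_const (K := 1) (by simp)) fun hs' hhs' => ?_)
    simp only [charge_val] at hhs'
    have hhl : hs'.length ≤ owned.length := hhs' ▸ List.length_filter_le _ _
    have hhsum : (hs'.map fun r => r.1.2.1.length).sum ≤ n :=
      (hhs' ▸ sum_map_filter_le owned _ _).trans hows
    refine Within.bind (Spec.mapR_const (K := 1) (by simp)) fun hp hhp => ?_
    refine Within.bind (Spec.mapR_const (K := 1) (by simp)) fun he hhe => ?_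
    refine Within.bind (Spec.concatR he) fun he' hhe' => ?_
    have hel : he.length = hs'.length := by simp [hhe]
    have hel' : he'.length = (hs'.map fun r => r.1.2.1.length).sum := by
      rw [hhe', List.length_flatten, hhe, List.map_map]
      rfl
    rw [← hhe', hel']
    refine Within.bind (Spec.appendR _ _) fun es hes => Within.charge (by omega) ⟨?_, ?_⟩
    · rw [hes, List.length_append, hel', hhs']
    · intro h0
      simp only [hhp, List.map_eq_nil_iff] at h0
      rw [hes, hhe', hhe, h0]
      simp
  refine Within.last (Spec.mapR_const fun o ho => (key o ho).1) ?_ fun fs hfs => ?_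
  · have e1 : (70 * n + 20 + 2) * inners.length ≤ (70 * n + 20 + 2) * n := Nat.mul_le_mul_left _ hil
    have e2 : (20 * n + 20 + 2) * outersN.length ≤ (20 * n + 20 + 2) * n :=
      Nat.mul_le_mul_left _ (by omega)
    clear key
    subst hsn
    nlinarith
  · have hb : ∀ f ∈ fs, f.holes = [] → IsRing f.edges := by
      intro f hf h0
      rw [hfs, List.mem_map] at hf
      obtain ⟨o, ho, rfl⟩ := hf
      rw [(key o ho).2.2 h0]
      rw [houtersN] at ho
      exact hor _ (List.fst_mem_of_mem_zipIdx ho)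
    refine ⟨?_, ?_, hb⟩
    · simp only [hfs, List.length_map]
      omega
    · rw [hfs, List.map_map]
      refine (sum_map_le_sum fun o ho => (key o ho).2.1.le).trans ?_
      rw [sum_map_add]
      -- Distinct outer rings have distinct numbers, so no hole is counted twice.
      have h1 := sum_sum_filter_le (fun r : (Poly × List Seg × ℝ) × Option ℕ => r.2)
        (fun r => r.1.2.1.length) (outersN.map Prod.snd)
        (by rw [houtersN, List.zipIdx_map_snd]; exact List.nodup_range') owned
      rw [List.map_map] at h1
      simp only [Function.comp_def] at h1
      omega

/-! ### Pieces, their owners and their regions. -/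

theorem PiecesBound.mono {N M M' : ℕ} {ps : List Piece} (h : PiecesBound N M ps) (hM : M ≤ M') :
    PiecesBound N M' ps :=
  ⟨h.length_le.trans hM, h.sum_edges_le.trans hM, h.owners_le, h.ring⟩

theorem PiecesBound.sublist {N M : ℕ} {ps ps' : List Piece} (h : PiecesBound N M ps)
    (hs : ps'.Sublist ps) : PiecesBound N M ps' :=
  ⟨hs.length_le.trans h.length_le, (sublist_sum_map_le hs _).trans h.sum_edges_le,
    fun q hq => h.owners_le q (hs.subset hq), fun q hq => h.ring q (hs.subset hq)⟩

/-- Changes that concern neither the geometry of the pieces nor enlarge the lists of owners. -/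
theorem PiecesBound.map {N M : ℕ} {ps : List Piece} (h : PiecesBound N M ps) {g : Piece → Piece}
    (hg : ∀ q ∈ ps, (g q).edges = q.edges ∧ (g q).simple = q.simple ∧
      (g q).owners.length ≤ q.owners.length) : PiecesBound N M (ps.map g) where
  length_le := by simpa using h.length_le
  sum_edges_le := by
    rw [List.map_map]
    refine le_trans (le_of_eq ?_) h.sum_edges_le
    congr 1
    exact List.map_congr_left fun q hq => by simp [(hg q hq).1]
  owners_le := by
    intro q hq
    obtain ⟨q', hq', rfl⟩ := List.mem_map.1 hq
    exact (hg q' hq').2.2.trans (h.owners_le q' hq')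
  ring := by
    intro q hq hs
    obtain ⟨q', hq', rfl⟩ := List.mem_map.1 hq
    rw [(hg q' hq').1]
    exact h.ring q' hq' ((hg q' hq').2.1 ▸ hs)

theorem innerPoint_cost_le (segs : List Seg) (f : Face) :
    (innerPoint segs f).cost ≤ 51 * segs.length + 21 := by
  unfold innerPoint
  exact (Within.spec (Within.bind (Spec.cost_le (foldR_cost_le_const (K := 50) (by simp)))
    fun _ _ => Within.charge (Q := fun _ => True) (by omega) trivial)).1

/-- Bounds for a numbered list of boundaries: the numbers of its members and of their edges. -/
structure BoundariesBound (E : ℕ) (ks : List (List Seg × ℕ)) : Prop where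
  length_le : ks.length ≤ E
  sum_le : (ks.map fun k => k.1.length).sum ≤ E

/-- For each of linearly many faces, an interior point is found by a scan of the complex and tested
against all unit and region edges. -/
theorem locatePieces_spec {E : ℕ} {units regs : List (List Seg × ℕ)} (hu : BoundariesBound E units)
    (hr : BoundariesBound E regs) (aware : Bool) (segs : List Seg) :
    Spec (locatePieces aware units regs segs)
      (20000 * (segs.length + 1) * (segs.length + E + 1))
      (PiecesBound units.length (4 * segs.length)) := by
  obtain ⟨hu1, hu2⟩ := hu
  obtain ⟨hr1, hr2⟩ := hr
  unfold locatePieces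
  refine Within.spec (Within.bind (polygonize_spec segs) fun faces hfaces => ?_)
  refine Within.bind (Spec.numberR faces) fun facesN hfacesN => ?_
  have hfl : facesN.length = faces.length := by simp [hfacesN]
  have hF := hfaces.length_le
  have key : ∀ f ∈ facesN, Spec (do
      let p ← innerPoint segs f.1
      let own ← filterR (fun (k : List Seg × ℕ) => insideR k.1 p) units
      let own ← mapR (fun (k : List Seg × ℕ) => charge 1 k.2) own
      let d ← lengthR own
      let r ← findR (fun (k : List Seg × ℕ) => insideR k.1 p) regs
      charge 12 ({ id := f.2, ring := f.1.outer, simple := f.1.holes.isEmpty, edges := f.1.edges,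
                   region := if aware then r.map Prod.snd else some 0,
                   owners := own, order := d, unit := none } : Piece))
      (51 * segs.length + 150 * E + 50)
      (fun q => q.edges = f.1.edges ∧ q.simple = f.1.holes.isEmpty ∧
        q.owners.length ≤ units.length) := by
    intro f hf
    refine Within.spec (Within.bind (Spec.cost_le (innerPoint_cost_le segs f.1)) fun p _ => ?_)
    refine Within.bind (Spec.filterR (c := fun k => 51 * k.1.length + 3)
      fun k _ => insideR_cost_le _ _) fun own hown => ?_
    have hol : own.length ≤ units.length := hown ▸ List.length_filter_le _ _
    refine Within.bind (Spec.mapR_const (K := 1) (by simp)) fun own' hown' => ?_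
    have hol' : own'.length = own.length := by simp [hown']
    refine Within.bind (Spec.lengthR own') fun d _ => ?_
    refine Within.bind (Spec.findR (c := fun k => 51 * k.1.length + 3)
      fun k _ => insideR_cost_le _ _) fun r _ => Within.charge ?_ ⟨rfl, rfl, by simp only; omega⟩
    simp only [sum_map_add_const, sum_map_mul_const]
    omega
  refine Within.last (Spec.mapR_const fun f hf => (key f hf).1) ?_ fun ps hps => ?_
  · rw [hfl]
    have : (51 * segs.length + 150 * E + 50 + 2) * faces.length ≤
      (51 * segs.length + 150 * E + 50 + 2) * (4 * segs.length) := Nat.mul_le_mul_left _ hF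
    nlinarith
  · subst hps
    refine ⟨by simp; omega, ?_, ?_, ?_⟩
    · rw [List.map_map]
      refine (sum_map_le_sum fun f hf => (congrArg List.length (key f hf).2.1).le).trans ?_
      rw [hfacesN, sum_zipIdx faces fun f => f.edges.length]
      exact hfaces.sum_edges_le
    · intro q hq
      obtain ⟨f, hf, rfl⟩ := List.mem_map.1 hq
      exact (key f hf).2.2.2
    · intro q hq hs
      obtain ⟨f, hf, rfl⟩ := List.mem_map.1 hq
      obtain ⟨h1, h2, _⟩ := (key f hf).2
      rw [h1]
      rw [h2, List.isEmpty_iff] at hs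
      refine hfaces.ring _ ?_ hs
      rw [hfacesN] at hf
      exact List.fst_mem_of_mem_zipIdx hf

/-- For every unit and every region all pieces are visited, with a search among up to `N` owners;
the areas add only the total number of edges. With `M = O(E ^ 2)` this is the fifth power that
dominates the first phase. -/
theorem assignRegions_cost_le {E N M : ℕ} {units regs : List (List Seg × ℕ)} {ps : List Piece}
    (hu : units.length ≤ E) (hr : regs.length ≤ E) (hps : PiecesBound N M ps) (hN : N ≤ E) :
    (assignRegions units regs ps).cost ≤ 40 * (E + 1) ^ 3 * (M + 1) := by
  have hM1 := hps.length_le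
  have hM2 := hps.sum_edges_le
  unfold assignRegions
  refine (Within.spec (Q := fun _ => True) (Within.bind
    (Spec.mapR_const (K := (20 * (E + 1) * (M + 1) + 3) * E + 4) fun k _ => ?_) fun l hl =>
      Within.last (Spec.arrayR l) ?_ fun _ _ => trivial)).1
  · refine (Within.spec (Q := fun _ => True) (Within.bind (Spec.cost_le
      (argmaxR_cost_le (c := fun _ => 20 * (E + 1) * (M + 1)) fun r _ => ?_)) fun best _ =>
        Within.charge ?_ trivial)).1
    · refine (foldR_cost_le (c := fun q => 6 * q.edges.length + (2 * N + 7)) fun s q hq => ?_).trans ?_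
      · have h1 := memR_cost_le k.2 q.owners
        have h2 := hps.owners_le q hq
        have h3 := areaR_cost_le q.edges
        rw [bind_cost]
        split_ifs
        · simp only [bind_cost, charge_cost]; omega
        · simp only [charge_cost]; omega
      · rw [sum_map_add_const, sum_map_mul_const]
        have : (2 * N + 7) * ps.length ≤ (2 * E + 7) * M := Nat.mul_le_mul (by omega) hM1
        nlinarith
    · simp only [List.map_const', List.sum_replicate, smul_eq_mul]
      have := Nat.mul_le_mul_right (20 * (E + 1) * (M + 1) + 3) hr
      linarith
  · have hll : l.length = units.length := by simp [hl]
    rw [hll]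
    have h1 : ((20 * (E + 1) * (M + 1) + 3) * E + 4 + 2) * units.length ≤
      ((20 * (E + 1) * (M + 1) + 3) * E + 4 + 2) * E := Nat.mul_le_mul_left _ hu
    have e1 : ((20 * (E + 1) * (M + 1) + 3) * E + 4 + 2) * E =
      20 * ((E + 1) * E * E * (M + 1)) + 3 * (E * E) + 6 * E := by ring
    have e2 : 40 * (E + 1) ^ 3 * (M + 1) = 20 * ((E + 1) * E * E * (M + 1)) +
      (20 * (E + 1) * E * E + 40 * (E + 1) * (2 * E + 1)) * (M + 1) := by ring
    rw [e1] at h1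
    rw [e2]
    nlinarith [Nat.zero_le ((20 * (E + 1) * E * E + 40 * (E + 1) * (2 * E + 1)) * M)]

theorem localize_spec {N M : ℕ} {ps : List Piece} (h : PiecesBound N M ps) (ureg : Array ℕ) :
    Spec (localize ureg ps) (20 * (N + 1) * (M + 1)) (PiecesBound N M) := by
  have hM := h.length_le
  unfold localize
  refine Within.spec (Within.bind (Spec.filterR_const (K := 1) (by simp)) fun kept hkept => ?_)
  have hk : PiecesBound N M kept := h.sublist (hkept ▸ List.filter_sublist)
  refine Within.last (Spec.mapR_const (K := 6 * N + 5) fun q hq => ?_) ?_ fun r hr => ?_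
  · have h1 := hk.owners_le q hq
    refine (Within.spec (Q := fun _ => True) (Within.bind (Spec.filterR_const (K := 3) (by simp))
      fun own hown => ?_)).1
    have : own.length ≤ q.owners.length := hown ▸ List.length_filter_le _ _
    refine Within.bind (Spec.lengthR own) fun d _ => Within.charge ?_ trivial
    omega
  · have h1 := hk.length_le
    have : (6 * N + 5 + 2) * kept.length ≤ (6 * N + 5 + 2) * M := Nat.mul_le_mul_left _ h1
    nlinarith
  · subst hr
    refine hk.map fun q _ => ⟨rfl, rfl, ?_⟩
    simp only [bind_val, charge_val, filterR_val]
    exact List.length_filter_le _ _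

theorem dropInnerEdges_spec {N M : ℕ} {ps : List Piece} (h : PiecesBound N M ps) (segs : List Seg) :
    Spec (dropInnerEdges segs ps) ((50 * M + 20) * segs.length + 1)
      (fun r => r.length ≤ segs.length) := by
  have hM1 := h.length_le
  have hM2 := h.sum_edges_le
  have hf : ∀ e : Seg, (findR (fun (q : Piece) =>
      if q.order == 0 then touchR [e] q.edges else charge 1 false) ps).cost ≤ 20 * M + 5 := by
    intro e
    have := (Spec.findR (l := ps) (c := fun q' => 11 * q'.edges.length + 5)
      (p := fun (q : Piece) => if q.order == 0 then touchR [e] q.edges else charge 1 false)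
      fun q' _ => by
        have := touchR_cost_le [e] q'.edges
        split_ifs
        · simp at this; omega
        · simp only [charge_cost]; omega).1
    rw [sum_map_add_const, sum_map_mul_const] at this
    omega
  unfold dropInnerEdges
  refine ((Spec.filterR_const (K := 40 * M + 15) fun e _ => ?_).le ?_).imp fun r hr =>
    hr ▸ List.length_filter_le _ _
  · refine (Within.spec (Q := fun _ => True) (Within.bind (Spec.cost_le (hf (flip e))) fun l _ =>
      Within.bind (Spec.cost_le (hf e)) fun r _ => Within.charge (by omega) trivial)).1
  · nlinarith

theorem boundariesBound_zipIdx {E : ℕ} {r : List (List Seg)} (h1 : r.length ≤ E)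
    (h2 : (r.map List.length).sum ≤ E) : BoundariesBound E r.zipIdx :=
  ⟨by simpa using h1, by rwa [sum_zipIdx r fun k => k.length]⟩

/-- In the region-aware version the complex is located a second time after edges have been deleted.
It has not grown, so the same bounds apply to both rounds. -/
theorem refinedTiling_spec {T : List Poly} {regions : Option (List Poly)}
    (hT : ∀ P ∈ T, 3 ≤ P.length) (hR : ∀ P ∈ regions.getD [], 3 ≤ P.length) {E : ℕ}
    (hE : edgeCount T + edgeCount (regions.getD []) = E) :
    Spec (refinedTiling T regions) (1000000 * (E + 1) ^ 5)
      (fun r => PiecesBound T.length (8 * (E + 1) ^ 2) r.1) := by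
  have hT1 := length_le_edgeCount hT
  have hR1 := length_le_edgeCount hR
  unfold refinedTiling
  simp only
  generalize regions.getD [] = regs at *
  refine Within.spec (Within.bind (Spec.appendR T regs) fun polys hpolys => ?_)
  have hpE : edgeCount polys = E := by rw [hpolys, edgeCount_append, hE]
  have hnode := nodedUnion_spec (T := polys) (by rw [hpE, hpolys, List.length_append]; omega)
  rw [hpE] at hnode
  refine Within.bind hnode fun segs hsegs => ?_
  refine Within.bind (mapR_ringEdges_spec T) fun unitE hunitE => ?_
  refine Within.bind (Spec.numberR unitE) fun unitN hunitN => ?_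
  have huN : BoundariesBound E unitN := hunitN ▸ boundariesBound_zipIdx (by omega) (by omega)
  refine Within.bind (mapR_ringEdges_spec regs) fun regE hregE => ?_
  refine Within.bind (Spec.numberR regE) fun regN hregN => ?_
  have hrN : BoundariesBound E regN := hregN ▸ boundariesBound_zipIdx (by omega) (by omega)
  have huT : unitN.length = T.length := by rw [hunitN, List.length_zipIdx]; exact hunitE.1
  have hloc : ∀ (a : Bool) (s : List Seg), s.length ≤ segs.length →
      Spec (locatePieces a unitN regN s) (200000 * (E + 1) ^ 4)
        (PiecesBound T.length (8 * (E + 1) ^ 2)) := by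
    intro a s hs
    have := locatePieces_spec huN hrN a s
    rw [huT] at this
    have h1 : s.length + 1 ≤ 3 * (E + 1) ^ 2 := by
      have : 1 ≤ (E + 1) ^ 2 := Nat.one_le_pow _ _ (by omega)
      omega
    have h2 : s.length + E + 1 ≤ 3 * (E + 1) ^ 2 := by
      have : E + 1 ≤ (E + 1) ^ 2 := Nat.le_self_pow (by omega) _
      omega
    refine (this.le ?_).imp fun ps hps => hps.mono (by omega)
    calc 20000 * (s.length + 1) * (s.length + E + 1)
        ≤ 20000 * (3 * (E + 1) ^ 2) * (3 * (E + 1) ^ 2) :=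
          Nat.mul_le_mul (Nat.mul_le_mul_left _ h1) h2
      _ = 180000 * (E + 1) ^ 4 := by ring
      _ ≤ _ := Nat.mul_le_mul_right _ (by omega)
  have hlz : ∀ (u : Array ℕ) (ps : List Piece), PiecesBound T.length (8 * (E + 1) ^ 2) ps →
      Spec (localize u ps) (180 * (E + 1) ^ 3) (PiecesBound T.length (8 * (E + 1) ^ 2)) := by
    intro u ps hps
    refine (localize_spec hps u).le ?_
    have h1 : 8 * (E + 1) ^ 2 + 1 ≤ 9 * (E + 1) ^ 2 := by
      have : 1 ≤ (E + 1) ^ 2 := Nat.one_le_pow _ _ (by omega)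
      omega
    calc 20 * (T.length + 1) * (8 * (E + 1) ^ 2 + 1) ≤ 20 * (E + 1) * (9 * (E + 1) ^ 2) :=
          Nat.mul_le_mul (by omega) h1
      _ = 180 * (E + 1) ^ 3 := by ring
  refine Within.bind (hloc _ segs le_rfl) fun raw hraw => ?_
  have hM : 8 * (E + 1) ^ 2 + 1 ≤ 9 * (E + 1) ^ 2 := by
    have : 1 ≤ (E + 1) ^ 2 := Nat.one_le_pow _ _ (by omega)
    omega
  have hassign : (assignRegions unitN regN raw).cost ≤ 360 * (E + 1) ^ 5 := by
    refine (assignRegions_cost_le huN.length_le hrN.length_le hraw (by omega)).trans ?_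
    calc 40 * (E + 1) ^ 3 * (8 * (E + 1) ^ 2 + 1) ≤ 40 * (E + 1) ^ 3 * (9 * (E + 1) ^ 2) :=
          Nat.mul_le_mul_left _ hM
      _ = 360 * (E + 1) ^ 5 := by ring
  refine Within.bind (Spec.cost_le hassign) fun ureg _ => ?_
  refine Within.bind (hlz ureg raw hraw) fun ps hps => ?_
  have p1 : E + 1 ≤ (E + 1) ^ 5 := Nat.le_self_pow (by omega) _
  have p3 : (E + 1) ^ 3 ≤ (E + 1) ^ 5 := Nat.pow_le_pow_right (by omega) (by omega)
  have p4 : (E + 1) ^ 4 ≤ (E + 1) ^ 5 := Nat.pow_le_pow_right (by omega) (by omega)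
  have hl1 := hunitE.1
  have hl2 := hregE.1
  split_ifs
  · have hdrop : ((50 * (8 * (E + 1) ^ 2) + 20) * segs.length + 1) ≤ 900 * (E + 1) ^ 4 := by
      have h1 : (50 * (8 * (E + 1) ^ 2) + 20) * segs.length ≤
        (420 * (E + 1) ^ 2) * (2 * (E + 1) ^ 2) := Nat.mul_le_mul (by omega) hsegs
      have h2 : (420 * (E + 1) ^ 2) * (2 * (E + 1) ^ 2) = 840 * (E + 1) ^ 4 := by ring
      have h3 : 1 ≤ (E + 1) ^ 4 := Nat.one_le_pow _ _ (by omega)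
      omega
    refine Within.bind ((dropInnerEdges_spec hps segs).le hdrop) fun segs' hsegs' => ?_
    refine Within.bind (hloc true segs' hsegs') fun raw' hraw' => ?_
    refine Within.bind (hlz ureg raw' hraw') fun ps' hps' => Within.pure ?_ hps'
    linarith
  · refine Within.pure ?_ hps
    linarith

/-! ### Assignment of overlaps -/

theorem touchR_cost_le_mul (es fs : List Seg) :
    (touchR es fs).cost ≤ 11 * ((es.length + 1) * (fs.length + 1)) := by
  have := touchR_cost_le es fs
  nlinarith

theorem sharedR_cost_le (es fs : List Seg) :
    (sharedR es fs).cost ≤ (21 * fs.length + 2) * es.length + 1 :=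
  foldR_cost_le_const (K := 21 * fs.length + 1) fun _ _ _ => foldR_cost_le_const (K := 20) (by simp)

theorem disconnectedR_cost_le {N M : ℕ} {ps : List Piece} (h : PiecesBound N M ps) (k : ℕ) :
    (disconnectedR ps k).cost ≤ 130 * (M + 1) ^ 2 := by
  have h1 := h.length_le
  have h2 := h.sum_edges_le
  unfold disconnectedR
  refine (Within.spec (Q := fun _ => True) (Within.bind (Spec.filterR_const (K := 1) (by simp))
    fun mine hmine => ?_)).1
  have hs : mine.Sublist ps := hmine ▸ List.filter_sublist
  have h3 : (mine.map fun q => q.edges.length + 1).sum ≤ 2 * M := by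
    refine (sublist_sum_map_le hs _).trans ?_
    rw [sum_map_add_const]
    omega
  have h4 := hs.length_le
  refine Within.bind (componentsR_spec (fun q => q.edges.length + 1) 11 (by simp)
    fun q q' => touchR_cost_le_mul q.edges q'.edges) fun cs hcs => ?_
  have h5 : cs.length ≤ mine.length := (length_flatten_le hcs.2).trans hcs.1.length_eq.le
  refine Within.bind (Spec.lengthR cs) fun c _ => Within.charge ?_ trivial
  have h6 : ((mine.map fun q => q.edges.length + 1).sum + 1) ^ 2 ≤ (2 * M + 1) ^ 2 :=
    Nat.pow_le_pow_left (by omega) 2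
  nlinarith

theorem perimeterR_cost_le {N M : ℕ} {ps : List Piece} (h : PiecesBound N M ps) (es : List Seg)
    (k : ℕ) : (perimeterR ps es k).cost ≤ 30 * (M + 1) * (es.length + 1) := by
  have h1 := h.length_le
  have h2 := h.sum_edges_le
  refine (foldR_cost_le (c := fun q => 21 * es.length * q.edges.length + (2 * es.length + 3))
    fun s q _ => ?_).trans ?_
  · have := sharedR_cost_le es q.edges
    split_ifs
    · simp only [bind_cost, charge_cost]
      nlinarith
    · simp only [charge_cost]
      omega
  · rw [sum_map_add_const, sum_map_mul_const]
    have h3 := Nat.mul_le_mul_left (21 * es.length) h2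
    have h4 := Nat.mul_le_mul_left (2 * es.length + 3) h1
    nlinarith

/-- At most `N` components tests of cost `O(M ^ 2)` are made for disconnected units. For each
remaining overlap, at most `N` common perimeters with the whole tiling are measured; these costs are
proportional to the number of its edges and sum to `O(N * M ^ 2)`. -/
theorem assignOrder_spec {N M : ℕ} {st : List Piece × List ℕ} (h : PiecesBound N M st.1)
    (hN : st.2.length ≤ N) (hNM : N ≤ M) (d : ℕ) :
    Spec (assignOrder st d) (400 * (N + 1) * (M + 1) ^ 2)
      (fun r => PiecesBound N M r.1 ∧ r.2.length ≤ N) := by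
  unfold assignOrder
  refine Within.spec (Within.bind (Spec.foldR_rest
    (fun rest s => PiecesBound N M s.1 ∧ s.2.length + rest.length ≤ N)
    (fun _ => 150 * (M + 1) ^ 2) ⟨h, by simpa using hN⟩ fun k rest s hs => ?_) fun st' hst' => ?_)
  · obtain ⟨h1, h2⟩ := hs
    simp only [List.length_cons] at h2
    refine Within.spec (Within.bind (Spec.mapR_const (K := 2 * N + 7) fun q hq => ?_)
      fun ps hps => ?_)
    · have h3 := memR_cost_le k q.owners
      have h4 := h1.owners_le q hq
      simp only [bind_cost, charge_cost]
      omega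
    · have hps' : PiecesBound N M ps := by
        rw [hps]
        refine h1.map fun q _ => ?_
        simp only [bind_val, charge_val]
        split_ifs <;> simp
      refine Within.bind (Spec.cost_le (disconnectedR_cost_le hps' k)) fun bad _ =>
        Within.charge ?_ ⟨hps', ?_⟩
      · have h5 := h1.length_le
        have h6 : (2 * N + 7 + 2) * s.1.length ≤ (2 * M + 7 + 2) * M :=
          Nat.mul_le_mul (by omega) h5
        nlinarith
      · simp only
        split_ifs
        · simp only [List.length_cons]; omega
        · omega
  · obtain ⟨h1, h2⟩ := hst'
    simp only [List.map_const', List.sum_replicate, smul_eq_mul]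
    simp only [List.length_nil, add_zero] at h2
    have hM := h1.length_le
    refine Within.bind (Spec.reverseR st'.2) fun disc hdisc => ?_
    refine Within.bind (Spec.filterR_const (K := 3) (by simp)) fun rest hrest => ?_
    have hr : PiecesBound N M rest := h1.sublist (hrest ▸ List.filter_sublist)
    refine Within.bind (Spec.foldR (PiecesBound N M)
      (fun q => 30 * N * (M + 1) * (q.edges.length + 1) + (3 * N + 5 * M + 2)) h1
      fun q hq ps hps => ?_) fun ps hps => Within.pure ?_ ⟨hps, by simpa [hdisc] using h2⟩
    · have ho := hr.owners_le q hq
      refine Within.spec (Within.bind (Spec.cost_le (argmaxR_cost_le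
        (c := fun _ => 30 * (M + 1) * (q.edges.length + 1)) fun k _ =>
          perimeterR_cost_le hps q.edges k)) fun best _ => ?_)
      refine Within.last (Spec.mapR_const (K := 3) (by simp)) ?_ fun r hr => ?_
      · simp only [List.map_const', List.sum_replicate, smul_eq_mul]
        have h3 := hps.length_le
        have h4 := Nat.mul_le_mul_right (30 * (M + 1) * (q.edges.length + 1)) ho
        have e : N * (30 * (M + 1) * (q.edges.length + 1)) =
          30 * N * (M + 1) * (q.edges.length + 1) := by ring
        omega
      · rw [hr]
        refine hps.map fun q' _ => ?_
        simp only [charge_val]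
        split_ifs <;> simp
    · have h3 := hr.length_le
      have h4 := hr.sum_edges_le
      rw [sum_map_add_const, sum_map_mul_const, sum_map_add_const]
      have e1 : 30 * N * (M + 1) * ((rest.map fun q => q.edges.length).sum + 1 * rest.length) ≤
        30 * N * (M + 1) * (2 * M) := Nat.mul_le_mul_left _ (by omega)
      have e2 : (3 * N + 5 * M + 2) * rest.length ≤ (8 * M + 2) * M :=
        Nat.mul_le_mul (by omega) h3
      have e3 : st.2.length * (150 * (M + 1) ^ 2) ≤ N * (150 * (M + 1) ^ 2) :=
        Nat.mul_le_mul_right _ hN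
      have e4 : 30 * N * (M + 1) * (2 * M) ≤ 60 * (N * (M + 1) ^ 2) := by nlinarith
      have e5 : 400 * (N + 1) * (M + 1) ^ 2 = 400 * (N * (M + 1) ^ 2) + 400 * (M + 1) ^ 2 := by ring
      have e6 : (8 * M + 2) * M + 10 * (M + 1) ≤ 20 * (M + 1) ^ 2 := by nlinarith
      rw [e5]
      nlinarith

/-- At most `N` orders, each at the full price; that every piece has only one order is not
exploited. -/
theorem assignOverlaps_spec {N M : ℕ} {ps : List Piece} (h : PiecesBound N M ps) (hNM : N ≤ M) :
    Spec (assignOverlaps N ps) (700 * (N + 1) ^ 2 * (M + 1) ^ 2) (PiecesBound N M) := by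
  have hM := h.length_le
  unfold assignOverlaps
  refine Within.spec (Within.bind (Spec.mapR_const (K := 3) (by simp)) fun ps' hps' => ?_)
  have hp : PiecesBound N M ps' := by
    rw [hps']
    refine h.map fun q _ => ?_
    simp only [charge_val]
    split_ifs <;> simp
  refine Within.bind (Spec.rangeR 0 N) fun units hunits => ?_
  have hul : units.length = N := by simp [hunits]
  refine Within.bind (Spec.filterR_const fun k _ => disconnectedR_cost_le hp k) fun disc hdisc => ?_
  have hdl : disc.length ≤ N := by
    rw [← hul, hdisc]
    exact List.length_filter_le _ _
  refine Within.bind (Spec.rangeR 2 (N - 1)) fun orders horders => ?_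
  have hol : orders.length ≤ N := by simp [horders]
  refine Within.bind (Spec.foldR_const (fun r => PiecesBound N M r.1 ∧ r.2.length ≤ N) _ ⟨hp, hdl⟩
    fun d _ st hst => assignOrder_spec hst.1 hst.2 hNM d) fun r hr => Within.pure ?_ hr.1
  have e1 : (400 * (N + 1) * (M + 1) ^ 2 + 1) * orders.length ≤
    (400 * (N + 1) * (M + 1) ^ 2 + 1) * N := Nat.mul_le_mul_left _ hol
  rw [hul]
  have e2 : 700 * (N + 1) ^ 2 * (M + 1) ^ 2 = 400 * (N + 1) * (M + 1) ^ 2 * N +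
    300 * N ^ 2 * (M + 1) ^ 2 + 1000 * N * (M + 1) ^ 2 + 700 * (M + 1) ^ 2 := by ring
  rw [e2]
  have e3 : 1 ≤ (M + 1) ^ 2 := Nat.one_le_pow _ _ (by omega)
  have e4 : N ≤ N * (M + 1) ^ 2 := Nat.le_mul_of_pos_right _ (by omega)
  have e5 : M + 1 ≤ (M + 1) ^ 2 := Nat.le_self_pow (by omega) _
  have e6 : 0 ≤ N ^ 2 * (M + 1) ^ 2 := Nat.zero_le _
  generalize (M + 1) ^ 2 = Y at *
  have e7 : N - 1 ≤ N := Nat.sub_le _ _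
  nlinarith

/-! ### Cleaning up -/

theorem partWeight_eq (ps : List Part) : partWeight ps = (ps.map fun p => p.1.length).sum + ps.length := by
  rw [partWeight, sum_map_add_const, one_mul]

/-- Total size of numbered parts. -/
def numberedWeight (ps : List (Part × ℕ)) : ℕ := (ps.map fun p => p.1.1.length + 1).sum

theorem numberedWeight_eq (ps : List (Part × ℕ)) :
    numberedWeight ps = (ps.map fun p => p.1.1.length).sum + ps.length := by
  rw [numberedWeight, sum_map_add_const, one_mul]

/-- Total size of a list of components, each given with its area, its parts, and its boundary edges. -/
def componentsWeight (cs : List (ℝ × List (Part × ℕ) × List Seg)) : ℕ :=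
  (cs.map fun c => c.2.1.length + c.2.2.length + 1).sum

/-- One pass of the loop that reassigns small components. -/
noncomputable def cleanPass (θ : ℝ) (N : ℕ) (ureg : Array ℕ) (k : ℕ) (units : List ℕ)
    (s : List (Part × ℕ) × List (ℝ × List (Part × ℕ) × List Seg)) :
    Run ((List (Part × ℕ) × List (ℝ × List (Part × ℕ) × List Seg)) × Bool) := do
  let big ← lastR s.2
  match s.2, big with
  | (a, c, es) :: c' :: rest, some (b, _) =>
    if a < θ * b then do
      let zero ← allocR N (0 : ℝ)
      let shared ← foldR (fun (acc : Array ℝ) (p : Part × ℕ) => do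
        let v ← sharedR es p.1.1
        charge 4 (acc.setIfInBounds p.1.2 (acc.getD p.1.2 0 + v))) zero s.1
      let others ← filterR (fun u => charge 5 (u != k && ureg.getD u 0 == ureg.getD k 0)) units
      match ← argmaxR (fun u => charge 1 (shared.getD u 0)) others with
      | none => return (s, false)
      | some (u, v) =>
        if 0 < v then do
          let ids ← mapR (fun (p : Part × ℕ) => charge 1 p.2) c
          let ps ← mapR (fun (p : Part × ℕ) => do
            let m ← memR p.2 ids
            charge 3 (if m then ((p.1.1, u), p.2) else p)) s.1
          charge 5 ((ps, c' :: rest), true)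
        else charge 1 (s, false)
    else charge 2 (s, false)
  | _, _ => charge 2 (s, false)

theorem numberedWeight_map {ps : List (Part × ℕ)} {g : Part × ℕ → Part × ℕ}
    (hg : ∀ p, (g p).1.1 = p.1.1) : numberedWeight (ps.map g) = numberedWeight ps := by
  simp [numberedWeight, Function.comp_def, hg]

theorem length_le_numberedWeight (ps : List (Part × ℕ)) : ps.length ≤ numberedWeight ps :=
  length_le_sum_map (by simp)

/-- The size of the component to be examined next. -/
def headWeight (cs : List (ℝ × List (Part × ℕ) × List Seg)) : ℕ :=
  match cs with
  | [] => 1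
  | c :: _ => c.2.1.length + c.2.2.length + 1

theorem one_le_headWeight (cs : List (ℝ × List (Part × ℕ) × List Seg)) : 1 ≤ headWeight cs := by
  unfold headWeight
  split <;> omega

theorem headWeight_le (cs : List (ℝ × List (Part × ℕ) × List Seg)) :
    headWeight cs ≤ componentsWeight cs + 1 := by
  cases cs with
  | nil => simp [headWeight]
  | cons c cs => simp [headWeight, componentsWeight]; omega

/-- The common perimeters and the relabelling take time `W` times the size of the first component. A
pass either stops with the state unchanged or removes that component for good; relabelled parts keep
their edges, so the weight is unchanged. -/
theorem cleanPass_spec {θ : ℝ} {N : ℕ} {ureg : Array ℕ} {k : ℕ} {units : List ℕ} {W : ℕ}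
    (hu : units.length = N) (hN : N ≤ W)
    {s : List (Part × ℕ) × List (ℝ × List (Part × ℕ) × List Seg)}
    (hs : numberedWeight s.1 ≤ W) (hs2 : s.2.length ≤ W) :
    Spec (cleanPass θ N ureg k units s) (59 * (W + 1) * headWeight s.2) (fun r =>
      (r.2 = false ∧ r.1 = s) ∨ (numberedWeight r.1.1 ≤ W ∧ ∃ c, s.2 = c :: r.1.2)) := by
  have hw1 := one_le_headWeight s.2
  have hw2 : W + 1 ≤ (W + 1) * headWeight s.2 := Nat.le_mul_of_pos_right _ (by omega)
  unfold cleanPass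
  refine Within.spec (Within.bind (Spec.lastR s.2) fun big _ => ?_)
  split
  · rename_i a c es c' rest b _ heq _
    have hhw : headWeight s.2 = c.length + es.length + 1 := by rw [heq]; rfl
    have hpl := length_le_numberedWeight s.1
    have heqw := numberedWeight_eq s.1
    refine Within.ite (fun _ => ?_) fun _ => Within.charge (by nlinarith) (Or.inl ⟨rfl, rfl⟩)
    refine Within.bind (Spec.allocR N (0 : ℝ)) fun zero _ => ?_
    refine Within.bind (Spec.cost_le (foldR_cost_le
      (c := fun p => 21 * es.length * p.1.1.length + (2 * es.length + 5)) fun acc p _ => ?_))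
      fun shared _ => ?_
    · have := sharedR_cost_le es p.1.1
      simp only [bind_cost, charge_cost]
      nlinarith
    rw [sum_map_add_const, sum_map_mul_const]
    refine Within.bind (Spec.filterR_const (K := 5) (by simp)) fun others hothers => ?_
    have hol : others.length ≤ N := by
      rw [← hu, hothers]
      exact List.length_filter_le _ _
    have e1 : 21 * es.length * (s.1.map fun p => p.1.1.length).sum ≤ 21 * es.length * W :=
      Nat.mul_le_mul_left _ (by omega)
    have e2 : (2 * es.length + 5) * s.1.length ≤ (2 * es.length + 5) * W :=
      Nat.mul_le_mul_left _ (by omega)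
    have e3 : 59 * (W + 1) * headWeight s.2 = 59 * (W + 1) * c.length + 59 * es.length * W +
      59 * es.length + 59 * W + 59 := by rw [hhw]; ring
    rw [hu, e3]
    refine Within.bind (Spec.cost_le (argmaxR_cost_le (c := fun _ => 1) (by simp))) fun best _ => ?_
    simp only [List.map_const', List.sum_replicate, smul_eq_mul, mul_one]
    have e4 : (2 * es.length + 5) * W = 2 * (es.length * W) + 5 * W := by ring
    have e5 : 21 * es.length * W = 21 * (es.length * W) := by ring
    have e6 : 59 * es.length * W = 59 * (es.length * W) := by ring
    have e7 : (2 * c.length + 2 + 3 + 2) * s.1.length ≤ (2 * c.length + 7) * W :=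
      Nat.mul_le_mul_left _ (by omega)
    have e8 : (2 * c.length + 7) * W = 2 * (c.length * W) + 7 * W := by ring
    have e9 : 59 * (W + 1) * c.length = 59 * (c.length * W) + 59 * c.length := by ring
    rw [e4] at e2
    rw [e5] at e1
    rw [e8] at e7
    rw [e6, e9]
    generalize hz : (2 * c.length + 2 + 3 + 2) * s.1.length = z1 at *
    generalize c.length * W = z2 at *
    generalize es.length * W = z3 at *
    generalize 21 * es.length * (s.1.map fun p => p.1.1.length).sum = z4 at *
    generalize (2 * es.length + 5) * s.1.length = z5 at *
    clear hw2 e3 e4 e5 e6 e8 e9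
    split
    · exact Within.pure (by omega) (Or.inl ⟨rfl, rfl⟩)
    · refine Within.ite (fun _ => ?_) fun _ => Within.charge (by omega) (Or.inl ⟨rfl, rfl⟩)
      refine Within.bind (Spec.mapR_const (K := 1) (by simp)) fun ids hids => ?_
      have hil : ids.length = c.length := by simp [hids]
      refine Within.bind (Spec.mapR_const (K := 2 * c.length + 2 + 3) fun p _ => ?_) fun ps hps => ?_
      · have := memR_cost_le p.2 ids
        simp only [bind_cost, charge_cost]
        omega
      refine Within.charge ?_ (Or.inr ⟨?_, _, heq⟩)
      · rw [hz]
        omega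
      · simp only
        rw [hps, numberedWeight_map]
        · exact hs
        · intro p
          simp only [bind_val, charge_val]
          split_ifs <;> rfl
  · exact Within.charge (by nlinarith) (Or.inl ⟨rfl, rfl⟩)

theorem numberedWeight_filter_le (ps : List (Part × ℕ)) (p : Part × ℕ → Bool) :
    numberedWeight (ps.filter p) ≤ numberedWeight ps := sum_map_filter_le _ _ _

/-- Components are consumed one by one, so passes proportional to the size of the current component
sum to `O(W ^ 2)`, the same as the search for components. -/
theorem cleanUnit_spec {θ : ℝ} {N : ℕ} {ureg : Array ℕ} {parts : List (Part × ℕ)} {W : ℕ}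
    (hN : N ≤ W) (h : numberedWeight parts ≤ W) (k : ℕ) :
    Spec (cleanUnit θ N ureg parts k) (1000 * (W + 1) ^ 2) (fun r => numberedWeight r ≤ W) := by
  unfold cleanUnit
  refine Within.spec (Within.bind (Spec.filterR_const (K := 1) (by simp)) fun mine hmine => ?_)
  have hm : numberedWeight mine ≤ W := (hmine ▸ numberedWeight_filter_le parts _).trans h
  have hpl := (length_le_numberedWeight parts).trans h
  have hml := (length_le_numberedWeight mine).trans hm
  refine Within.bind (componentsR_spec (fun p => p.1.1.length + 1) 11 (by simp)
    fun p p' => touchR_cost_le_mul p.1.1 p'.1.1) fun comps hcomps => ?_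
  obtain ⟨hc1, hc2⟩ := hcomps
  have hcw : (comps.map numberedWeight).sum ≤ W := by
    have := sum_map_flatten comps fun p : Part × ℕ => p.1.1.length + 1
    rw [(hc1.map _).sum_eq] at this
    exact this.symm.le.trans hm
  have hcl : comps.length ≤ W := (length_flatten_le hc2).trans (hc1.length_eq.le.trans hml)
  have key : ∀ c ∈ comps, Spec (do
      let es ← mapR (fun (p : Part × ℕ) => charge 1 p.1.1) c
      let es ← concatR es
      let a ← areaR es
      charge 2 (a, c, es) : Run (ℝ × List (Part × ℕ) × List Seg)) (10 * numberedWeight c + 10)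
      (fun r => r.2.1.length + r.2.2.length = numberedWeight c) := by
    intro c _
    refine Within.spec (Within.bind (Spec.mapR_const (K := 1) (by simp)) fun es hes => ?_)
    refine Within.bind (Spec.concatR es) fun es' hes' => ?_
    have h1 : es.length = c.length := by simp [hes]
    have h2 : es'.length = (c.map fun p => p.1.1.length).sum := by
      rw [hes', List.length_flatten, hes, List.map_map]
      rfl
    rw [← hes']
    have h3 := numberedWeight_eq c
    refine Within.bind (Spec.cost_le (areaR_cost_le es')) fun a _ => Within.charge (by omega) ?_
    simp only
    omega
  refine Within.bind (Spec.mapR fun c hc => (key c hc).1) fun sized hsized => ?_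
  rw [sum_map_add_const comps, sum_map_mul_const comps]
  have hsw : componentsWeight sized ≤ 2 * W := by
    rw [componentsWeight, sum_map_add_const, hsized, List.map_map, List.length_map]
    have := sum_map_le_sum fun c hc => (key c hc).2.le
    simp only [Function.comp_def] at this ⊢
    omega
  have hsl : sized.length = comps.length := by simp [hsized]
  refine Within.bind (sortR_spec Prod.fst sized) fun sorted hsorted => ?_
  have hsl' := hsorted.length_eq
  have hsw' : componentsWeight sorted ≤ 2 * W := ((hsorted.map _).sum_eq.le).trans hsw
  refine Within.bind (Spec.lengthR sorted) fun n _ => ?_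
  refine Within.bind (Spec.rangeR 0 N) fun units hunits => ?_
  have hul : units.length = N := by simp [hunits]
  have hloop := whileR_decreasing (body := cleanPass θ N ureg k units)
    (fun s => numberedWeight s.1 ≤ W ∧ s.2.length ≤ W ∧ componentsWeight s.2 ≤ 2 * W)
    -- Of the factor 60, the pass takes 59 and the rest covers loop control. The last pass may
    -- inspect a component without removing it and gets an allowance of its own.
    (fun s => 60 * (W + 1) * componentsWeight s.2) (60 * (W + 1) * (2 * W + 1))
    (fun s hs => by
      obtain ⟨h1, h2, h3⟩ := hs
      obtain ⟨h4, h5⟩ := cleanPass_spec (θ := θ) (ureg := ureg) (k := k) hul hN h1 h2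
      have h6 := one_le_headWeight s.2
      have h7 : 1 ≤ (W + 1) * headWeight s.2 := Nat.mul_pos (by omega) (by omega)
      have h8 := headWeight_le s.2
      rcases h5 with ⟨h9, h10⟩ | ⟨h9, c, h10⟩
      · rw [h9, h10]
        refine ⟨⟨h1, h2, h3⟩, by simp, fun _ => ?_⟩
        have : (W + 1) * headWeight s.2 ≤ (W + 1) * (2 * W + 1) := Nat.mul_le_mul_left _ (by omega)
        nlinarith
      · have h11 : componentsWeight s.2 = headWeight s.2 +
            componentsWeight (cleanPass θ N ureg k units s).val.1.2 := by
          rw [h10]; simp [componentsWeight, headWeight]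
        have h12 : s.2.length = (cleanPass θ N ureg k units s).val.1.2.length + 1 := by
          rw [h10]; simp
        have h13 : 60 * (W + 1) * componentsWeight s.2 = 60 * ((W + 1) * headWeight s.2) +
            60 * (W + 1) * componentsWeight (cleanPass θ N ureg k units s).val.1.2 := by
          rw [h11]; ring
        have h14 : 59 * (W + 1) * headWeight s.2 = 59 * ((W + 1) * headWeight s.2) := by ring
        rw [h14] at h4
        rw [h13]
        exact ⟨⟨h9, by omega, by omega⟩, fun _ => by omega, fun _ => by omega⟩) (n + 1) (parts, sorted) ⟨h, by simp only; omega, hsw'⟩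
  refine Within.bind ⟨(Nat.le_add_right _ _).trans hloop.2, hloop.1.1⟩ fun r hr => Within.pure ?_ hr
  have e1 : 60 * (W + 1) * componentsWeight sorted ≤ 60 * (W + 1) * (2 * W) :=
    Nat.mul_le_mul_left _ hsw'
  have e2 : (2 * sized.length + 3) * sized.length ≤ (2 * W + 3) * W :=
    Nat.mul_le_mul (by omega) (by omega)
  have e3 : ((mine.map fun p => p.1.1.length + 1).sum + 1) ^ 2 ≤ (W + 1) ^ 2 :=
    Nat.pow_le_pow_left (Nat.add_le_add_right hm 1) 2
  simp only
  nlinarith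

/-- The assigned pieces add at most `2 * M` to the weight: their edges, and one for each piece.
Reassignment changes labels only, so the same `W` serves for every unit. -/
theorem cleanUp_spec {θ : ℝ} {N M W : ℕ} {ureg : Array ℕ} {ps : List Piece} {filled : List Part}
    (h : PiecesBound N M ps) (hW : partWeight filled + 2 * M ≤ W) (hN : N ≤ W) :
    Spec (cleanUp θ N ureg ps filled) (1020 * (N + 1) * (W + 1) ^ 2)
      (fun parts => partWeight parts ≤ W) := by
  have h1 := h.length_le
  have h2 := h.sum_edges_le
  unfold cleanUp
  refine Within.spec (Within.bind (Spec.foldR_rest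
    (fun rest acc => partWeight acc + (rest.map fun q => q.edges.length + 1).sum ≤ W)
    (fun _ => 2) ?_ fun q rest acc hacc => Spec.charge ?_) fun all hall => ?_)
  · rw [sum_map_add_const]
    omega
  · simp only [List.map_cons, List.sum_cons] at hacc
    split
    · rw [partWeight_cons]
      simp only
      omega
    · omega
  · simp only [List.map_nil, List.sum_nil, add_zero] at hall
    have hal := length_le_partWeight all
    simp only [List.map_const', List.sum_replicate, smul_eq_mul]
    refine Within.bind (Spec.numberR all) fun allN hallN => ?_
    refine Within.bind (Spec.rangeR 0 N) fun units hunits => ?_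
    have hul : units.length = N := by simp [hunits]
    have hw : numberedWeight allN ≤ W := by
      rw [hallN, numberedWeight, sum_zipIdx all fun p => p.1.length + 1]
      exact hall
    refine Within.bind (Spec.foldR_const (fun r => numberedWeight r ≤ W) _ hw
      fun k _ parts hparts => cleanUnit_spec hN hparts k) fun r hr => ?_
    have hrl := length_le_numberedWeight r
    refine Within.last (Spec.mapR_const (K := 1) (by simp)) ?_ fun parts hparts => ?_
    · rw [hul]
      have e1 : W + 1 ≤ (W + 1) ^ 2 := Nat.le_self_pow (by omega) _
      nlinarith
    · rw [hparts, partWeight, List.map_map]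
      exact hr

theorem boundariesR_spec {W : ℕ} {parts : List Part} (h : partWeight parts ≤ W) :
    Spec (boundariesR parts) (40 * (W + 1) ^ 2) (fun bs => bs.length ≤ W) := by
  have h1 := partWeight_eq parts
  unfold boundariesR
  refine Within.spec (Within.bind (Spec.mapR (c := fun p => (17 * W + 6) * p.1.length + 1)
    fun p _ => (Spec.mapR_const (K := 17 * W + 4) fun e _ => ?_).1) fun bs hbs => ?_)
  · have := (Spec.findR (l := parts) (c := fun p' => 11 * p'.1.length + 5)
      (p := fun (p' : Part) => touchR [e] p'.1) fun p' _ => by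
        have := touchR_cost_le [e] p'.1
        simp at this; omega).1
    rw [sum_map_add_const, sum_map_mul_const] at this
    simp only [bind_cost, charge_cost]
    omega
  · rw [sum_map_add_const, sum_map_mul_const]
    refine Within.bind (Spec.concatR bs) fun bs' hbs' => ?_
    have hl : bs.length = parts.length := by simp [hbs]
    have hl' : bs'.length = (parts.map fun p => p.1.length).sum := by
      rw [hbs', List.length_flatten, hbs, List.map_map]
      congr 1
      refine List.map_congr_left fun p _ => ?_
      simp [mapR_val]
    rw [← hbs']
    refine Within.last (Spec.filterR_const (K := 1) (by simp)) ?_ fun r hr => ?_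
    · have : (17 * W + 6) * (parts.map fun p => p.1.length).sum ≤ (17 * W + 6) * W :=
        Nat.mul_le_mul_left _ (by omega)
      nlinarith
    · have : r.length ≤ bs'.length := hr ▸ List.length_filter_le _ _
      omega

/-! ### Conversion of rook adjacencies -/

theorem refineCircle_spec (p : Poly) :
    Spec (refineCircle p) (30 * p.length + 10) (fun q => q.length = 2 * p.length) := by
  unfold refineCircle
  refine Within.spec (Within.bind (ringEdges_spec p) fun es hes => ?_)
  have hel : es.length = p.length := by simp [hes]
  refine Within.bind (Spec.mapR_const (K := 20) (by simp)) fun ps hps => ?_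
  have hpl : ps.length = p.length := by simp [hps, hel]
  have hfl : ps.flatten.length = 2 * p.length := by
    rw [List.length_flatten, hps, List.map_map]
    simp [Function.comp_def, hel]
    omega
  refine Within.last (Spec.concatR ps) ?_ fun q hq => by rw [hq, hfl]
  omega

theorem circleR_spec : Spec circleR 3000 (fun q => q.length = 64) := by
  unfold circleR
  refine Within.spec (Within.bind (refineCircle_spec _) fun p hp => ?_)
  simp only [List.length_cons, List.length_nil] at hp ⊢
  refine Within.bind (refineCircle_spec _) fun q hq => ?_
  refine Within.bind (refineCircle_spec _) fun r hr => ?_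
  exact Within.last (refineCircle_spec _) (by omega) fun s hs => by omega

theorem diskAround_spec (circle : Poly) (adj : List BoundaryEdge) (len : ℝ) :
    Spec (diskAround circle adj len) (30 * (adj.length + 1) ^ 2 + 10 * circle.length)
      (fun d => d.length = circle.length) := by
  have key : ∀ f : BoundaryEdge → BoundaryEdge → Bool, (findR (fun (b : BoundaryEdge) => do
      let e ← anyR (fun (b' : BoundaryEdge) => charge 4 (f b b')) adj
      charge 1 (!e)) adj).cost ≤ (5 * adj.length + 4) * adj.length + 1 := by
    intro f
    refine (Spec.findR_const (K := 5 * adj.length + 3) fun b _ => ?_).1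
    have := anyR_cost_le_const (l := adj) (p := fun b' => charge 4 (f b b')) (K := 4) (by simp)
    simp only [bind_cost, charge_cost]
    omega
  unfold diskAround
  refine Within.spec (Within.bind
    (Spec.cost_le (key fun b b' => same b'.edge.2 b.edge.1)) fun first _ => ?_)
  refine Within.bind (Spec.cost_le (key fun b b' => same b'.edge.1 b.edge.2)) fun last _ => ?_
  refine Within.tick (Within.last (Spec.mapR_const (K := 8) (by simp)) ?_ fun d hd => by simp [hd])
  nlinarith

theorem separatesR_cost_le (p q : Poly) :
    (separatesR p q).cost ≤ 10 * ((p.length + 1) * (q.length + 1)) := by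
  unfold separatesR
  refine (Within.spec (Q := fun _ => True) (Within.bind (ringEdges_spec p) fun es hes => ?_)).1
  have hel : es.length = p.length := by simp [hes]
  refine Within.last (Spec.cost_le (anyR_cost_le_const (K := 9 * q.length + 3) fun e _ => ?_)) ?_
    fun _ _ => trivial
  · have := anyR_cost_le_const (l := q) (p := fun v => charge 8 (decide (0 < orient e.1 e.2 v)))
      (K := 8) (by simp)
    simp only [bind_cost, charge_cost]
    omega
  · rw [hel]
    nlinarith

theorem overlapR_cost_le (p q : Poly) :
    (overlapR p q).cost ≤ 23 * ((p.length + 1) * (q.length + 1)) := by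
  have h1 := separatesR_cost_le p q
  have h2 := separatesR_cost_le q p
  have h3 : 1 ≤ (p.length + 1) * (q.length + 1) := Nat.mul_pos (by omega) (by omega)
  rw [mul_comm (q.length + 1)] at h2
  simp only [overlapR, bind_cost, charge_cost]
  omega

/-- The fuel is the number of points, so a hull never has more vertices than the input, whatever the
wrapping does. -/
theorem hullR_spec (ps : List Pt) :
    Spec (hullR ps) (60 * (ps.length + 1) ^ 2) (fun h => h.length ≤ ps.length) := by
  unfold hullR
  refine Within.spec (Within.bind (Spec.lengthR ps) fun n hn => ?_)
  split
  · exact Within.pure (by simp) (by simp)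
  · rename_i p l
    generalize p :: l = ps at *
    refine Within.bind (Spec.cost_le (foldR_cost_le_const (K := 5) (by simp))) fun low _ => ?_
    refine Within.bind (Spec.whileR_amortized (fun m s => s.1.length + m ≤ n) (fun _ => 0)
      (41 * n + 6) (by simp) fun m s hs => ?_) fun r hr => ?_
    · have := foldR_cost_le_const (K := 40) (l := ps) (b := s.2) (f := fun (b : Pt) q => charge 40 (
        if same b s.2 then q
        else if orient s.2 b q < 0 ∨ (orient s.2 b q = 0 ∧ distance s.2 b < distance s.2 q) then q
        else b)) (by simp)
      simp only [bind_val, bind_cost, charge_val, charge_cost, List.length_cons]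
      constructor <;> omega
    · obtain ⟨m, hm⟩ := hr
      refine Within.last (Spec.reverseR r.1) ?_ fun h hh => by simp [hh]; omega
      subst hn
      nlinarith

/-- Total number of vertices. -/
def vertexCount (ds : List Poly) : ℕ := (ds.map List.length).sum

/-- One round of merging: the polygons that overlap the second component of the state are merged
with it. -/
noncomputable def mergePass (s : List Poly × Poly) : Run ((List Poly × Poly) × Bool) := do
  let p ← partitionR (overlapR s.2) s.1
  match p.1 with
  | [] => charge 1 (s, false)
  | _ :: _ => do
    let vs ← concatR (s.2 :: p.1)
    let h ← hullR vs
    charge 2 ((p.2, h), true)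

/-- Each pass that goes on removes at least one polygon from the list, and taking the hull does not
increase the total number of vertices. The latter keeps the quadratic cost of all passes under the
same bound. -/
theorem mergePass_spec {V L : ℕ} {s : List Poly × Poly} (h1 : s.2.length + vertexCount s.1 ≤ V)
    (h2 : s.1.length ≤ L) (hL : L ≤ V) :
    Spec (mergePass s) (200 * (V + 1) ^ 2) (fun r =>
      r.1.2.length + vertexCount r.1.1 ≤ s.2.length + vertexCount s.1 ∧
      (r.2 = false ∧ r.1 = s ∨ r.1.1.length + 1 ≤ s.1.length)) := by
  unfold mergePass
  have hp := partitionR_val (overlapR s.2) s.1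
  have hc := partitionR_cost (overlapR s.2) s.1
  have hsum : (s.1.map fun q => (overlapR s.2 q).cost).sum ≤
      23 * (s.2.length + 1) * (vertexCount s.1 + s.1.length) := by
    refine (sum_map_le_sum fun q _ => overlapR_cost_le s.2 q).trans ?_
    have : ∀ q : Poly, 23 * ((s.2.length + 1) * (q.length + 1)) =
      23 * (s.2.length + 1) * (q.length + 1) := fun q => by ring
    simp only [this]
    rw [sum_map_mul_const, sum_map_add_const, one_mul]
    rfl
  have hsum' : 23 * (s.2.length + 1) * (vertexCount s.1 + s.1.length) ≤ 23 * (V + 1) * (2 * V) :=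
    Nat.mul_le_mul (by omega) (by omega)
  refine Within.spec (Within.bind (k₁ := 23 * (V + 1) * (2 * V) + 2 * V + 1)
    (Q := fun p => p = (s.1.filter fun a => (overlapR s.2 a).val,
      s.1.filter fun a => !(overlapR s.2 a).val))
    ⟨by rw [hc]; omega, hp⟩ fun p hp => ?_)
  have hpv : vertexCount p.1 + vertexCount p.2 = vertexCount s.1 := by
    rw [hp]
    have := ((List.filter_append_perm (fun a => (overlapR s.2 a).val) s.1).map List.length).sum_eq
    rw [List.map_append, List.sum_append] at this
    exact this
  have hpl : p.1.length + p.2.length = s.1.length := by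
    rw [hp]
    have := (List.filter_append_perm (fun a => (overlapR s.2 a).val) s.1).length_eq
    rw [List.length_append] at this
    exact this
  split
  · exact Within.charge (by nlinarith) ⟨le_rfl, Or.inl ⟨rfl, rfl⟩⟩
  · rename_i d l heq
    have hpos : 1 ≤ p.1.length := by rw [heq]; simp
    refine Within.bind (Spec.concatR (s.2 :: p.1)) fun vs hvs => ?_
    have hvl : vs.length = s.2.length + vertexCount p.1 := by
      rw [hvs]
      simp [vertexCount]
    rw [← hvs]
    refine Within.bind (hullR_spec vs) fun h hh => Within.charge ?_ ⟨?_, Or.inr ?_⟩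
    · have : (vs.length + 1) ^ 2 ≤ (V + 1) ^ 2 := Nat.pow_le_pow_left (by omega) 2
      simp only [List.length_cons]
      nlinarith
    · simp only
      omega
    · simp only
      omega

/-- Every disk enters once, and every merging pass removes a polygon, so the number of passes is
linear; with quadratic cost per pass the total is cubic. Here 64 is the number of vertices of a
disk. -/
theorem mergeDisks_spec {disks : List Poly} {L : ℕ} (hL : disks.length ≤ L)
    (hd : ∀ d ∈ disks, d.length = 64) :
    Spec (mergeDisks disks) (2000000 * (L + 1) ^ 3)
      (fun r => vertexCount r ≤ 64 * L ∧ r.length ≤ L) := by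
  unfold mergeDisks
  have key := foldR_amortized (f := fun (acc : List Poly) (d : Poly) => do
      let n ← lengthR acc
      let r ← whileR mergePass (n + 1) (acc, d)
      charge 1 (r.2 :: r.1))
    (fun rest acc => vertexCount acc + 64 * rest.length ≤ 64 * L ∧ acc.length + rest.length ≤ L ∧
      ∀ d ∈ rest, d.length = 64)
    (fun acc => (200 * (64 * L + 1) ^ 2 + 1) * acc.length)
    -- For each disk: the last, unsuccessful pass, and a deposit that pays for the pass in which the
    -- resulting polygon is absorbed later.
    (fun _ => 2 * (200 * (64 * L + 1) ^ 2 + 1) + L + 2)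
    (fun d rest acc hacc => by
      obtain ⟨h1, h2, h3⟩ := hacc
      have hd' := h3 d (by simp)
      simp only [List.length_cons] at h1 h2
      generalize hP : 200 * (64 * L + 1) ^ 2 = P
      obtain ⟨⟨h4, h5⟩, h6⟩ := whileR_decreasing (body := mergePass)
        (fun s => s.2.length + vertexCount s.1 ≤ 64 + vertexCount acc ∧ s.1.length ≤ acc.length)
        (fun s => (P + 1) * s.1.length) P
        (fun s hs => by
          obtain ⟨h7, h8, h9⟩ := mergePass_spec (V := 64 * L) (L := L) (s := s)
            (by omega) (by omega) (by omega)
          rw [hP] at h7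
          rcases h9 with ⟨h9, h10⟩ | h9
          · rw [h9, h10]
            exact ⟨hs, by simp, fun _ => by omega⟩
          · have h10 : (P + 1) * ((mergePass s).val.1.1.length + 1) ≤ (P + 1) * s.1.length :=
              Nat.mul_le_mul_left _ h9
            rw [mul_add] at h10
            exact ⟨⟨h8.trans hs.1, by omega⟩, fun _ => by omega, fun _ => by omega⟩) (acc.length + 1) (acc, d) ⟨by simp only; omega, le_rfl⟩
      refine ⟨⟨?_, ?_, fun x hx => h3 x (by simp [hx])⟩, ?_⟩
      · simp only [bind_val, lengthR, charge_val, vertexCount, List.map_cons, List.sum_cons] at h4 ⊢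
        simp only [vertexCount] at h1
        omega
      · simp only [bind_val, lengthR, charge_val, List.length_cons]
        omega
      · simp only [bind_val, bind_cost, lengthR, charge_val, charge_cost, List.length_cons]
        simp only at h6
        rw [mul_add]
        omega) disks [] ⟨by simp [vertexCount]; omega, by simpa using hL, hd⟩
  obtain ⟨⟨h1, h2, _⟩, h3⟩ := key
  refine ⟨?_, Nat.le_of_add_right_le h1, Nat.le_of_add_right_le h2⟩
  refine (Nat.le_add_right _ _).trans (h3.trans ?_)
  simp only [List.map_const', List.sum_replicate, smul_eq_mul, List.length_nil, mul_zero, zero_add]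
  have e1 := Nat.mul_le_mul_right (2 * (200 * (64 * L + 1) ^ 2 + 1) + L + 2) hL
  have e2 : (64 * L + 1) ^ 2 ≤ (64 * (L + 1)) ^ 2 := Nat.pow_le_pow_left (by omega) 2
  have e3 : L * (64 * L + 1) ^ 2 ≤ (L + 1) * (64 * (L + 1)) ^ 2 := Nat.mul_le_mul (by omega) e2
  have e4 : (L + 1) * (64 * (L + 1)) ^ 2 = 4096 * (L + 1) ^ 3 := by ring
  have e5 : L * (2 * (200 * (64 * L + 1) ^ 2 + 1) + L + 2) =
    400 * (L * (64 * L + 1) ^ 2) + L * L + 4 * L := by ring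
  have e6 : L * L + 5 * L + 1 ≤ 10 * (L + 1) ^ 3 := by
    have : (L + 1) ^ 2 ≤ (L + 1) ^ 3 := Nat.pow_le_pow_right (by omega) (by omega)
    nlinarith
  rw [e5] at e1
  rw [e4] at e3
  linarith

theorem centroidR_cost_le (p : Poly) : (centroidR p).cost ≤ 25 * p.length + 10 := by
  unfold centroidR
  refine (Within.spec (Q := fun _ => True) (Within.bind (ringEdges_spec p) fun es hes => ?_)).1
  have hel : es.length = p.length := by simp [hes]
  refine Within.bind (Spec.cost_le (foldR_cost_le_const (K := 20) (by simp))) fun r _ =>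
    Within.charge (by omega) trivial

theorem clipR_cost_le (e : Seg) (es : List Seg) : (clipR e es).cost ≤ 31 * es.length + 1 :=
  foldR_cost_le_const (K := 30) (by simp)

/-- Each disk produces at most three edges: the stretch before it, and a connection to the center on
either side. One edge is left at the end. The quadratic cost is that of sorting the intervals. -/
theorem reroute_spec {L : ℕ} {disks : List (List Seg × Pt)} (h1 : disks.length ≤ L)
    (h2 : (disks.map fun d => d.1.length).sum ≤ 64 * L) (b : BoundaryEdge) :
    Spec (reroute disks b) (3000 * (L + 1) ^ 2) (fun r => r.length ≤ 3 * L + 1) := by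
  unfold reroute
  refine Within.spec (Within.bind (Spec.mapR (c := fun d => 31 * d.1.length + 2) fun d _ => ?_)
    fun ivs hivs => ?_)
  · have := clipR_cost_le b.edge d.1
    simp only [bind_cost, charge_cost]
    omega
  rw [sum_map_add_const, sum_map_mul_const]
  have hl : ivs.length = disks.length := by simp [hivs]
  refine Within.bind (Spec.filterR_const (K := 5) (by simp)) fun ivs' hivs' => ?_
  have hl' : ivs'.length ≤ ivs.length := hivs' ▸ List.length_filter_le _ _
  refine Within.bind (sortR_spec _ ivs') fun ivs'' hivs'' => ?_
  have hl'' := hivs''.length_eq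
  refine Within.bind (Spec.foldR_rest (fun rest s => s.1.length + 3 * rest.length ≤ 3 * L)
    (fun _ => 40) (by simp only [List.length_nil]; omega) fun i rest s hs => Spec.charge ?_)
    fun r hr => Within.charge ?_ ?_
  · simp only [List.length_cons] at hs ⊢
    split_ifs
    all_goals
      try simp only [List.length_cons]
      omega
  · simp only [List.map_const', List.sum_replicate, smul_eq_mul]
    have : (2 * ivs'.length + 3) * ivs'.length ≤ (2 * L + 3) * L :=
      Nat.mul_le_mul (by omega) (by omega)
    nlinarith
  · simp only [List.length_nil] at hr
    split_ifs
    · simp only [List.length_cons]; omega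
    · omega

/-- The adjacencies partition a subset of the boundary edges, so there are at most `L` disks with at
most `64 * L` vertices after merging. Rerouting `L` edges at quadratic cost and merging are both
cubic. -/
theorem rookToQueen_cost_le {ε : ℝ} {bs : List BoundaryEdge} {L : ℕ} (h : bs.length ≤ L) :
    (rookToQueen ε bs).cost ≤ 3000000 * (L + 1) ^ 3 := by
  unfold rookToQueen
  refine (Within.spec (Q := fun _ => True) (Within.bind (Spec.filterR_const (K := 3) (by simp))
    fun inner hinner => ?_)).1
  have hil : inner.length ≤ bs.length := hinner ▸ List.length_filter_le _ _
  refine Within.bind (componentsR_spec (fun _ => 1) 20 (by simp) (by simp)) fun adjs hadjs => ?_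
  obtain ⟨ha1, ha2⟩ := hadjs
  have hal : adjs.length ≤ inner.length := (length_flatten_le ha2).trans ha1.length_eq.le
  have has : (adjs.map List.length).sum = inner.length := by
    rw [← List.length_flatten]
    exact ha1.length_eq
  simp only [List.map_const', List.sum_replicate, smul_eq_mul, mul_one]
  refine Within.bind (Spec.mapR (c := fun c => 11 * c.length + 2) fun c _ => ?_)
    fun sized hsized => ?_
  · have := foldR_cost_le_const (K := 10) (l := c) (b := 0) (f := fun (s : ℝ) (b : BoundaryEdge) =>
      charge 10 (s + distance b.edge.1 b.edge.2)) (by simp)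
    simp only [bind_cost, charge_cost]
    omega
  rw [sum_map_add_const, sum_map_mul_const, has]
  have hsl : sized.length = adjs.length := by simp [hsized]
  have hss : (sized.map fun c => c.1.length).sum = inner.length := by
    rw [hsized, List.map_map, ← has]
    rfl
  refine Within.bind (Spec.filterR_const (K := 1) (by simp)) fun small hsmall => ?_
  have hml : small.length ≤ sized.length := hsmall ▸ List.length_filter_le _ _
  have hms : (small.map fun c => c.1.length).sum ≤ inner.length :=
    (hsmall ▸ sum_map_filter_le sized _ _).trans hss.le
  refine Within.bind circleR_spec fun circle hcircle => ?_
  refine Within.bind (Spec.mapR (c := fun c => 30 * (L + 1) * c.1.length + (30 * (L + 1) + 640))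
    fun c hc => ?_) fun disks hdisks => ?_
  · have h1 := (diskAround_spec circle c.1 c.2).1
    have h2 : c.1.length ≤ L := (le_sum_map hc fun c => c.1.length).trans (by omega)
    have h3 : (c.1.length + 1) * (c.1.length + 1) ≤ (L + 1) * (c.1.length + 1) :=
      Nat.mul_le_mul_right _ (by omega)
    rw [hcircle] at h1
    nlinarith
  rw [sum_map_add_const, sum_map_mul_const]
  have hdl : disks.length = small.length := by simp [hdisks]
  refine Within.bind (mergeDisks_spec (L := L) (by omega) fun d hd => ?_) fun merged hmerged => ?_
  · rw [hdisks, List.mem_map] at hd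
    obtain ⟨c, _, rfl⟩ := hd
    rw [(diskAround_spec circle c.1 c.2).2, hcircle]
  obtain ⟨hv1, hv2⟩ := hmerged
  refine Within.bind (Spec.mapR (c := fun d => 27 * d.length + 13) fun d _ => ?_)
    fun disks' hdisks' => ?_
  · have h1 := (ringEdges_spec d).1
    have h2 := centroidR_cost_le d
    simp only [bind_cost, charge_cost]
    omega
  rw [sum_map_add_const, sum_map_mul_const]
  have hl1 : disks'.length ≤ L := by simpa [hdisks'] using hv2
  have hl2 : (disks'.map fun d => d.1.length).sum ≤ 64 * L := by
    rw [hdisks', List.map_map]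
    simpa [Function.comp_def, length_ringEdges, vertexCount] using hv1
  refine Within.bind (Spec.mapR_const fun b _ => (reroute_spec hl1 hl2 b).1) fun rs hrs => ?_
  have hrl : rs.length = bs.length := by simp [hrs]
  have hrf : rs.flatten.length ≤ (3 * L + 1) * bs.length := by
    rw [List.length_flatten, hrs, List.map_map]
    exact sum_map_le_mul fun b _ => (reroute_spec hl1 hl2 b).2
  refine Within.last (Spec.concatR rs) ?_ fun _ _ => trivial
  have e1 : (3 * L + 1) * bs.length ≤ (3 * L + 1) * L := Nat.mul_le_mul_left _ h
  have e2 : (3000 * (L + 1) ^ 2 + 2) * bs.length ≤ (3000 * (L + 1) ^ 2 + 2) * L :=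
    Nat.mul_le_mul_left _ h
  have e3 : (inner.length + 1) ^ 2 ≤ (L + 1) ^ 2 := Nat.pow_le_pow_left (by omega) 2
  have e4 : 30 * (L + 1) * (small.map fun c => c.1.length).sum ≤ 30 * (L + 1) * L :=
    Nat.mul_le_mul_left _ (by omega)
  have e5 : (30 * (L + 1) + 640) * small.length ≤ (30 * (L + 1) + 640) * L :=
    Nat.mul_le_mul_left _ (by omega)
  have e6 : (merged.map fun d => d.length).sum ≤ 64 * L := hv1
  have p2 : (L + 1) ^ 2 ≤ (L + 1) ^ 3 := Nat.pow_le_pow_right (by omega) (by omega)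
  have p1 : L + 1 ≤ (L + 1) ^ 3 := Nat.le_self_pow (by omega) _
  have f1 : (3 * L + 1) * L + 2 * L + 1 ≤ 3 * (L + 1) ^ 2 := by nlinarith
  have f2 : (3000 * (L + 1) ^ 2 + 2) * L + 3000 * (L + 1) ^ 2 = 3000 * (L + 1) ^ 3 + 2 * L := by ring
  have f4 : 30 * (L + 1) * L + 30 * (L + 1) = 30 * (L + 1) ^ 2 := by ring
  have f5 : (30 * (L + 1) + 640) * L + 30 * (L + 1) = 30 * (L + 1) ^ 2 + 640 * L := by ring
  linarith

/-! ### The whole algorithm -/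

/-- With `M = 8 * (E + 1) ^ 2` and total part weight at most `1002 * M`, the sixth power is reached
by the overlaps, the gaps and the rook-to-queen conversion; the other phases stay below. The last of
these three determines the size of the constant. -/
theorem smartRepair_cost_le {T : List Poly} (θ : ℝ) {regions : Option (List Poly)} (rook : Option ℝ)
    (hT : ∀ P ∈ T, 3 ≤ P.length) (hR : ∀ P ∈ regions.getD [], 3 ≤ P.length) {E : ℕ}
    (hE : edgeCount T + edgeCount (regions.getD []) = E) :
    (smartRepair T θ regions rook).cost ≤ 10 ^ 20 * (E + 1) ^ 6 := by
  have hTE := length_le_edgeCount hT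
  have hX1 : E + 1 ≤ (E + 1) ^ 2 := Nat.le_self_pow (by omega) _
  unfold smartRepair
  refine (Within.spec (Q := fun _ => True) (Within.bind (Spec.lengthR T) fun N hN => ?_)).1
  refine Within.bind (refinedTiling_spec hT hR hE) fun ⟨pieces, ureg⟩ hpieces => ?_
  simp only at hpieces ⊢
  rw [← hN] at hpieces ⊢
  have hNE : N ≤ E := by omega
  generalize hM : 8 * (E + 1) ^ 2 = M at *
  refine Within.bind (assignOverlaps_spec hpieces (by omega)) fun pieces' hpieces' => ?_
  refine Within.bind (closeGaps_spec hpieces') fun filled hfilled => ?_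
  -- The polygons from the gaps have weight at most `1000 * M`, the assigned pieces at most `2 * M`.
  refine Within.bind (cleanUp_spec (W := 1002 * M) hpieces' (by omega) (by omega))
    fun parts hparts => ?_
  refine Within.bind (boundariesR_spec hparts) fun bs hbs => ?_
  have hM1 : M + 1 ≤ 9 * (E + 1) ^ 2 := by omega
  have hW1 : 1002 * M + 1 ≤ 9000 * (E + 1) ^ 2 := by omega
  have c1 : 1000000 * (E + 1) ^ 5 ≤ 1000000 * (E + 1) ^ 6 :=
    Nat.mul_le_mul_left _ (Nat.pow_le_pow_right (by omega) (by omega))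
  have c2 : 700 * (N + 1) ^ 2 * (M + 1) ^ 2 ≤ 56700 * (E + 1) ^ 6 :=
    calc 700 * (N + 1) ^ 2 * (M + 1) ^ 2 ≤ 700 * (E + 1) ^ 2 * (9 * (E + 1) ^ 2) ^ 2 := by
          gcongr
      _ = 56700 * (E + 1) ^ 6 := by ring
  have c3 : 2000000000 * (M + 1) ^ 3 ≤ 1458000000000 * (E + 1) ^ 6 :=
    calc 2000000000 * (M + 1) ^ 3 ≤ 2000000000 * (9 * (E + 1) ^ 2) ^ 3 := by gcongr
      _ = 1458000000000 * (E + 1) ^ 6 := by ring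
  have c4 : 1020 * (N + 1) * (1002 * M + 1) ^ 2 ≤ 82620000000 * (E + 1) ^ 6 :=
    calc 1020 * (N + 1) * (1002 * M + 1) ^ 2 ≤ 1020 * (E + 1) * (9000 * (E + 1) ^ 2) ^ 2 := by
          gcongr
      _ = 82620000000 * (E + 1) ^ 5 := by ring
      _ ≤ _ := Nat.mul_le_mul_left _ (Nat.pow_le_pow_right (by omega) (by omega))
  have c5 : 40 * (1002 * M + 1) ^ 2 ≤ 3240000000 * (E + 1) ^ 6 :=
    calc 40 * (1002 * M + 1) ^ 2 ≤ 40 * (9000 * (E + 1) ^ 2) ^ 2 := by gcongr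
      _ = 3240000000 * (E + 1) ^ 4 := by ring
      _ ≤ _ := Nat.mul_le_mul_left _ (Nat.pow_le_pow_right (by omega) (by omega))
  have c6 : N + 1 ≤ (E + 1) ^ 6 := le_trans (by omega) (Nat.le_self_pow (by omega) (E + 1))
  have c7 : 3000000 * (1002 * M + 1) ^ 3 ≤ 2187000000000000000 * (E + 1) ^ 6 :=
    calc 3000000 * (1002 * M + 1) ^ 3 ≤ 3000000 * (9000 * (E + 1) ^ 2) ^ 3 := by gcongr
      _ = 2187000000000000000 * (E + 1) ^ 6 := by ring
  clear hX1 hM hM1 hW1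
  split
  · refine Within.pure ?_ trivial
    linarith
  · refine Within.last (Spec.cost_le (rookToQueen_cost_le hbs)) ?_ fun _ _ => trivial
    linarith

end SmartRepair

/-! ### The bound in terms of the number of edges. -/

theorem theorem5p1 :
    ∃ C : ℕ, ∀ T : List SmartRepair.Poly, T ≠ [] → (∀ P ∈ T, 3 ≤ P.length) →
      (∀ θ : ℝ,
        (SmartRepair.primarySmartRepair T θ).cost ≤ C * SmartRepair.edgeCount T ^ 6) ∧
      (∀ (θ : ℝ) (regions : Option (List SmartRepair.Poly)) (rook : Option ℝ),
        (∀ P ∈ regions.getD [], 3 ≤ P.length) →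
        (SmartRepair.smartRepair T θ regions rook).cost ≤
          C * (SmartRepair.edgeCount T + SmartRepair.edgeCount (regions.getD [])) ^ 6) := by
  -- The factor `2 ^ 6` absorbs the passage from `E + 1` to `E`; a non-empty family of polygons has
  -- at least one edge, so `E + 1 ≤ 2 * E`.
  refine ⟨10 ^ 20 * 2 ^ 6, fun T hT0 hT => ?_⟩
  have hpos : 1 ≤ SmartRepair.edgeCount T :=
    (List.length_pos_iff.2 hT0).trans_le (SmartRepair.length_le_edgeCount hT)
  have hall : ∀ (θ : ℝ) (regions : Option (List SmartRepair.Poly)) (rook : Option ℝ),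
      (∀ P ∈ regions.getD [], 3 ≤ P.length) →
      (SmartRepair.smartRepair T θ regions rook).cost ≤ 10 ^ 20 * 2 ^ 6 *
        (SmartRepair.edgeCount T + SmartRepair.edgeCount (regions.getD [])) ^ 6 := by
    intro θ regions rook hR
    refine (SmartRepair.smartRepair_cost_le θ rook hT hR rfl).trans ?_
    rw [mul_assoc, ← mul_pow]
    exact Nat.mul_le_mul_left _ (Nat.pow_le_pow_left (by omega) 6)
  refine ⟨fun θ => ?_, hall⟩
  have := hall θ none none (by simp)
  simpa [SmartRepair.primarySmartRepair, SmartRepair.edgeCount] using this
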